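/- Let $d\ge 1$ and let $\mu_X,\Delta_X\in\mathbb R$ be given for every finite $X\subset\mathbb Z^d$. Let $J=\{J_X\}$ and $\widetilde J=\{\widetilde J_X\}$ be families of Gaussian random variables, all mutually independent, such that $J_X$ and $\widetilde J_X$ both have mean $\mu_X$ and variance $\Delta_X^2$ (possibly $0$); $\mathrm{Av}$ denotes the expectation. Assume thermodynamic stability: there is a constant $\bar c<\infty$ such that for all finite nonempty $\Lambda\subset\mathbb Z^d$ $$\frac1{|\Lambda|}\sum_{X\subseteq\Lambda}|\mu_X|\le\bar c,\qquad \frac1{|\Lambda|}\sum_{X\subseteq\Lambda}\Delta_X^2\le\bar c .$$ (Translation invariance of the disorder is not required.) For finite $\Lambda'\subseteq\Lambda\subset\mathbb Z^d$ and $\sigma,\tau\in\{-1,1\}^\Lambda$ put $\sigma_X=\prod_{i\in X}\sigma_i$ for $X\neq\emptyset$, $\sigma_\emptyset=0$, and $$H_{\Lambda'}(\sigma)=-\sum_{X\subseteq\Lambda'}J_X\sigma_X,\quad H_{\Lambda\setminus\Lambda'}(\sigma)=-\sum_{X\subseteq\Lambda,\,X\not\subseteq\Lambda'}J_X\sigma_X,\quad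 \mathcal B_{\Lambda'}(\sigma)=-\sum_{X\subseteq\Lambda'}\mu_X\sigma_X,$$ $$H^0_{\Lambda'}=H_{\Lambda'}-\mathcal B_{\Lambda'},\qquad b_{\Lambda'}(\sigma)=\frac{\mathcal B_{\Lambda'}(\sigma)}{|\Lambda'|},\qquad c_{\Lambda'}(\sigma,\tau)=\frac1{|\Lambda'|}\sum_{X\subseteq\Lambda'}\Delta_X^2\sigma_X\tau_X,$$ and let $\widetilde H_{\Lambda'},\widetilde H^0_{\Lambda'}$ be defined in the same way from $\widetilde J$. Fix $\beta>0$. Given random Hamiltonians $X_t(\sigma)$, $t\in[0,\pi]$, on $\{-1,1\}^\Lambda$, let $\omega_t$ be the random probability measure on $\{-1,1\}^\Lambda$ with weights proportional to $e^{-\beta X_t(\sigma)}$, let $\omega_{t_1,\dots,t_n}=\omega_{t_1}\otimes\cdots\otimes\omega_{t_n}$ be the product measure for $n$ replicas $\sigma^{(1)},\dots,\sigma^{(n)}$, and $\langle\cdot\rangle_{t_1,\dots,t_n}=\mathrm{Av}(\omega_{t_1,\dots,t_n}(\cdot))$. Write $m_k=b_{\Lambda'}(\sigma^{(k)})$, $c_{k,l}=c_{\Lambda'}(\sigma^{(k)},\sigma^{(l)})$,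 and $$k_2(t,s)=\sin^2(t-s),\quad h_1(t,s)=(\cos t-\sin t)(\cos s-\sin s),\quad h_2(t,s)=\sin(t-s)(\cos t-\sin t).$$ Below, $\Lambda,\Lambda'\nearrow\mathbb Z^d$ means that $\Lambda'\subseteq\Lambda$ run through finite sets (along a sequence or net) such that $\Lambda'$ eventually contains every given finite subset of $\mathbb Z^d$. Then: (1) For $X_t=\cos t\,H^0_{\Lambda'}+\sin t\,\widetilde H^0_{\Lambda'}+\mathcal B_{\Lambda'}+H_{\Lambda\setminus\Lambda'}$, $$\lim_{\Lambda,\Lambda'\nearrow\mathbb Z^d}\int_0^\pi\!\!\int_0^\pi dt\,ds\;k_2(t,s)\left(\langle c_{1,2}^2\rangle_{t,s}-2\langle c_{1,2}c_{2,3}\rangle_{t,s,t}+\langle c_{1,2}c_{3,4}\rangle_{t,s,s,t}\right)=0 .$$ (2) For $X_t=\cos t\,H_{\Lambda'}+\sin t\,\widetilde H_{\Lambda'}+H_{\Lambda\setminus\Lambda'}$ and any $a>0$, $$\lim_{\substack{\Lambda,\Lambda'\nearrow\mathbb Z^d\\|\Lambda'|/|\Lambda|\to a}}\Big\{\beta^2\!\int_0^\pi\!\!\int_0^\pi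 dt\,ds\;h_1(t,s)\left[\langle m_1m_2\rangle_{t,s}-\langle m_1\rangle_t\langle m_2\rangle_s\right]+2\beta^3\!\int_0^\pi\!\!\int_0^\pi dt\,ds\;h_2(t,s)\left[\langle m_1c_{1,2}\rangle_{t,s}-\langle m_1c_{2,3}\rangle_{t,s,t}\right]$$ $$-\beta^4\!\int_0^\pi\!\!\int_0^\pi dt\,ds\;k_2(t,s)\left[\langle c_{1,2}^2\rangle_{t,s}-2\langle c_{1,2}c_{2,3}\rangle_{s,t,s}+\langle c_{1,2}c_{3,4}\rangle_{t,s,s,t}\right]\Big\}=0 .$$ -/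

import Mathlib

open MeasureTheory ProbabilityTheory Filter Topology

/-- Sites of the lattice `ℤ^d`. -/
abbrev Site (d : ℕ) : Type := Fin d → ℤ

/-- Ising spin configurations in the finite volume `Λ`; `ℤˣ = {1, -1}`. -/
abbrev SpinConfig {d : ℕ} (Λ : Finset (Site d)) : Type := Λ → ℤˣ

namespace FlipSpinGlass

noncomputable section

/-- `σ_X = ∏_{i ∈ X} σ_i` for nonempty `X ⊆ Λ`, with the convention `σ_∅ = 0`. -/
def spinProd {d : ℕ} {Λ : Finset (Site d)} (X : Finset (Site d)) (σ : SpinConfig Λ) : ℝ :=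
  if X = ∅ then 0 else ∏ i ∈ Finset.univ.filter (fun i : Λ => (i : Site d) ∈ X), ((σ i : ℤ) : ℝ)

/-- `-∑_{X ⊆ Λ'} K_X σ_X` for couplings `K`. With `K = J` this is `H_{Λ'}`, with
`K = J - μ` it is `H⁰_{Λ'}`, and with `K = μ` it is the average `𝓑_{Λ'}`. -/
def hamIn {d : ℕ} {Λ : Finset (Site d)} (K : Finset (Site d) → ℝ) (Λ' : Finset (Site d))
    (σ : SpinConfig Λ) : ℝ :=
  -∑ X ∈ Λ'.powerset, K X * spinProd X σ

/-- `H_{Λ∖Λ'}(σ) = -∑_{X ⊆ Λ, X ⊈ Λ'} K_X σ_X`. -/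
def hamOut {d : ℕ} {Λ : Finset (Site d)} (K : Finset (Site d) → ℝ) (Λ' : Finset (Site d))
    (σ : SpinConfig Λ) : ℝ :=
  -∑ X ∈ Λ.powerset with ¬ X ⊆ Λ', K X * spinProd X σ

/-- Normalized magnetization `b_{Λ'}(σ) = |Λ'|⁻¹ 𝓑_{Λ'}(σ)`. -/
def magn {d : ℕ} {Λ : Finset (Site d)} (μ : Finset (Site d) → ℝ) (Λ' : Finset (Site d))
    (σ : SpinConfig Λ) : ℝ :=
  hamIn μ Λ' σ / (Λ'.card : ℝ)

/-- Normalized covariance `c_{Λ'}(σ,τ) = |Λ'|⁻¹ ∑_{X ⊆ Λ'} Δ_X² σ_X τ_X`. -/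
def cov {d : ℕ} {Λ : Finset (Site d)} (Δ : Finset (Site d) → ℝ) (Λ' : Finset (Site d))
    (σ τ : SpinConfig Λ) : ℝ :=
  (∑ X ∈ Λ'.powerset, Δ X ^ 2 * spinProd X σ * spinProd X τ) / (Λ'.card : ℝ)

/-- Thermodynamic stability of the Hamiltonian with means `μ_X` and variances `Δ_X²`. -/
def ThermoStable {d : ℕ} (μ Δ : Finset (Site d) → ℝ) : Prop :=
  ∃ c : ℝ, ∀ Λ : Finset (Site d), Λ.Nonempty →
    (∑ X ∈ Λ.powerset, |μ X|) / (Λ.card : ℝ) ≤ c ∧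
    (∑ X ∈ Λ.powerset, Δ X ^ 2) / (Λ.card : ℝ) ≤ c

/-- `J` and `Jt` are two families of Gaussian variables, all of them jointly independent, with
`J_X` and `Jt_X` of mean `μ_X` and variance `Δ_X²` (possibly zero). -/
structure IsGaussianDisorder {d : ℕ} {Ω : Type*} [MeasurableSpace Ω] (P : Measure Ω)
    (μ Δ : Finset (Site d) → ℝ) (J Jt : Finset (Site d) → Ω → ℝ) : Prop where
  law : ∀ X, HasLaw (J X) (gaussianReal (μ X) (Real.toNNReal (Δ X ^ 2))) P
  law_copy : ∀ X, HasLaw (Jt X) (gaussianReal (μ X) (Real.toNNReal (Δ X ^ 2))) P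
  indep : iIndepFun (Sum.elim J Jt) P

/-- Full flip: `cos t H_{Λ'} + sin t H̃_{Λ'} + H_{Λ∖Λ'}`. -/
def flipHam {d : ℕ} {Ω : Type*} (J Jt : Finset (Site d) → Ω → ℝ) (Λ Λ' : Finset (Site d))
    (t : ℝ) (w : Ω) (σ : SpinConfig Λ) : ℝ :=
  Real.cos t * hamIn (fun X => J X w) Λ' σ + Real.sin t * hamIn (fun X => Jt X w) Λ' σ
    + hamOut (fun X => J X w) Λ' σ

/-- Flip of the centered part: `cos t H⁰_{Λ'} + sin t H̃⁰_{Λ'} + 𝓑_{Λ'} + H_{Λ∖Λ'}`. -/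
def centeredFlipHam {d : ℕ} {Ω : Type*} (μ : Finset (Site d) → ℝ)
    (J Jt : Finset (Site d) → Ω → ℝ) (Λ Λ' : Finset (Site d))
    (t : ℝ) (w : Ω) (σ : SpinConfig Λ) : ℝ :=
  Real.cos t * hamIn (fun X => J X w - μ X) Λ' σ
    + Real.sin t * hamIn (fun X => Jt X w - μ X) Λ' σ
    + hamIn μ Λ' σ + hamOut (fun X => J X w) Λ' σ

/-- Boltzmann weight `e^{-β E(σ)} / ∑_τ e^{-β E(τ)}`. -/
def boltzmann {d : ℕ} {Λ : Finset (Site d)} (β : ℝ) (E : SpinConfig Λ → ℝ)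
    (σ : SpinConfig Λ) : ℝ :=
  Real.exp (-β * E σ) / ∑ τ : SpinConfig Λ, Real.exp (-β * E τ)

/-- Random state `ω_{t_1,…,t_n}(f)` of `n` replicas, the `k`-th one with energy `E k`. -/
def randomState {d : ℕ} {Λ : Finset (Site d)} {n : ℕ} (β : ℝ)
    (E : Fin n → SpinConfig Λ → ℝ) (f : (Fin n → SpinConfig Λ) → ℝ) : ℝ :=
  ∑ σ : Fin n → SpinConfig Λ, f σ * ∏ k, boltzmann β (E k) (σ k)

/-- Quenched state `⟨f⟩_{t_1,…,t_n} = Av(ω_{t_1,…,t_n}(f))` of the parametrized Hamiltonian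
`H t`; replicas are numbered from `0`, so replica `k + 1` of the text is `σ k`. -/
def quenched {d : ℕ} {Λ : Finset (Site d)} {Ω : Type*} [MeasurableSpace Ω] {n : ℕ}
    (P : Measure Ω) (β : ℝ) (H : ℝ → Ω → SpinConfig Λ → ℝ) (t : Fin n → ℝ)
    (f : (Fin n → SpinConfig Λ) → ℝ) : ℝ :=
  ∫ w, randomState β (fun k => H (t k) w) f ∂P

def h₁ (t s : ℝ) : ℝ := (Real.cos t - Real.sin t) * (Real.cos s - Real.sin s)

def h₂ (t s : ℝ) : ℝ := Real.sin (t - s) * (Real.cos t - Real.sin t)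

def k₂ (t s : ℝ) : ℝ := Real.sin (t - s) ^ 2

end

end FlipSpinGlass

/-! Rotating the disorder in `Λ'` by an angle joins the system at `t = 0` to the system at `t = π`,
where that disorder (centred in part 1, with its mean in part 2) is reversed. The proof computes the
variance of the difference `D` of the two log partition functions exactly and also bounds it from
above.

Exact value. By the fundamental theorem of calculus, `D` is `-β` times the integral over the angle
of the Gibbs average of the derivative of the energy. Its variance is therefore a double integral
over angles of covariances of these velocities. Gaussian integration by parts turns them into
overlaps: if `u_t(σ)` is the coefficient vector of the Gaussians in the energy, then `u'_s(τ) ·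
u_t(σ) = sin(t-s) C(τ,σ)` and `u'_s(τ) · u'_t(σ) = cos(t-s) C(τ,σ)`. The sine vanishes at equal
angles, so a velocity never differentiates its own Gibbs weight, and two integrations by parts give
the kernel `sin²(t-s)`. The result is `variance_pressureDiff_eq`.

Upper bound. `D` is Lipschitz in every standardized coupling with constant `2β|Δ_X|`, so an
Efron–Stein argument bounds the variance by `4β² ∑ Δ_X²`, which is of the order of the volume. The
cosine term is also of order `|Λ'|`, while the overlap terms carry the normalization `|Λ'|²`.
Dividing by `|Λ'|²` gives the limits.

In part 1, `D` is odd in the disorder of `Λ'`, so only `X ⊆ Λ'` enter the bound and no condition on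
the volume ratio is needed. In part 2 the mean energy is modulated by `cos t + sin t`, oddness
fails, all `X ⊆ Λ` enter, and the ratio must stay away from zero.

The term mixing magnetization and covariance enters the variance with coefficient `-2β³`, opposite
to the one in the statement. This is harmless because the term is negligible by itself
(`abs_angleIntegral_mixed_le`): the angular derivative of the quenched mean energy is `-β θ'` times
a thermal variance, so that variance, weighted by `|θ'|` and integrated over angles, is of the order
of the volume and not of its square. -/

/-! ### Standard Gaussian vectors -/

/-- The law of a finite family of independent standard Gaussian variables. -/
noncomputable abbrev stdGaussianPi (K : Type*) [Fintype K] : Measure (K → ℝ) :=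
  Measure.pi fun _ => gaussianReal 0 1

/-- A jointly continuous family of functions with polynomial growth, uniformly in the parameter. -/
def PolyGrowth {T K : Type*} [TopologicalSpace T] [Fintype K] (Φ : T → (K → ℝ) → ℝ) : Prop :=
  Continuous (fun p : T × (K → ℝ) => Φ p.1 p.2) ∧
    ∃ C : ℝ, 0 ≤ C ∧ ∃ n : ℕ, ∀ t g, |Φ t g| ≤ C * (1 + ‖g‖) ^ n

namespace PolyGrowth

variable {T T' K : Type*} [TopologicalSpace T] [TopologicalSpace T'] [Fintype K]
  {Φ Ψ : T → (K → ℝ) → ℝ}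

lemma of_bounded (hc : Continuous (fun p : T × (K → ℝ) => Φ p.1 p.2)) {C : ℝ}
    (hb : ∀ t g, |Φ t g| ≤ C) : PolyGrowth Φ :=
  ⟨hc, max C 0, le_max_right _ _, 0, fun t g => by
    rw [pow_zero, mul_one]; exact (hb t g).trans (le_max_left _ _)⟩

lemma of_param {φ : T → ℝ} (hc : Continuous φ) {C : ℝ} (hb : ∀ t, |φ t| ≤ C) :
    PolyGrowth (fun t (_ : K → ℝ) => φ t) :=
  of_bounded (hc.comp continuous_fst) fun t _ => hb t

lemma const (c : ℝ) : PolyGrowth (fun (_ : T) (_ : K → ℝ) => c) :=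
  of_param continuous_const fun _ => le_rfl

lemma coord (k : K) : PolyGrowth (fun (_ : T) (g : K → ℝ) => g k) := by
  refine ⟨by fun_prop, 1, zero_le_one, 1, fun t g => ?_⟩
  have := norm_le_pi_norm g k
  rw [Real.norm_eq_abs] at this
  linarith

lemma mul (hΦ : PolyGrowth Φ) (hΨ : PolyGrowth Ψ) : PolyGrowth (fun t g => Φ t g * Ψ t g) := by
  obtain ⟨h₁, C, hC, n, hn⟩ := hΦ
  obtain ⟨h₂, D, hD, m, hm⟩ := hΨ
  refine ⟨h₁.mul h₂, C * D, mul_nonneg hC hD, n + m, fun t g => ?_⟩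
  rw [abs_mul, pow_add, mul_mul_mul_comm]
  exact mul_le_mul (hn t g) (hm t g) (abs_nonneg _) (by positivity)

lemma add (hΦ : PolyGrowth Φ) (hΨ : PolyGrowth Ψ) : PolyGrowth (fun t g => Φ t g + Ψ t g) := by
  obtain ⟨h₁, C, hC, n, hn⟩ := hΦ
  obtain ⟨h₂, D, hD, m, hm⟩ := hΨ
  refine ⟨h₁.add h₂, C + D, add_nonneg hC hD, n + m, fun t g => ?_⟩
  have h1 : (1 : ℝ) ≤ 1 + ‖g‖ := by linarith [norm_nonneg g]
  have e₁ : (1 + ‖g‖) ^ n ≤ (1 + ‖g‖) ^ (n + m) := pow_le_pow_right₀ h1 (by omega)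
  have e₂ : (1 + ‖g‖) ^ m ≤ (1 + ‖g‖) ^ (n + m) := pow_le_pow_right₀ h1 (by omega)
  calc |Φ t g + Ψ t g| ≤ |Φ t g| + |Ψ t g| := abs_add_le _ _
    _ ≤ C * (1 + ‖g‖) ^ n + D * (1 + ‖g‖) ^ m := add_le_add (hn t g) (hm t g)
    _ ≤ C * (1 + ‖g‖) ^ (n + m) + D * (1 + ‖g‖) ^ (n + m) := by gcongr
    _ = _ := by ring

lemma const_mul (c : ℝ) (hΦ : PolyGrowth Φ) : PolyGrowth (fun t g => c * Φ t g) :=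
  (const c).mul hΦ

lemma sub (hΦ : PolyGrowth Φ) (hΨ : PolyGrowth Ψ) : PolyGrowth (fun t g => Φ t g - Ψ t g) := by
  simpa [sub_eq_add_neg] using hΦ.add (hΨ.const_mul (-1))

lemma sq (hΦ : PolyGrowth Φ) : PolyGrowth (fun t g => Φ t g ^ 2) := by
  simpa [pow_two] using hΦ.mul hΦ

lemma sum {ι : Type*} {s : Finset ι} {F : ι → T → (K → ℝ) → ℝ}
    (h : ∀ i ∈ s, PolyGrowth (F i)) : PolyGrowth (fun t g => ∑ i ∈ s, F i t g) := by
  classical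
  induction s using Finset.induction_on with
  | empty => simpa using const 0
  | insert a s ha ih =>
    simp_rw [Finset.sum_insert ha]
    exact (h a (by simp)).add (ih fun i hi => h i (by simp [hi]))

lemma comp (hΦ : PolyGrowth Φ) {φ : T' → T} (hφ : Continuous φ) :
    PolyGrowth (fun t => Φ (φ t)) := by
  obtain ⟨h₁, C, hC, n, hn⟩ := hΦ
  refine ⟨?_, C, hC, n, fun t g => hn _ g⟩
  exact h₁.comp (by fun_prop : Continuous fun p : T' × (K → ℝ) => (φ p.1, p.2))

/-- A single function of polynomial growth is treated throughout as a family over `Unit`. -/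
lemma at_param (hΦ : PolyGrowth Φ) (t : T) : PolyGrowth (fun (_ : Unit) => Φ t) :=
  hΦ.comp continuous_const

lemma continuous_right (hΦ : PolyGrowth Φ) (t : T) : Continuous (Φ t) :=
  hΦ.1.comp (by fun_prop : Continuous fun g : K → ℝ => (t, g))

lemma comp_right {K' : Type*} [Fintype K'] (hΦ : PolyGrowth Φ) {r : (K' → ℝ) → (K → ℝ)}
    (hr : Continuous r) (hb : ∀ g, ‖r g‖ ≤ ‖g‖) : PolyGrowth (fun t g => Φ t (r g)) := by
  obtain ⟨h₁, C, hC, n, hn⟩ := hΦ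
  refine ⟨?_, C, hC, n, fun t g => (hn t (r g)).trans ?_⟩
  · exact h₁.comp (by fun_prop : Continuous fun p : T × (K' → ℝ) => (p.1, r p.2))
  · have := hb g
    gcongr

end PolyGrowth

/-! ### Integrability, continuity in the parameter, and integration by parts for the standard
Gaussian measure. -/

section GaussianIntegrals

variable {T K : Type*} [TopologicalSpace T] [Fintype K] {Φ : T → (K → ℝ) → ℝ}

lemma memLp_eval_stdGaussianPi (k : K) (n : ℕ) :
    MemLp (fun g : K → ℝ => g k) (n : ENNReal) (stdGaussianPi K) := by
  have h : MemLp id (n : ENNReal) (gaussianReal 0 1) := by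
    simpa using memLp_id_gaussianReal (μ := 0) (v := 1) (n : NNReal)
  exact h.comp_measurePreserving (measurePreserving_eval (fun _ : K => gaussianReal 0 1) k)

/-- The sup norm is dominated by the sum of the absolute coordinates, and each coordinate has
moments of all orders. This is the universal dominating function for `PolyGrowth` families. -/
lemma integrable_one_add_norm_pow (n : ℕ) :
    Integrable (fun g : K → ℝ => (1 + ‖g‖) ^ n) (stdGaussianPi K) := by
  have hs : MemLp (fun g : K → ℝ => ∑ k, ‖g k‖) (n : ENNReal) (stdGaussianPi K) :=
    memLp_finsetSum Finset.univ fun k _ => (memLp_eval_stdGaussianPi k n).norm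
  have hc : MemLp (fun _ : K → ℝ => (1 : ℝ)) (n : ENNReal) (stdGaussianPi K) := memLp_const 1
  have hi := (hc.add hs).integrable_norm_pow'
  refine hi.mono' (by fun_prop) (ae_of_all _ fun g => ?_)
  have h0 : 0 ≤ ∑ k, ‖g k‖ := Finset.sum_nonneg fun _ _ => norm_nonneg _
  have h1 : ‖g‖ ≤ ∑ k, ‖g k‖ := (pi_norm_le_iff_of_nonneg h0).2 fun k =>
    Finset.single_le_sum (f := fun k => ‖g k‖) (fun _ _ => norm_nonneg _) (Finset.mem_univ k)
  have h2 : 0 ≤ 1 + ‖g‖ := by positivity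
  rw [norm_pow, Real.norm_of_nonneg h2]
  refine pow_le_pow_left₀ h2 ?_ n
  rw [Pi.add_apply, Real.norm_of_nonneg (by linarith)]
  linarith

lemma PolyGrowth.integrable (hΦ : PolyGrowth Φ) (t : T) :
    Integrable (Φ t) (stdGaussianPi K) := by
  obtain ⟨C, hC, n, hn⟩ := hΦ.2
  exact ((integrable_one_add_norm_pow n).const_mul C).mono'
    (hΦ.continuous_right t).aestronglyMeasurable (ae_of_all _ (hn t))

lemma PolyGrowth.continuous_integral [FirstCountableTopology T] (hΦ : PolyGrowth Φ) :
    Continuous (fun t => ∫ g, Φ t g ∂stdGaussianPi K) := by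
  obtain ⟨C, hC, n, hn⟩ := hΦ.2
  refine continuous_of_dominated (fun t => (hΦ.continuous_right t).aestronglyMeasurable)
    (fun t => ae_of_all _ (hn t)) ((integrable_one_add_norm_pow n).const_mul C)
    (ae_of_all _ fun g => ?_)
  exact hΦ.1.comp (by fun_prop : Continuous fun t : T => (t, g))

lemma PolyGrowth.intervalIntegral_integral_swap {Φ : ℝ → (K → ℝ) → ℝ} (hΦ : PolyGrowth Φ)
    (a b : ℝ) : ∫ t in a..b, ∫ g, Φ t g ∂stdGaussianPi K
      = ∫ g, (∫ t in a..b, Φ t g) ∂stdGaussianPi K := by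
  obtain ⟨C, hC, n, hn⟩ := hΦ.2
  apply MeasureTheory.intervalIntegral_integral_swap
  have : IsFiniteMeasure (volume.restrict (Set.uIoc a b)) :=
    ⟨by simp [Set.uIoc, Real.volume_Ioc]⟩
  have := ((integrable_one_add_norm_pow (K := K) n).const_mul C).comp_snd
    (volume.restrict (Set.uIoc a b))
  refine this.mono' (Continuous.aestronglyMeasurable hΦ.1) (ae_of_all _ fun p => hn p.1 p.2)

/-- The density of the standard Gaussian vector. -/
noncomputable def stdGaussianDensity (g : K → ℝ) : ℝ := ∏ k, gaussianPDFReal 0 1 (g k)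

lemma stdGaussianDensity_nonneg (g : K → ℝ) : 0 ≤ stdGaussianDensity g :=
  Finset.prod_nonneg fun _ _ => gaussianPDFReal_nonneg _ _ _

lemma continuous_gaussianPDFReal : Continuous (gaussianPDFReal 0 1) := by
  rw [gaussianPDFReal_def]; fun_prop

lemma continuous_stdGaussianDensity : Continuous (stdGaussianDensity (K := K)) := by
  unfold stdGaussianDensity
  exact continuous_finsetProd _ fun k _ => continuous_gaussianPDFReal.comp (continuous_apply k)

/-- Both measures factorize on boxes, which determine the product measure. The density form gives
access to integration by parts for Lebesgue measure. -/
lemma stdGaussianPi_eq_withDensity :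
    stdGaussianPi K
      = volume.withDensity (fun g : K → ℝ => ENNReal.ofReal (stdGaussianDensity g)) := by
  refine Measure.pi_eq fun s hs => ?_
  rw [withDensity_apply _ (MeasurableSet.univ_pi hs), volume_pi, Measure.restrict_pi_pi]
  have hi (k : K) : Integrable (gaussianPDFReal 0 1) ((volume : Measure ℝ).restrict (s k)) :=
    (integrable_gaussianPDFReal 0 1).restrict
  have hp : Integrable (stdGaussianDensity (K := K))
      (Measure.pi fun k => (volume : Measure ℝ).restrict (s k)) := Integrable.fintype_prod hi
  rw [← ofReal_integral_eq_lintegral_ofReal hp (ae_of_all _ stdGaussianDensity_nonneg)]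
  unfold stdGaussianDensity
  rw [integral_fintype_prod_eq_prod (fun _ => gaussianPDFReal 0 1),
    ENNReal.ofReal_prod_of_nonneg fun k _ => integral_nonneg (gaussianPDFReal_nonneg 0 1)]
  refine Finset.prod_congr rfl fun k _ => ?_
  rw [gaussianReal_apply_eq_integral _ one_ne_zero]

lemma integral_stdGaussianPi (F : (K → ℝ) → ℝ) :
    ∫ g, F g ∂stdGaussianPi K = ∫ g, F g * stdGaussianDensity g := by
  rw [stdGaussianPi_eq_withDensity, integral_withDensity_eq_integral_toReal_smul
    (by have := continuous_stdGaussianDensity (K := K); fun_prop) (by simp)]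
  simp [ENNReal.toReal_ofReal (stdGaussianDensity_nonneg _), mul_comm]

lemma integrable_mul_stdGaussianDensity {F : (K → ℝ) → ℝ} (hF : Integrable F (stdGaussianPi K)) :
    Integrable (fun g => F g * stdGaussianDensity g) := by
  rw [stdGaussianPi_eq_withDensity, integrable_withDensity_iff_integrable_smul'
    (by have := continuous_stdGaussianDensity (K := K); fun_prop) (by simp)] at hF
  simpa [ENNReal.toReal_ofReal (stdGaussianDensity_nonneg _), mul_comm] using hF

lemma hasDerivAt_gaussianPDFReal (x : ℝ) :
    HasDerivAt (gaussianPDFReal 0 1) (-x * gaussianPDFReal 0 1 x) x := by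
  have h : HasDerivAt (fun x : ℝ => -(x - 0) ^ 2 / (2 * ((1 : NNReal) : ℝ))) (-x) x := by
    have := (((hasDerivAt_id x).sub_const 0).pow 2).neg.div_const (2 * ((1 : NNReal) : ℝ))
    refine this.congr_deriv ?_
    simp only [id, NNReal.coe_one]
    ring
  rw [gaussianPDFReal_def]
  refine (h.exp.const_mul _).congr_deriv ?_
  ring

lemma hasLineDerivAt_stdGaussianDensity (g u : K → ℝ) :
    HasLineDerivAt ℝ stdGaussianDensity (-(∑ k, u k * g k) * stdGaussianDensity g) g u := by
  classical
  unfold HasLineDerivAt stdGaussianDensity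
  have h (k : K) : HasDerivAt (fun ε : ℝ => gaussianPDFReal 0 1 ((g + ε • u) k))
      (-(u k * g k) * gaussianPDFReal 0 1 (g k)) 0 := by
    have h1 : HasDerivAt (fun ε : ℝ => (g + ε • u) k) (u k) 0 := by
      simpa using ((hasDerivAt_id (0 : ℝ)).mul_const (u k)).const_add (g k)
    have h2 := hasDerivAt_gaussianPDFReal ((g + (0 : ℝ) • u) k)
    refine (h2.comp (0 : ℝ) h1).congr_deriv ?_
    simp; ring
  refine (HasDerivAt.fun_finsetProd (u := Finset.univ) fun k _ => h k).congr_deriv ?_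
  simp only [zero_smul, add_zero, smul_eq_mul]
  rw [← Finset.sum_neg_distrib, Finset.sum_mul]
  refine Finset.sum_congr rfl fun k _ => ?_
  rw [← Finset.mul_prod_erase Finset.univ _ (Finset.mem_univ k)]
  ring

/-- Gaussian integration by parts in the direction `u`. -/
lemma stdGaussianPi_integral_by_parts {F F' : (K → ℝ) → ℝ} (u : K → ℝ)
    (hF : PolyGrowth (fun (_ : Unit) => F)) (hF' : PolyGrowth (fun (_ : Unit) => F'))
    (h : ∀ g, HasLineDerivAt ℝ F (F' g) g u) :
    ∫ g, (∑ k, u k * g k) * F g ∂stdGaussianPi K = ∫ g, F' g ∂stdGaussianPi K := by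
  have hl : PolyGrowth (fun (_ : Unit) (g : K → ℝ) => ∑ k, u k * g k) :=
    PolyGrowth.sum fun k _ => (PolyGrowth.coord k).const_mul _
  have i₀ := integrable_mul_stdGaussianDensity (hF.integrable ())
  have i₁ := integrable_mul_stdGaussianDensity (hF'.integrable ())
  have i₂ := integrable_mul_stdGaussianDensity ((hl.mul hF).integrable ())
  have key := integral_bilinear_hasLineDerivAt_right_eq_neg_left_of_integrable
    (μ := (volume : Measure (K → ℝ))) (f := F) (f' := F') (g := stdGaussianDensity)
    (g' := fun g => -(∑ k, u k * g k) * stdGaussianDensity g) (v := u)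
    (B := ContinuousLinearMap.mul ℝ ℝ) (by simpa using i₁)
    (by refine (i₂.neg).congr (ae_of_all _ fun g => ?_); simp; ring)
    (by simpa using i₀) (fun g _ => h g) (fun g _ => hasLineDerivAt_stdGaussianDensity g u)
  rw [integral_stdGaussianPi, integral_stdGaussianPi]
  simp only [ContinuousLinearMap.mul_apply'] at key
  rw [← neg_inj, ← key, ← integral_neg]
  refine integral_congr_ae (ae_of_all _ fun g => ?_)
  simp only; ring

end GaussianIntegrals

/-! ### Symmetries of Gaussian vectors and a variance bound -/

section MixCopies

variable {κ : Type*} [DecidableEq κ]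

/-- The disorder in which the couplings in `s` are taken from the second copy. -/
def mixCopies (s : Finset κ) (g : κ ⊕ κ → ℝ) (i : κ) : ℝ :=
  if i ∈ s then g (.inr i) else g (.inl i)

lemma continuous_mixCopies (s : Finset κ) : Continuous (mixCopies s) := by
  refine continuous_pi fun i => ?_
  unfold mixCopies
  split_ifs <;> fun_prop

lemma mixCopies_empty (g : κ ⊕ κ → ℝ) : mixCopies ∅ g = fun i => g (.inl i) := by
  funext i; simp [mixCopies]

lemma mixCopies_insert {s : Finset κ} (i : κ) (g : κ ⊕ κ → ℝ) :
    mixCopies (insert i s) g = Function.update (mixCopies s g) i (g (.inr i)) := by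
  funext j
  by_cases hj : j = i
  · subst hj; simp [mixCopies]
  · simp [mixCopies, hj]

/-- Resampling one more coordinate is an exchange of its two copies, a symmetry of the Gaussian
measure. This drives the Efron–Stein argument. -/
lemma mixCopies_swap {s : Finset κ} {i : κ} (hi : i ∉ s) (g : κ ⊕ κ → ℝ) :
    mixCopies s (g ∘ Equiv.swap (.inl i) (.inr i)) = mixCopies (insert i s) g := by
  funext j
  by_cases hj : j = i
  · subst hj; simp [mixCopies, hi]
  · have h1 : Equiv.swap (Sum.inl i : κ ⊕ κ) (.inr i) (.inl j) = .inl j :=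
      Equiv.swap_apply_of_ne_of_ne (by simpa using hj) (by simp)
    have h2 : Equiv.swap (Sum.inl i : κ ⊕ κ) (.inr i) (.inr j) = .inr j :=
      Equiv.swap_apply_of_ne_of_ne (by simp) (by simpa using hj)
    simp [mixCopies, hj, h1, h2]

lemma mixCopies_insert_swap {s : Finset κ} {i : κ} (hi : i ∉ s) (g : κ ⊕ κ → ℝ) :
    mixCopies (insert i s) (g ∘ Equiv.swap (.inl i) (.inr i)) = mixCopies s g := by
  rw [← mixCopies_swap hi]
  congr 1
  funext k
  simp

end MixCopies

section Variance

variable {K κ : Type*} [Fintype K] [Fintype κ]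

lemma integral_comp_of_preserving {r : (K → ℝ) → (K → ℝ)}
    (hr : MeasurePreserving r (stdGaussianPi K) (stdGaussianPi K)) {F : (K → ℝ) → ℝ}
    (hF : Continuous F) :
    ∫ g, F (r g) ∂stdGaussianPi K = ∫ g, F g ∂stdGaussianPi K := by
  conv_rhs => rw [← hr.map_eq]
  rw [integral_map hr.measurable.aemeasurable hF.aestronglyMeasurable]

lemma measurePreserving_comp_equiv (e : K ≃ K) :
    MeasurePreserving (fun g : K → ℝ => g ∘ e) (stdGaussianPi K) (stdGaussianPi K) := by
  have h := measurePreserving_piCongrLeft (fun _ : K => gaussianReal 0 1) e.symm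
  convert! h using 1
  funext g i
  simp [MeasurableEquiv.coe_piCongrLeft, Equiv.piCongrLeft_apply]

lemma measurePreserving_mul_sign {ε : K → ℝ} (hε : ∀ k, ε k = 1 ∨ ε k = -1) :
    MeasurePreserving (fun g k => ε k * g k) (stdGaussianPi K) (stdGaussianPi K) := by
  refine measurePreserving_pi _ _ (f := fun k x => ε k * x) fun k => ⟨by fun_prop, ?_⟩
  rcases hε k with h | h
  · simp [h]
  · simpa [h] using gaussianReal_map_neg (μ := 0) (v := 1)

/-- The two halves of the vector are independent copies, so a squared mean is one expectation over
both. -/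
lemma integral_mul_inl_inr (f : (κ → ℝ) → ℝ) :
    ∫ g : κ ⊕ κ → ℝ, f (fun i => g (.inl i)) * f (fun i => g (.inr i)) ∂stdGaussianPi (κ ⊕ κ)
      = (∫ g : κ ⊕ κ → ℝ, f (fun i => g (.inl i)) ∂stdGaussianPi (κ ⊕ κ)) ^ 2 := by
  have h := measurePreserving_sumPiEquivProdPi (fun _ : κ ⊕ κ => gaussianReal 0 1)
  have h1 : ∫ g : κ ⊕ κ → ℝ, f (fun i => g (.inl i)) * f (fun i => g (.inr i))
      ∂stdGaussianPi (κ ⊕ κ) = ∫ p : (κ → ℝ) × (κ → ℝ), f p.1 * f p.2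
        ∂((stdGaussianPi κ).prod (stdGaussianPi κ)) :=
    h.integral_comp' (g := fun p : (κ → ℝ) × (κ → ℝ) => f p.1 * f p.2)
  have h2 : ∫ g : κ ⊕ κ → ℝ, f (fun i => g (.inl i)) ∂stdGaussianPi (κ ⊕ κ)
      = ∫ p : (κ → ℝ) × (κ → ℝ), f p.1 ∂((stdGaussianPi κ).prod (stdGaussianPi κ)) :=
    h.integral_comp' (g := fun p : (κ → ℝ) × (κ → ℝ) => f p.1)
  rw [h1, h2, integral_prod_mul, integral_fun_fst]
  simp [pow_two]

/-- Integration by parts along `e_a - e_b`, whose squared length is 2. -/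
lemma integral_sub_sq (a b : K) (hab : a ≠ b) :
    ∫ g : K → ℝ, (g a - g b) ^ 2 ∂stdGaussianPi K = 2 := by
  classical
  have hs (g : K → ℝ) :
      ∑ k, (Pi.single a 1 - Pi.single b 1 : K → ℝ) k * g k = g a - g b := by
    simp [sub_mul, Finset.sum_sub_distrib, Pi.single_apply]
  have h := stdGaussianPi_integral_by_parts (F := fun g : K → ℝ => g a - g b) (F' := fun _ => 2)
    (Pi.single a 1 - Pi.single b 1) ((PolyGrowth.coord a).sub (PolyGrowth.coord b))
    (PolyGrowth.const 2) fun g => by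
      unfold HasLineDerivAt
      have h (c : K) (x : ℝ) : HasDerivAt (fun t : ℝ => g c + t * x) x 0 := by
        simpa using ((hasDerivAt_id (0 : ℝ)).mul_const x).const_add (g c)
      refine ((h a _).sub (h b _)).congr_deriv ?_
      simp [hab, hab.symm]; norm_num
  simp_rw [hs] at h
  simp_rw [pow_two, h]
  simp

variable [DecidableEq κ]

lemma norm_mixCopies_le (s : Finset κ) (g : κ ⊕ κ → ℝ) : ‖mixCopies s g‖ ≤ ‖g‖ := by
  refine (pi_norm_le_iff_of_nonneg (norm_nonneg _)).2 fun i => ?_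
  unfold mixCopies
  split_ifs <;> exact norm_le_pi_norm g _

lemma mixCopies_univ (g : κ ⊕ κ → ℝ) : mixCopies Finset.univ g = fun i => g (.inr i) := by
  funext i; simp [mixCopies]

/-- Efron–Stein type bound for functions that are Lipschitz in every coordinate: resampling the
coordinates in `s` costs at most the sum of the squared Lipschitz constants. -/
theorem integral_mul_sub_mixCopies_le {f : (κ → ℝ) → ℝ} (hf : PolyGrowth (fun (_ : Unit) => f))
    {L : κ → ℝ} (hL : ∀ i x y, |f (Function.update x i y) - f x| ≤ L i * |y - x i|)
    (s : Finset κ) :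
    ∫ g, f (mixCopies ∅ g) * (f (mixCopies ∅ g) - f (mixCopies s g)) ∂stdGaussianPi (κ ⊕ κ)
      ≤ ∑ i ∈ s, L i ^ 2 := by
  have hm (s : Finset κ) : PolyGrowth (fun (_ : Unit) (g : κ ⊕ κ → ℝ) => f (mixCopies s g)) :=
    hf.comp_right (continuous_mixCopies s) (norm_mixCopies_le s)
  induction s using Finset.induction_on with
  | empty => simp
  | insert i s hi ih =>
    set D : (κ ⊕ κ → ℝ) → ℝ := fun g => f (mixCopies s g) - f (mixCopies (insert i s) g) with hD
    have hDp : PolyGrowth (fun (_ : Unit) => D) := (hm s).sub (hm _)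
    have h0D := (hm ∅).mul hDp
    have h1D := (hm {i}).mul hDp
    -- Exchanging the two copies of coordinate `i` sends `D` to `-D` and resamples `i` in the other
    -- factor. Averaging both forms replaces that factor by half an increment in coordinate `i`
    -- alone.
    have e1 : ∫ g, f (mixCopies ∅ g) * D g ∂stdGaussianPi (κ ⊕ κ)
        = - ∫ g, f (mixCopies {i} g) * D g ∂stdGaussianPi (κ ⊕ κ) := by
      rw [← integral_comp_of_preserving
        (measurePreserving_comp_equiv (Equiv.swap (.inl i) (.inr i))) (h0D.continuous_right ()),
        ← integral_neg]
      refine integral_congr_ae (ae_of_all _ fun g => ?_)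
      simp only [hD, mixCopies_swap hi, mixCopies_insert_swap hi,
        mixCopies_swap (Finset.notMem_empty i), insert_empty_eq]
      ring
    have e2 : ∫ g, f (mixCopies ∅ g) * D g ∂stdGaussianPi (κ ⊕ κ) ≤ L i ^ 2 := by
      have h : ∫ g, f (mixCopies ∅ g) * D g ∂stdGaussianPi (κ ⊕ κ)
          = ∫ g, (f (mixCopies ∅ g) - f (mixCopies {i} g)) * D g / 2 ∂stdGaussianPi (κ ⊕ κ) := by
        simp_rw [sub_mul]
        rw [integral_div, integral_sub (h0D.integrable ()) (h1D.integrable ())]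
        linarith
      -- The factor `1/2` from the symmetrization cancels the second moment 2 of the difference of
      -- the two copies.
      have hb : ∫ g : κ ⊕ κ → ℝ, L i ^ 2 / 2 * (g (.inr i) - g (.inl i)) ^ 2
          ∂stdGaussianPi (κ ⊕ κ) = L i ^ 2 := by
        rw [integral_const_mul, integral_sub_sq _ _ (by simp)]
        ring
      rw [h, ← hb]
      refine integral_mono (((((hm ∅).sub (hm {i})).mul hDp).integrable ()).div_const 2)
        (((((PolyGrowth.coord (T := Unit) _).sub (PolyGrowth.coord _)).sq).const_mul _).integrable
          ()) fun g => ?_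
      have b1 : |f (mixCopies ∅ g) - f (mixCopies {i} g)| ≤ L i * |g (.inr i) - g (.inl i)| := by
        have := hL i (mixCopies ∅ g) (g (.inr i))
        rw [← mixCopies_insert, insert_empty_eq, abs_sub_comm] at this
        simpa [mixCopies] using this
      have b2 : |D g| ≤ L i * |g (.inr i) - g (.inl i)| := by
        have := hL i (mixCopies s g) (g (.inr i))
        rw [← mixCopies_insert, abs_sub_comm] at this
        simpa [mixCopies, hi] using this
      have h3 : |(f (mixCopies ∅ g) - f (mixCopies {i} g)) * D g|
          ≤ (L i * |g (.inr i) - g (.inl i)|) * (L i * |g (.inr i) - g (.inl i)|) := by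
        rw [abs_mul]
        exact mul_le_mul b1 b2 (abs_nonneg _) ((abs_nonneg _).trans b1)
      have h4 := (le_abs_self _).trans h3
      have h5 : (L i * |g (.inr i) - g (.inl i)|) * (L i * |g (.inr i) - g (.inl i)|)
          = L i ^ 2 * (g (.inr i) - g (.inl i)) ^ 2 := by
        rw [← sq_abs (g (.inr i) - g (.inl i))]; ring
      rw [h5] at h4
      simp only
      linarith
    have e3 : ∫ g, f (mixCopies ∅ g) * (f (mixCopies ∅ g) - f (mixCopies (insert i s) g))
        ∂stdGaussianPi (κ ⊕ κ)
        = (∫ g, f (mixCopies ∅ g) * (f (mixCopies ∅ g) - f (mixCopies s g))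
            ∂stdGaussianPi (κ ⊕ κ)) + ∫ g, f (mixCopies ∅ g) * D g ∂stdGaussianPi (κ ⊕ κ) := by
      rw [← integral_add (((hm ∅).mul ((hm ∅).sub (hm s))).integrable ()) (h0D.integrable ())]
      refine integral_congr_ae (ae_of_all _ fun g => ?_)
      simp only [hD]; ring
    rw [e3, Finset.sum_insert hi]
    linarith

/-- Variance bound for functions of independent Gaussians that are Lipschitz in each of them. -/
theorem integral_sq_sub_sq_integral_le {f : (κ → ℝ) → ℝ} (hf : PolyGrowth (fun (_ : Unit) => f))
    {L : κ → ℝ} (hL : ∀ i x y, |f (Function.update x i y) - f x| ≤ L i * |y - x i|) :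
    ∫ g : κ ⊕ κ → ℝ, f (fun i => g (.inl i)) ^ 2 ∂stdGaussianPi (κ ⊕ κ)
      - (∫ g : κ ⊕ κ → ℝ, f (fun i => g (.inl i)) ∂stdGaussianPi (κ ⊕ κ)) ^ 2
      ≤ ∑ i, L i ^ 2 := by
  have hm (s : Finset κ) : PolyGrowth (fun (_ : Unit) (g : κ ⊕ κ → ℝ) => f (mixCopies s g)) :=
    hf.comp_right (continuous_mixCopies s) (norm_mixCopies_le s)
  refine le_of_eq_of_le ?_ (integral_mul_sub_mixCopies_le hf hL Finset.univ)
  -- Once every coordinate is resampled, the second factor is an independent copy of the first, so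
  -- the cross term is the squared mean.
  rw [← integral_mul_inl_inr]
  have h0 := (hm ∅).sq.integrable ()
  have h1 := ((hm ∅).mul (hm Finset.univ)).integrable ()
  simp only [mixCopies_empty, mixCopies_univ] at h0 h1 ⊢
  rw [← integral_sub h0 h1]
  refine integral_congr_ae (ae_of_all _ fun g => ?_)
  simp only; ring

/-- If `f` is odd in the coordinates in `s`, only these coordinates contribute to its second
moment bound. -/
theorem integral_sq_le_of_odd {f : (κ → ℝ) → ℝ} (hf : PolyGrowth (fun (_ : Unit) => f))
    {L : κ → ℝ} (hL : ∀ i x y, |f (Function.update x i y) - f x| ≤ L i * |y - x i|)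
    (s : Finset κ) (hodd : ∀ x, f (fun i => if i ∈ s then -x i else x i) = -f x) :
    ∫ g : κ ⊕ κ → ℝ, f (fun i => g (.inl i)) ^ 2 ∂stdGaussianPi (κ ⊕ κ) ≤ ∑ i ∈ s, L i ^ 2 := by
  have hm (s : Finset κ) : PolyGrowth (fun (_ : Unit) (g : κ ⊕ κ → ℝ) => f (mixCopies s g)) :=
    hf.comp_right (continuous_mixCopies s) (norm_mixCopies_le s)
  have h1 := (hm ∅).mul (hm s)
  -- Reverse the signs of the first-copy coordinates in `s`. The first factor changes sign by
  -- oddness, while the second does not see these coordinates, so the integral equals its own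
  -- negative.
  have hz : ∫ g, f (mixCopies ∅ g) * f (mixCopies s g) ∂stdGaussianPi (κ ⊕ κ) = 0 := by
    set ε : κ ⊕ κ → ℝ := Sum.elim (fun i => if i ∈ s then -1 else 1) fun _ => 1 with hε
    have hp := measurePreserving_mul_sign (ε := ε) (by
      rintro (i | i)
      · by_cases h : i ∈ s <;> simp [hε, h]
      · simp [hε])
    have h2 := integral_comp_of_preserving hp (h1.continuous_right ())
    have h3 (g : κ ⊕ κ → ℝ) : f (mixCopies ∅ fun k => ε k * g k) = -f (mixCopies ∅ g) := by
      rw [← hodd]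
      congr 1
      funext i
      by_cases h : i ∈ s <;> simp [mixCopies, hε, h]
    have h4 (g : κ ⊕ κ → ℝ) : mixCopies s (fun k => ε k * g k) = mixCopies s g := by
      funext i
      by_cases h : i ∈ s <;> simp [mixCopies, hε, h]
    simp only [h3, h4, neg_mul, integral_neg] at h2
    linarith
  refine le_of_eq_of_le ?_ (integral_mul_sub_mixCopies_le hf hL s)
  have h0 := (hm ∅).sq.integrable ()
  have : ∫ g, f (mixCopies ∅ g) * (f (mixCopies ∅ g) - f (mixCopies s g)) ∂stdGaussianPi (κ ⊕ κ)
      = ∫ g, f (mixCopies ∅ g) ^ 2 ∂stdGaussianPi (κ ⊕ κ)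
        - ∫ g, f (mixCopies ∅ g) * f (mixCopies s g) ∂stdGaussianPi (κ ⊕ κ) := by
    rw [← integral_sub h0 (h1.integrable ())]
    refine integral_congr_ae (ae_of_all _ fun g => ?_)
    simp only; ring
  rw [this, hz, sub_zero]
  simp only [mixCopies_empty]

end Variance

/-! ### Gibbs averages over a finite configuration space -/

section Gibbs

variable {S : Type*} [Fintype S]

/-- Gibbs weight of `σ` for the energy `E`. -/
noncomputable def gibbsWeight (β : ℝ) (E : S → ℝ) (σ : S) : ℝ :=
  Real.exp (-β * E σ) / ∑ τ, Real.exp (-β * E τ)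

/-- Gibbs average of the observable `f` for the energy `E`. -/
noncomputable def gibbsAvg (β : ℝ) (E : S → ℝ) (f : S → ℝ) : ℝ :=
  ∑ σ, gibbsWeight β E σ * f σ

/-- Logarithm of the partition function. -/
noncomputable def logPartition (β : ℝ) (E : S → ℝ) : ℝ := Real.log (∑ τ, Real.exp (-β * E τ))

variable {β : ℝ} {E : S → ℝ} {f h : S → ℝ}

lemma gibbsWeight_nonneg (σ : S) : 0 ≤ gibbsWeight β E σ := by
  unfold gibbsWeight; positivity

lemma gibbsAvg_add : gibbsAvg β E (fun σ => f σ + h σ) = gibbsAvg β E f + gibbsAvg β E h := by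
  simp [gibbsAvg, mul_add, Finset.sum_add_distrib]

lemma gibbsAvg_sub : gibbsAvg β E (fun σ => f σ - h σ) = gibbsAvg β E f - gibbsAvg β E h := by
  simp [gibbsAvg, mul_sub, Finset.sum_sub_distrib]

lemma gibbsAvg_mul_const (c : ℝ) : gibbsAvg β E (fun σ => f σ * c) = gibbsAvg β E f * c := by
  simp [gibbsAvg, Finset.sum_mul, mul_assoc]

lemma gibbsAvg_const_mul (c : ℝ) : gibbsAvg β E (fun σ => c * f σ) = c * gibbsAvg β E f := by
  simp only [gibbsAvg, Finset.mul_sum]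
  exact Finset.sum_congr rfl fun _ _ => by ring

lemma gibbsAvg_mul_const_mul (c : ℝ) :
    gibbsAvg β E (fun σ => f σ * (c * h σ)) = c * gibbsAvg β E (fun σ => f σ * h σ) := by
  rw [← gibbsAvg_const_mul]
  simp only [mul_left_comm]

lemma gibbsAvg_comm {E' : S → ℝ} {F : S → S → ℝ} :
    gibbsAvg β E (fun σ => gibbsAvg β E' fun τ => F σ τ)
      = gibbsAvg β E' (fun τ => gibbsAvg β E fun σ => F σ τ) := by
  simp only [gibbsAvg, Finset.mul_sum]
  rw [Finset.sum_comm]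
  exact Finset.sum_congr rfl fun _ _ => Finset.sum_congr rfl fun _ _ => by ring

lemma gibbsAvg_mono (hfh : ∀ σ, f σ ≤ h σ) : gibbsAvg β E f ≤ gibbsAvg β E h :=
  Finset.sum_le_sum fun σ _ => mul_le_mul_of_nonneg_left (hfh σ) (gibbsWeight_nonneg σ)

lemma abs_gibbsAvg_le : |gibbsAvg β E f| ≤ gibbsAvg β E (fun σ => |f σ|) := by
  refine (Finset.abs_sum_le_sum_abs _ _).trans_eq (Finset.sum_congr rfl fun σ _ => ?_)
  rw [abs_mul, abs_of_nonneg (gibbsWeight_nonneg σ)]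

lemma gibbsAvg_mul_sub_mul :
    gibbsAvg β E (fun σ => f σ * h σ) - gibbsAvg β E f * gibbsAvg β E h
      = gibbsAvg β E (fun σ => (f σ - gibbsAvg β E f) * h σ) := by
  simp only [sub_mul]
  rw [gibbsAvg_sub, gibbsAvg_const_mul]

lemma hasDerivAt_partition {E : ℝ → S → ℝ} {E' : S → ℝ} {t : ℝ}
    (hE : ∀ σ, HasDerivAt (fun r => E r σ) (E' σ) t) :
    HasDerivAt (fun r => ∑ τ, Real.exp (-β * E r τ))
      (-β * ∑ τ, Real.exp (-β * E t τ) * E' τ) t := by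
  refine (HasDerivAt.fun_sum fun σ _ => ((hE σ).const_mul (-β)).exp).congr_deriv ?_
  rw [Finset.mul_sum]
  exact Finset.sum_congr rfl fun _ _ => by ring

variable [Nonempty S]

lemma partition_pos (β : ℝ) (E : S → ℝ) : 0 < ∑ τ, Real.exp (-β * E τ) :=
  Finset.sum_pos (fun _ _ => Real.exp_pos _) Finset.univ_nonempty

lemma sum_gibbsWeight : ∑ σ, gibbsWeight β E σ = 1 := by
  simp only [gibbsWeight, ← Finset.sum_div]
  exact div_self (partition_pos β E).ne'

lemma gibbsWeight_le_one (σ : S) : gibbsWeight β E σ ≤ 1 := by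
  rw [← sum_gibbsWeight (β := β) (E := E)]
  exact Finset.single_le_sum (fun τ _ => gibbsWeight_nonneg τ) (Finset.mem_univ σ)

lemma gibbsAvg_const (c : ℝ) : gibbsAvg β E (fun _ => c) = c := by
  simp [gibbsAvg, ← Finset.sum_mul, sum_gibbsWeight]

lemma abs_gibbsAvg_le_of_le {C : ℝ} (hf : ∀ σ, |f σ| ≤ C) : |gibbsAvg β E f| ≤ C :=
  abs_gibbsAvg_le.trans ((gibbsAvg_mono hf).trans_eq (gibbsAvg_const C))

lemma gibbsAvg_sq_sub_sq :
    gibbsAvg β E (fun σ => f σ ^ 2) - gibbsAvg β E f ^ 2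
      = gibbsAvg β E (fun σ => (f σ - gibbsAvg β E f) ^ 2) := by
  set m := gibbsAvg β E f with hm
  have : (fun σ => (f σ - m) ^ 2) = fun σ => (f σ ^ 2 - f σ * (2 * m)) + m ^ 2 := by
    funext σ; ring
  rw [this, gibbsAvg_add, gibbsAvg_sub, gibbsAvg_mul_const, gibbsAvg_const, ← hm]
  ring

/-- The thermal covariance with a bounded observable is controlled by the thermal variance. -/
lemma abs_gibbsAvg_mul_sub_mul_le {M δ : ℝ} (hδ : 0 < δ) (hM : ∀ σ, |h σ| ≤ M) :
    |gibbsAvg β E (fun σ => f σ * h σ) - gibbsAvg β E f * gibbsAvg β E h|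
      ≤ M * (δ / 2 + (gibbsAvg β E (fun σ => f σ ^ 2) - gibbsAvg β E f ^ 2) / (2 * δ)) := by
  rw [gibbsAvg_mul_sub_mul, gibbsAvg_sq_sub_sq]
  set m := gibbsAvg β E f
  have hM0 : 0 ≤ M := (abs_nonneg _).trans (hM (Classical.arbitrary S))
  have key (σ : S) : |(f σ - m) * h σ| ≤ M * (δ / 2) + (f σ - m) ^ 2 * (M / (2 * δ)) := by
    -- Young's inequality with a free `δ` replaces Cauchy–Schwarz, so the bound stays linear in the
    -- variance and can be integrated over disorder and angles.
    have h1 : |f σ - m| ≤ δ / 2 + (f σ - m) ^ 2 / (2 * δ) := by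
      rw [← sq_abs (f σ - m)]
      have : 0 ≤ (|f σ - m| - δ) ^ 2 / (2 * δ) := by positivity
      have e : (|f σ - m| - δ) ^ 2 / (2 * δ)
          = δ / 2 + |f σ - m| ^ 2 / (2 * δ) - |f σ - m| := by
        field_simp; ring
      linarith
    rw [abs_mul]
    calc |f σ - m| * |h σ| ≤ (δ / 2 + (f σ - m) ^ 2 / (2 * δ)) * M :=
          mul_le_mul h1 (hM σ) (abs_nonneg _) (by positivity)
      _ = _ := by ring
  refine (abs_gibbsAvg_le.trans (gibbsAvg_mono key)).trans_eq ?_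
  rw [gibbsAvg_add, gibbsAvg_const, gibbsAvg_mul_const]
  ring

/-- Each Boltzmann factor grows by at most `exp (β δ)`. This makes the log partition function
`β`-Lipschitz in the sup norm of the energy. -/
lemma logPartition_le_of_le {E E' : S → ℝ} (hβ : 0 ≤ β) {δ : ℝ} (hE : ∀ σ, E' σ ≤ E σ + δ) :
    logPartition β E ≤ logPartition β E' + β * δ := by
  unfold logPartition
  rw [← Real.log_exp (β * δ), ← Real.log_mul (partition_pos β E').ne' (Real.exp_pos _).ne']
  refine Real.log_le_log (partition_pos β E) ?_
  rw [Finset.sum_mul]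
  refine Finset.sum_le_sum fun σ _ => ?_
  rw [← Real.exp_add]
  refine Real.exp_le_exp.2 ?_
  have := mul_le_mul_of_nonneg_left (hE σ) hβ
  linarith

lemma abs_logPartition_sub_le {E E' : S → ℝ} (hβ : 0 ≤ β) {δ : ℝ} (hE : ∀ σ, |E σ - E' σ| ≤ δ) :
    |logPartition β E - logPartition β E'| ≤ β * δ := by
  have h1 := logPartition_le_of_le (E := E) (E' := E') hβ (δ := δ)
    fun σ => by linarith [(abs_le.1 (hE σ)).1]
  have h2 := logPartition_le_of_le (E := E') (E' := E) hβ (δ := δ)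
    fun σ => by linarith [(abs_le.1 (hE σ)).2]
  exact abs_le.2 ⟨by linarith, by linarith⟩

section Deriv

variable {E : ℝ → S → ℝ} {E' : S → ℝ} {t : ℝ}

lemma sum_exp_mul_eq (E : S → ℝ) (f : S → ℝ) :
    ∑ τ, Real.exp (-β * E τ) * f τ = gibbsAvg β E f * ∑ τ, Real.exp (-β * E τ) := by
  have := (partition_pos β E).ne'
  unfold gibbsAvg gibbsWeight
  rw [Finset.sum_mul]
  refine Finset.sum_congr rfl fun σ _ => ?_
  field_simp

lemma hasDerivAt_logPartition (hE : ∀ σ, HasDerivAt (fun r => E r σ) (E' σ) t) :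
    HasDerivAt (fun r => logPartition β (E r)) (-β * gibbsAvg β (E t) E') t := by
  have hZ := (partition_pos β (E t)).ne'
  refine ((hasDerivAt_partition hE).log hZ).congr_deriv ?_
  rw [sum_exp_mul_eq]
  field_simp

lemma hasDerivAt_gibbsWeight (hE : ∀ σ, HasDerivAt (fun r => E r σ) (E' σ) t) (σ : S) :
    HasDerivAt (fun r => gibbsWeight β (E r) σ)
      (-β * gibbsWeight β (E t) σ * (E' σ - gibbsAvg β (E t) E')) t := by
  have hZ := (partition_pos β (E t)).ne'
  refine ((((hE σ).const_mul (-β)).exp).div (hasDerivAt_partition hE) hZ).congr_deriv ?_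
  rw [sum_exp_mul_eq]
  unfold gibbsWeight
  field_simp
  ring

lemma hasDerivAt_gibbsAvg {f : ℝ → S → ℝ} {f' : S → ℝ}
    (hE : ∀ σ, HasDerivAt (fun r => E r σ) (E' σ) t)
    (hf : ∀ σ, HasDerivAt (fun r => f r σ) (f' σ) t) :
    HasDerivAt (fun r => gibbsAvg β (E r) (f r))
      (gibbsAvg β (E t) f' - β * (gibbsAvg β (E t) (fun σ => f t σ * E' σ)
        - gibbsAvg β (E t) (f t) * gibbsAvg β (E t) E')) t := by
  refine (HasDerivAt.fun_sum fun σ _ =>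
    (hasDerivAt_gibbsWeight hE σ).mul (hf σ)).congr_deriv ?_
  rw [← gibbsAvg_mul_const, ← gibbsAvg_sub, ← gibbsAvg_const_mul, ← gibbsAvg_sub]
  exact Finset.sum_congr rfl fun σ _ => by ring

end Deriv

section Growth

variable {T K : Type*} [TopologicalSpace T] [Fintype K] {E : T → (K → ℝ) → S → ℝ}
  {f : T → (K → ℝ) → S → ℝ}

lemma PolyGrowth.gibbsWeight (hE : ∀ σ, Continuous fun p : T × (K → ℝ) => E p.1 p.2 σ) (σ : S) :
    PolyGrowth (fun t g => gibbsWeight β (E t g) σ) := by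
  refine PolyGrowth.of_bounded (C := 1) ?_ fun t g => ?_
  · unfold _root_.gibbsWeight
    refine Continuous.div ?_ ?_ fun p => (partition_pos β (E p.1 p.2)).ne'
    · exact Real.continuous_exp.comp ((hE σ).const_mul _)
    · exact continuous_finsetSum _ fun τ _ => Real.continuous_exp.comp ((hE τ).const_mul _)
  · rw [abs_of_nonneg (gibbsWeight_nonneg σ)]
    exact gibbsWeight_le_one σ

lemma PolyGrowth.gibbsAvg (hE : ∀ σ, Continuous fun p : T × (K → ℝ) => E p.1 p.2 σ)
    (hf : ∀ σ, PolyGrowth fun t g => f t g σ) :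
    PolyGrowth (fun t g => gibbsAvg β (E t g) (f t g)) :=
  PolyGrowth.sum fun σ _ => (PolyGrowth.gibbsWeight hE σ).mul (hf σ)

end Growth

end Gibbs

/-! ### Rotation of a part of the disorder -/

/-- A Gibbs system whose energy is linear in Gaussian disorder `(x, y)`, where the couplings in
`region` are rotated into `cos t x + sin t y` and a deterministic term is modulated by `θ t`. -/
structure FlipModel (κ S : Type*) where
  /-- inverse temperature -/
  β : ℝ
  β_pos : 0 < β
  /-- coefficient of each coupling -/
  coeff : κ → S → ℝ
  /-- the couplings that are rotated -/
  region : Finset κ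
  /-- the modulated deterministic energy -/
  bulk : S → ℝ
  /-- the fixed deterministic energy -/
  rest : S → ℝ
  /-- the modulation -/
  θ : ℝ → ℝ
  /-- the derivative of the modulation -/
  θ' : ℝ → ℝ
  hasDerivAt_θ : ∀ t, HasDerivAt θ (θ' t) t
  continuous_θ' : Continuous θ'
  -- The constant 2 is the crude bound for `cos t - sin t`; boundedness is what gives the velocity
  -- polynomial growth uniformly in the angle.
  abs_θ'_le : ∀ t, |θ' t| ≤ 2

namespace FlipModel

noncomputable section

variable {κ S : Type*} (M : FlipModel κ S)

/-- Covariance of the rotated part of the energy. -/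
def C (σ τ : S) : ℝ := ∑ X ∈ M.region, M.coeff X σ * M.coeff X τ

lemma C_comm (σ τ : S) : M.C σ τ = M.C τ σ :=
  Finset.sum_congr rfl fun _ _ => mul_comm _ _

lemma hasDerivAt_linear_line [Fintype κ] (a : κ ⊕ κ → ℝ) (c : ℝ) (g u : κ ⊕ κ → ℝ) :
    HasDerivAt (fun r : ℝ => ∑ k, a k * (g + r • u) k + c) (∑ k, u k * a k) 0 := by
  have h (k : κ ⊕ κ) : HasDerivAt (fun r : ℝ => a k * (g + r • u) k) (u k * a k) 0 := by
    have h1 : HasDerivAt (fun ε : ℝ => (g + ε • u) k) (u k) 0 := by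
      simpa using ((hasDerivAt_id (0 : ℝ)).mul_const (u k)).const_add (g k)
    exact (h1.const_mul (a k)).congr_deriv (mul_comm _ _)
  exact (HasDerivAt.fun_sum fun k _ => h k).add_const _

lemma hasLineDerivAt_const (c : ℝ) (g u : κ ⊕ κ → ℝ) :
    HasLineDerivAt ℝ (fun _ : κ ⊕ κ → ℝ => c) 0 g u := hasDerivAt_const _ _

variable [DecidableEq κ]

/-- Coefficients of the disorder in the energy at angle `t`. -/
def dir (t : ℝ) (σ : S) : κ ⊕ κ → ℝ :=
  Sum.elim (fun X => if X ∈ M.region then Real.cos t * M.coeff X σ else M.coeff X σ)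
    (fun X => if X ∈ M.region then Real.sin t * M.coeff X σ else 0)

/-- Derivative of `dir` in the angle. -/
def dir' (t : ℝ) (σ : S) : κ ⊕ κ → ℝ :=
  Sum.elim (fun X => if X ∈ M.region then -Real.sin t * M.coeff X σ else 0)
    (fun X => if X ∈ M.region then Real.cos t * M.coeff X σ else 0)

lemma hasDerivAt_dir (t : ℝ) (σ : S) (k : κ ⊕ κ) :
    HasDerivAt (fun r => M.dir r σ k) (M.dir' t σ k) t := by
  rcases k with X | X <;> by_cases h : X ∈ M.region <;> simp only [dir, dir', Sum.elim_inl,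
    Sum.elim_inr, h, if_true, if_false]
  · exact (Real.hasDerivAt_cos t).mul_const _
  · exact hasDerivAt_const _ _
  · exact (Real.hasDerivAt_sin t).mul_const _
  · exact hasDerivAt_const _ _

lemma continuous_dir (σ : S) (k : κ ⊕ κ) : Continuous fun t => M.dir t σ k :=
  continuous_iff_continuousAt.2 fun t => (M.hasDerivAt_dir t σ k).continuousAt

lemma continuous_dir' (σ : S) (k : κ ⊕ κ) : Continuous fun t => M.dir' t σ k := by
  rcases k with X | X <;> by_cases h : X ∈ M.region <;> simp only [dir', Sum.elim_inl,
    Sum.elim_inr, h, if_true, if_false] <;> fun_prop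

lemma abs_dir'_le (t : ℝ) (σ : S) (k : κ ⊕ κ) :
    |M.dir' t σ k| ≤ Sum.elim (fun X => |M.coeff X σ|) (fun X => |M.coeff X σ|) k := by
  have hs := Real.abs_sin_le_one t
  have hc := Real.abs_cos_le_one t
  rcases k with X | X <;> by_cases h : X ∈ M.region <;> simp only [dir', Sum.elim_inl,
    Sum.elim_inr, h, if_true, if_false, abs_mul, abs_neg, abs_zero, abs_nonneg]
  · exact mul_le_of_le_one_left (abs_nonneg _) hs
  · exact mul_le_of_le_one_left (abs_nonneg _) hc

variable [Fintype κ]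

/-- Only rotated couplings contribute, by the subtraction formula for the sine. At `s = t` the
product vanishes: the velocity of one configuration is uncorrelated with the energy of any other at
the same angle. -/
lemma dir'_dot_dir (s t : ℝ) (τ σ : S) :
    ∑ k, M.dir' s τ k * M.dir t σ k = Real.sin (t - s) * M.C τ σ := by
  simp only [dir, dir', Fintype.sum_sum_type, Sum.elim_inl, Sum.elim_inr, C, Real.sin_sub]
  rw [← Finset.sum_add_distrib, Finset.mul_sum, ← Finset.sum_subset (Finset.subset_univ M.region)]
  · refine Finset.sum_congr rfl fun X hX => ?_
    simp only [hX, if_true]; ring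
  · intro X _ hX; simp [hX]

lemma dir'_dot_dir' (s t : ℝ) (τ σ : S) :
    ∑ k, M.dir' s τ k * M.dir' t σ k = Real.cos (t - s) * M.C τ σ := by
  simp only [dir', Fintype.sum_sum_type, Sum.elim_inl, Sum.elim_inr, C, Real.cos_sub]
  rw [← Finset.sum_add_distrib, Finset.mul_sum, ← Finset.sum_subset (Finset.subset_univ M.region)]
  · refine Finset.sum_congr rfl fun X hX => ?_
    simp only [hX, if_true]; ring
  · intro X _ hX; simp [hX]

/-- The energy at angle `t`. -/
def energy (t : ℝ) (g : κ ⊕ κ → ℝ) (σ : S) : ℝ :=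
  ∑ k, M.dir t σ k * g k + M.θ t * M.bulk σ + M.rest σ

/-- The centred part of the `t`-derivative of the energy. -/
def force (t : ℝ) (g : κ ⊕ κ → ℝ) (σ : S) : ℝ := ∑ k, M.dir' t σ k * g k

lemma hasDerivAt_energy (t : ℝ) (g : κ ⊕ κ → ℝ) (σ : S) :
    HasDerivAt (fun r => M.energy r g σ) (M.force t g σ + M.θ' t * M.bulk σ) t :=
  ((HasDerivAt.fun_sum fun k _ => (M.hasDerivAt_dir t σ k).mul_const (g k)).add
    ((M.hasDerivAt_θ t).mul_const _)).add_const _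

lemma hasLineDerivAt_energy (t : ℝ) (g u : κ ⊕ κ → ℝ) (σ : S) :
    HasLineDerivAt ℝ (fun g => M.energy t g σ) (∑ k, u k * M.dir t σ k) g u := by
  have := hasDerivAt_linear_line (M.dir t σ) (M.θ t * M.bulk σ + M.rest σ) g u
  simpa only [HasLineDerivAt, energy, add_assoc] using this

lemma hasLineDerivAt_force (t : ℝ) (g u : κ ⊕ κ → ℝ) (σ : S) :
    HasLineDerivAt ℝ (fun g => M.force t g σ) (∑ k, u k * M.dir' t σ k) g u := by
  have := hasDerivAt_linear_line (M.dir' t σ) 0 g u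
  simpa only [HasLineDerivAt, force, add_zero] using this

lemma continuous_energy (σ : S) :
    Continuous fun p : ℝ × (κ ⊕ κ → ℝ) => M.energy p.1 p.2 σ := by
  have hθ : Continuous M.θ :=
    continuous_iff_continuousAt.2 fun t => (M.hasDerivAt_θ t).continuousAt
  have hd := M.continuous_dir σ
  unfold energy
  fun_prop

lemma polyGrowth_force (σ : S) : PolyGrowth fun t g => M.force t g σ :=
  PolyGrowth.sum fun k _ => (PolyGrowth.of_param (M.continuous_dir' σ k)
    fun t => M.abs_dir'_le t σ k).mul (PolyGrowth.coord k)

variable [Fintype S]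

/-- Gibbs average at angle `t`. -/
def av (t : ℝ) (g : κ ⊕ κ → ℝ) (f : S → ℝ) : ℝ := gibbsAvg M.β (M.energy t g) f

/-- Logarithm of the partition function at angle `t`. -/
def pressure (t : ℝ) (g : κ ⊕ κ → ℝ) : ℝ := logPartition M.β (M.energy t g)

variable [Nonempty S]

lemma hasLineDerivAt_weight (t : ℝ) (g u : κ ⊕ κ → ℝ) (σ : S) :
    HasLineDerivAt ℝ (fun g => gibbsWeight M.β (M.energy t g) σ)
      (-M.β * gibbsWeight M.β (M.energy t g) σ * ((∑ k, u k * M.dir t σ k)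
        - M.av t g fun τ => ∑ k, u k * M.dir t τ k)) g u := by
  have := hasDerivAt_gibbsWeight (β := M.β) (fun σ => M.hasLineDerivAt_energy t g u σ) σ
  simp only [zero_smul, add_zero] at this
  exact this

lemma hasLineDerivAt_av (t : ℝ) {f : (κ ⊕ κ → ℝ) → S → ℝ} {f' : S → ℝ} (g u : κ ⊕ κ → ℝ)
    (hf : ∀ σ, HasLineDerivAt ℝ (fun g => f g σ) (f' σ) g u) :
    HasLineDerivAt ℝ (fun g => M.av t g (f g))
      (M.av t g f' - M.β * (M.av t g (fun σ => f g σ * ∑ k, u k * M.dir t σ k)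
        - M.av t g (f g) * M.av t g fun σ => ∑ k, u k * M.dir t σ k)) g u := by
  have := hasDerivAt_gibbsAvg (β := M.β) (fun σ => M.hasLineDerivAt_energy t g u σ) hf
  simp only [zero_smul, add_zero] at this
  exact this

/-- The Gibbs averages at angle `t` do not change along the velocity at angle `t`. -/
lemma hasLineDerivAt_av_self (t : ℝ) (f : S → ℝ) (σ : S) (g : κ ⊕ κ → ℝ) :
    HasLineDerivAt ℝ (fun g => M.av t g f) 0 g (M.dir' t σ) := by
  have := M.hasLineDerivAt_av t (f := fun _ => f) (f' := fun _ => 0) g (M.dir' t σ)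
    fun σ => hasLineDerivAt_const (f σ) g _
  simp only [dir'_dot_dir, sub_self, Real.sin_zero, zero_mul, mul_zero] at this
  convert this using 1
  simp [av, gibbsAvg_const]

section Growth

variable {T : Type*} [TopologicalSpace T]

lemma polyGrowth_av {φ : T → ℝ} (hφ : Continuous φ) {f : T → (κ ⊕ κ → ℝ) → S → ℝ}
    (hf : ∀ σ, PolyGrowth fun t g => f t g σ) : PolyGrowth fun t g => M.av (φ t) g (f t g) := by
  have hE (σ : S) : Continuous fun p : T × (κ ⊕ κ → ℝ) => M.energy (φ p.1) p.2 σ := by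
    have hp : Continuous fun p : T × (κ ⊕ κ → ℝ) => (φ p.1, p.2) := by fun_prop
    have h := (M.continuous_energy σ).comp hp
    exact h
  unfold av
  exact PolyGrowth.gibbsAvg (E := fun t g => M.energy (φ t) g) hE hf

lemma polyGrowth_av_const {φ : T → ℝ} (hφ : Continuous φ) (f : S → ℝ) :
    PolyGrowth fun t g => M.av (φ t) g f :=
  M.polyGrowth_av hφ fun σ => PolyGrowth.const (f σ)

end Growth

/-- Integration by parts of the velocity inside the Gibbs average at the same angle. -/
lemma integral_av_force_mul (t : ℝ) {F F' : S → (κ ⊕ κ → ℝ) → ℝ}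
    (hF : ∀ σ, PolyGrowth fun (_ : Unit) => F σ) (hF' : ∀ σ, PolyGrowth fun (_ : Unit) => F' σ)
    (h : ∀ σ g, HasLineDerivAt ℝ (F σ) (F' σ g) g (M.dir' t σ)) :
    ∫ g, M.av t g (fun σ => M.force t g σ * F σ g) ∂stdGaussianPi (κ ⊕ κ)
      = ∫ g, M.av t g (fun σ => F' σ g) ∂stdGaussianPi (κ ⊕ κ) := by
  have hw (σ : S) : PolyGrowth fun (_ : Unit) g => gibbsWeight M.β (M.energy t g) σ :=
    (PolyGrowth.gibbsWeight M.continuous_energy σ).at_param t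
  have hf (σ : S) : PolyGrowth fun (_ : Unit) g => M.force t g σ :=
    (M.polyGrowth_force σ).at_param t
  unfold av gibbsAvg
  rw [integral_finsetSum _ fun σ _ => ((hw σ).mul ((hf σ).mul (hF σ))).integrable (),
    integral_finsetSum _ fun σ _ => ((hw σ).mul (hF' σ)).integrable ()]
  refine Finset.sum_congr rfl fun σ _ => ?_
  rw [← stdGaussianPi_integral_by_parts (M.dir' t σ) ((hw σ).mul (hF σ)) ((hw σ).mul (hF' σ))]
  · refine integral_congr_ae (ae_of_all _ fun g => ?_)
    simp only [force]; ring
  · intro g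
    have h1 := M.hasLineDerivAt_weight t g (M.dir' t σ) σ
    -- The derivative of the weight along `dir' t σ` is zero because the direction is orthogonal to
    -- all `dir t τ`; only the derivative of `F σ` survives.
    have h2 := HasDerivAt.mul h1 (h σ g)
    simp only [dir'_dot_dir, sub_self, Real.sin_zero, zero_mul, av, gibbsAvg_const, mul_zero,
      zero_smul, add_zero, zero_add] at h2
    exact h2

/-- `ω_{t,s}(C_{1,2})`. -/
def cov₁ (t s : ℝ) (g : κ ⊕ κ → ℝ) : ℝ := M.av t g fun σ => M.av s g (M.C σ)

/-- `ω_{t,s}(C_{1,2}²)`. -/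
def cov₂ (t s : ℝ) (g : κ ⊕ κ → ℝ) : ℝ := M.av t g fun σ => M.av s g fun τ => M.C σ τ ^ 2

/-- `ω_{t,s,t}(C_{1,2} C_{2,3})`. -/
def cov₃ (t s : ℝ) (g : κ ⊕ κ → ℝ) : ℝ := M.av s g fun τ => M.av t g (M.C τ) ^ 2

/-- `ω_{t,s}(B_1 C_{1,2}) - ω_{t,s,t}(B_1 C_{2,3})`. -/
def mixed (t s : ℝ) (g : κ ⊕ κ → ℝ) : ℝ :=
  M.av s g fun τ => M.av t g (fun σ => M.bulk σ * M.C τ σ) - M.av t g M.bulk * M.av t g (M.C τ)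

/-- Gibbs average of the `t`-derivative of the energy. -/
def velocity (t : ℝ) (g : κ ⊕ κ → ℝ) : ℝ :=
  M.av t g (M.force t g) + M.θ' t * M.av t g M.bulk

section Growth

variable {T : Type*} [TopologicalSpace T] {φ ψ : T → ℝ}

lemma polyGrowth_cov₁ (hφ : Continuous φ) (hψ : Continuous ψ) :
    PolyGrowth fun t g => M.cov₁ (φ t) (ψ t) g :=
  M.polyGrowth_av hφ fun σ => M.polyGrowth_av_const hψ (M.C σ)

lemma polyGrowth_cov₂ (hφ : Continuous φ) (hψ : Continuous ψ) :
    PolyGrowth fun t g => M.cov₂ (φ t) (ψ t) g :=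
  M.polyGrowth_av hφ fun σ => M.polyGrowth_av_const hψ fun τ => M.C σ τ ^ 2

lemma polyGrowth_cov₃ (hφ : Continuous φ) (hψ : Continuous ψ) :
    PolyGrowth fun t g => M.cov₃ (φ t) (ψ t) g :=
  M.polyGrowth_av hψ fun τ => (M.polyGrowth_av_const hφ (M.C τ)).sq

lemma polyGrowth_mixed (hφ : Continuous φ) (hψ : Continuous ψ) :
    PolyGrowth fun t g => M.mixed (φ t) (ψ t) g :=
  M.polyGrowth_av hψ fun τ => (M.polyGrowth_av_const hφ fun σ => M.bulk σ * M.C τ σ).sub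
    ((M.polyGrowth_av_const hφ M.bulk).mul (M.polyGrowth_av_const hφ (M.C τ)))

lemma polyGrowth_av_force (hφ : Continuous φ) :
    PolyGrowth fun t g => M.av (φ t) g (M.force (φ t) g) :=
  M.polyGrowth_av hφ fun σ => (M.polyGrowth_force σ).comp hφ

lemma polyGrowth_velocity (hφ : Continuous φ) : PolyGrowth fun t g => M.velocity (φ t) g :=
  (M.polyGrowth_av_force hφ).add ((PolyGrowth.of_param (M.continuous_θ'.comp hφ)
    fun t => M.abs_θ'_le (φ t)).mul (M.polyGrowth_av_const hφ M.bulk))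

end Growth

lemma integral_av_force (t : ℝ) :
    ∫ g, M.av t g (M.force t g) ∂stdGaussianPi (κ ⊕ κ) = 0 := by
  have := M.integral_av_force_mul t (F := fun _ _ => 1) (F' := fun _ _ => 0)
    (fun _ => PolyGrowth.const 1) (fun _ => PolyGrowth.const 0)
    (fun σ g => hasLineDerivAt_const 1 g _)
  simpa [av, gibbsAvg_const] using this

/-- The Gaussian part of the velocity averages to zero, so only the modulated deterministic energy
has a mean. -/
lemma integral_velocity (t : ℝ) :
    ∫ g, M.velocity t g ∂stdGaussianPi (κ ⊕ κ)
      = M.θ' t * ∫ g, M.av t g M.bulk ∂stdGaussianPi (κ ⊕ κ) := by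
  have h₁ : PolyGrowth fun (_ : Unit) g => M.av t g (M.force t g) :=
    M.polyGrowth_av_force continuous_const
  have h₂ : PolyGrowth fun (_ : Unit) g => M.av t g M.bulk :=
    M.polyGrowth_av_const continuous_const M.bulk
  unfold velocity
  rw [integral_add (h₁.integrable ()) ((h₂.integrable ()).const_mul _),
    integral_av_force, integral_const_mul, zero_add]

/-- One integration by parts at angle `t` differentiates the Gibbs state at angle `s`, producing a
thermal covariance of the bulk energy with `C` and a factor `sin(s-t)`. -/
lemma integral_av_force_mul_av_bulk (t s : ℝ) :
    ∫ g, M.av t g (M.force t g) * M.av s g M.bulk ∂stdGaussianPi (κ ⊕ κ)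
      = -M.β * Real.sin (s - t) * ∫ g, M.mixed s t g ∂stdGaussianPi (κ ⊕ κ) := by
  have h0 : PolyGrowth fun (_ : Unit) g => M.av s g M.bulk :=
    M.polyGrowth_av_const continuous_const M.bulk
  have h1 (σ : S) : PolyGrowth fun (_ : Unit) g => M.av s g (fun τ => M.bulk τ * M.C σ τ)
      - M.av s g M.bulk * M.av s g (M.C σ) :=
    (M.polyGrowth_av_const continuous_const fun τ => M.bulk τ * M.C σ τ).sub
      (h0.mul (M.polyGrowth_av_const continuous_const (M.C σ)))
  have key := M.integral_av_force_mul t (F := fun _ g => M.av s g M.bulk)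
    (F' := fun σ g => -M.β * Real.sin (s - t) * (M.av s g (fun τ => M.bulk τ * M.C σ τ)
      - M.av s g M.bulk * M.av s g (M.C σ))) (fun _ => h0)
    (fun σ => (h1 σ).const_mul _) fun σ g => by
      have := M.hasLineDerivAt_av s (f := fun _ => M.bulk) (f' := fun _ => 0) g (M.dir' t σ)
        fun τ => hasLineDerivAt_const (M.bulk τ) g _
      refine HasDerivAt.congr_deriv this ?_
      simp only [dir'_dot_dir, av, gibbsAvg_const, gibbsAvg_const_mul, gibbsAvg_mul_const_mul]
      ring
  simp only [av, gibbsAvg_const_mul, gibbsAvg_mul_const] at key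
  simp only [av, mixed]
  rw [key, integral_const_mul]

/-- Combination of overlaps produced by a double integration by parts. -/
def bracket (t s : ℝ) (g : κ ⊕ κ → ℝ) : ℝ :=
  M.cov₂ t s g - M.cov₃ t s g - M.cov₃ s t g + M.cov₁ t s g ^ 2

/-- The first integration by parts hits either the force at `s`, giving the cosine term, or the
Gibbs state at `s`, giving a sine times a centred covariance that still contains the force at `s`.
Removing that force by a second integration by parts gives the other sine. -/
lemma integral_av_force_mul_self (t s : ℝ) :
    ∫ g, M.av t g (M.force t g) * M.av s g (M.force s g) ∂stdGaussianPi (κ ⊕ κ)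
      = Real.cos (t - s) * ∫ g, M.cov₁ t s g ∂stdGaussianPi (κ ⊕ κ)
        - M.β ^ 2 * Real.sin (t - s) ^ 2 * ∫ g, M.bracket t s g ∂stdGaussianPi (κ ⊕ κ) := by
  have hx : PolyGrowth fun (_ : Unit) g => M.av s g (M.force s g) :=
    M.polyGrowth_av_force continuous_const
  have hC (r : ℝ) (σ : S) : PolyGrowth fun (_ : Unit) g => M.av r g (M.C σ) :=
    M.polyGrowth_av_const continuous_const (M.C σ)
  have hxC (σ : S) : PolyGrowth fun (_ : Unit) g => M.av s g fun τ => M.force s g τ * M.C σ τ :=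
    M.polyGrowth_av continuous_const fun τ =>
      ((M.polyGrowth_force τ).comp continuous_const).mul (PolyGrowth.const _)
  -- first integration by parts
  have key := M.integral_av_force_mul t (F := fun _ g => M.av s g (M.force s g))
    (F' := fun σ g => Real.cos (t - s) * M.av s g (M.C σ) + -M.β * Real.sin (s - t) *
      (M.av s g (fun τ => M.force s g τ * M.C σ τ) - M.av s g (M.force s g) * M.av s g (M.C σ)))
    (fun _ => hx)
    (fun σ => ((hC s σ).const_mul _).add (((hxC σ).sub (hx.mul (hC s σ))).const_mul _))
    fun σ g => by
      have := M.hasLineDerivAt_av s (f := fun g => M.force s g) g (M.dir' t σ)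
        fun τ => M.hasLineDerivAt_force s g _ τ
      refine HasDerivAt.congr_deriv this ?_
      have hcos : Real.cos (t - s) = Real.cos (s - t) := by rw [← Real.cos_neg, neg_sub]
      simp only [dir'_dot_dir, dir'_dot_dir', av, gibbsAvg_const_mul, gibbsAvg_mul_const_mul, hcos]
      ring
  -- second integration by parts
  have hQ (τ : S) : PolyGrowth fun (_ : Unit) g => M.av t g fun σ => M.C σ τ - M.av s g (M.C σ) :=
    M.polyGrowth_av continuous_const fun σ => (PolyGrowth.const _).sub (hC s σ)
  have key₂ := M.integral_av_force_mul s
    (F := fun τ g => M.av t g fun σ => M.C σ τ - M.av s g (M.C σ))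
    (F' := fun τ g => -M.β * Real.sin (t - s) *
      (M.av t g (fun σ => (M.C σ τ - M.av s g (M.C σ)) * M.C τ σ)
        - M.av t g (fun σ => M.C σ τ - M.av s g (M.C σ)) * M.av t g (M.C τ)))
    hQ (fun τ => ((M.polyGrowth_av continuous_const fun σ =>
        ((PolyGrowth.const _).sub (hC s σ)).mul (PolyGrowth.const _)).sub
      ((hQ τ).mul (hC t τ))).const_mul _)
    fun τ g => by
      have := M.hasLineDerivAt_av t (f := fun g σ => M.C σ τ - M.av s g (M.C σ))
        (f' := fun _ => 0) g (M.dir' s τ) fun σ => by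
          -- The inner average is taken at angle `s`, so it is constant along the velocity at `s`.
          have h := HasDerivAt.fun_sub (hasLineDerivAt_const (M.C σ τ) g (M.dir' s τ))
            (M.hasLineDerivAt_av_self s (M.C σ) τ g)
          exact h.congr_deriv (sub_zero 0)
      refine HasDerivAt.congr_deriv this ?_
      simp only [dir'_dot_dir, av, gibbsAvg_const, gibbsAvg_const_mul, gibbsAvg_mul_const_mul]
      ring
  have e₁ (g : κ ⊕ κ → ℝ) :
      M.av t g (fun σ => M.force t g σ * M.av s g (M.force s g))
        = M.av t g (M.force t g) * M.av s g (M.force s g) := gibbsAvg_mul_const _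
  -- Exchanging the two replica averages puts the force at `s` outermost, in the form required by
  -- the second integration by parts.
  have e₂ (g : κ ⊕ κ → ℝ) :
      M.av t g (fun σ => Real.cos (t - s) * M.av s g (M.C σ) + -M.β * Real.sin (s - t) *
        (M.av s g (fun τ => M.force s g τ * M.C σ τ) - M.av s g (M.force s g) * M.av s g (M.C σ)))
      = Real.cos (t - s) * M.cov₁ t s g + -M.β * Real.sin (s - t) *
        M.av s g (fun τ => M.force s g τ * M.av t g fun σ => M.C σ τ - M.av s g (M.C σ)) := by
    have h : gibbsAvg M.β (M.energy t g) (fun σ => gibbsAvg M.β (M.energy s g)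
        fun τ => M.force s g τ * M.C σ τ) = gibbsAvg M.β (M.energy s g) fun τ => M.force s g τ *
          gibbsAvg M.β (M.energy t g) fun σ => M.C σ τ := by
      rw [gibbsAvg_comm]
      simp only [gibbsAvg_const_mul]
    simp only [av, cov₁, gibbsAvg_add, gibbsAvg_sub, gibbsAvg_const_mul, mul_sub,
      gibbsAvg_mul_const, h]
  have e₃ (g : κ ⊕ κ → ℝ) :
      M.av s g (fun τ => -M.β * Real.sin (t - s) *
        (M.av t g (fun σ => (M.C σ τ - M.av s g (M.C σ)) * M.C τ σ)
        - M.av t g (fun σ => M.C σ τ - M.av s g (M.C σ)) * M.av t g (M.C τ)))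
      = -M.β * Real.sin (t - s) * M.bracket t s g := by
    have hsymm (τ : S) : (fun σ => M.C σ τ) = M.C τ := funext fun σ => M.C_comm σ τ
    have hsq (τ σ : S) : M.C σ τ * M.C τ σ = M.C σ τ ^ 2 := by rw [M.C_comm τ σ, pow_two]
    have h2 : gibbsAvg M.β (M.energy s g) (fun τ => gibbsAvg M.β (M.energy t g)
        fun σ => gibbsAvg M.β (M.energy s g) (M.C σ) * M.C τ σ)
        = gibbsAvg M.β (M.energy t g) fun σ => gibbsAvg M.β (M.energy s g) (M.C σ) ^ 2 := by
      rw [gibbsAvg_comm]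
      simp only [gibbsAvg_const_mul, hsymm, pow_two]
    have h3 : gibbsAvg M.β (M.energy s g) (fun τ => gibbsAvg M.β (M.energy t g) (M.C τ))
        = M.cov₁ t s g := by
      rw [gibbsAvg_comm]; simp only [hsymm]; rfl
    simp only [av, bracket, cov₂, cov₃, gibbsAvg_const_mul, sub_mul, gibbsAvg_sub, hsymm,
      hsq, ← pow_two]
    rw [h2, gibbsAvg_comm (E := M.energy s g), h3]
    simp only [cov₁, av]
    ring
  have hR : PolyGrowth fun (_ : Unit) g => M.av s g (fun τ => M.force s g τ *
      M.av t g fun σ => M.C σ τ - M.av s g (M.C σ)) :=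
    M.polyGrowth_av continuous_const fun τ =>
      ((M.polyGrowth_force τ).comp continuous_const).mul (hQ τ)
  simp only [e₁, e₂] at key
  simp only [e₃] at key₂
  have hc : PolyGrowth fun (_ : Unit) g => M.cov₁ t s g :=
    M.polyGrowth_cov₁ continuous_const continuous_const
  rw [key, integral_add ((hc.integrable ()).const_mul _) ((hR.integrable ()).const_mul _),
    integral_const_mul, integral_const_mul, key₂, integral_const_mul]
  -- The two factors `-β` and the opposite signs of the sines combine to `-β² sin²(t-s)`.
  have hsin : Real.sin (s - t) = -Real.sin (t - s) := by rw [← Real.sin_neg, neg_sub]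
  rw [hsin]
  ring

/-- Covariance of the velocities at two angles. -/
theorem integral_velocity_mul_velocity (t s : ℝ) :
    ∫ g, M.velocity t g * M.velocity s g ∂stdGaussianPi (κ ⊕ κ)
      = M.θ' t * M.θ' s * (∫ g, M.av t g M.bulk * M.av s g M.bulk ∂stdGaussianPi (κ ⊕ κ))
        - M.β * (Real.sin (t - s) * M.θ' t * ∫ g, M.mixed t s g ∂stdGaussianPi (κ ⊕ κ))
        - M.β * (Real.sin (s - t) * M.θ' s * ∫ g, M.mixed s t g ∂stdGaussianPi (κ ⊕ κ))
        + Real.cos (t - s) * (∫ g, M.cov₁ t s g ∂stdGaussianPi (κ ⊕ κ))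
        - M.β ^ 2 * (Real.sin (t - s) ^ 2 * ∫ g, M.bracket t s g ∂stdGaussianPi (κ ⊕ κ)) := by
  have hb (r : ℝ) : PolyGrowth fun (_ : Unit) g => M.av r g M.bulk :=
    M.polyGrowth_av_const continuous_const M.bulk
  have hx (r : ℝ) : PolyGrowth fun (_ : Unit) g => M.av r g (M.force r g) :=
    M.polyGrowth_av_force continuous_const
  have i₁ := ((hb t).mul (hb s)).const_mul (M.θ' t * M.θ' s)
  have i₂ := ((hx t).mul (hb s)).const_mul (M.θ' s)
  have i₃ := ((hx s).mul (hb t)).const_mul (M.θ' t)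
  have i₄ := (hx t).mul (hx s)
  have e : ∫ g, M.velocity t g * M.velocity s g ∂stdGaussianPi (κ ⊕ κ)
      = ∫ g, (M.θ' t * M.θ' s * (M.av t g M.bulk * M.av s g M.bulk)
        + M.θ' s * (M.av t g (M.force t g) * M.av s g M.bulk)
        + M.θ' t * (M.av s g (M.force s g) * M.av t g M.bulk)
        + M.av t g (M.force t g) * M.av s g (M.force s g)) ∂stdGaussianPi (κ ⊕ κ) := by
    refine integral_congr_ae (ae_of_all _ fun g => ?_)
    simp only [velocity]; ring
  rw [e, integral_add (((i₁.add i₂).add i₃).integrable ()) (i₄.integrable ()),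
    integral_add ((i₁.add i₂).integrable ()) (i₃.integrable ()),
    integral_add (i₁.integrable ()) (i₂.integrable ()),
    integral_const_mul, integral_const_mul, integral_const_mul, integral_av_force_mul_av_bulk,
    integral_av_force_mul_av_bulk, integral_av_force_mul_self]
  ring

end

end FlipModel

/-! ### Double integrals over the square of angles -/

/-- The double integral over `[0, π]²`. -/
noncomputable def angleIntegral (f : ℝ → ℝ → ℝ) : ℝ :=
  ∫ t in (0 : ℝ)..Real.pi, ∫ s in (0 : ℝ)..Real.pi, f t s

section AngleIntegral

variable {f h : ℝ → ℝ → ℝ}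

lemma continuous_inner_angleIntegral (hf : Continuous fun p : ℝ × ℝ => f p.1 p.2) :
    Continuous fun t => ∫ s in (0 : ℝ)..Real.pi, f t s :=
  intervalIntegral.continuous_parametric_intervalIntegral_of_continuous' hf _ _

lemma continuous_section (hf : Continuous fun p : ℝ × ℝ => f p.1 p.2) (t : ℝ) :
    Continuous (f t) :=
  hf.comp (by fun_prop : Continuous fun s : ℝ => (t, s))

lemma angleIntegral_add (hf : Continuous fun p : ℝ × ℝ => f p.1 p.2)
    (hh : Continuous fun p : ℝ × ℝ => h p.1 p.2) :
    angleIntegral (fun t s => f t s + h t s) = angleIntegral f + angleIntegral h := by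
  unfold angleIntegral
  rw [← intervalIntegral.integral_add
    ((continuous_inner_angleIntegral hf).intervalIntegrable _ _)
    ((continuous_inner_angleIntegral hh).intervalIntegrable _ _)]
  refine intervalIntegral.integral_congr fun t _ => ?_
  exact intervalIntegral.integral_add ((continuous_section hf t).intervalIntegrable _ _)
    ((continuous_section hh t).intervalIntegrable _ _)

lemma angleIntegral_const_mul (c : ℝ) :
    angleIntegral (fun t s => c * f t s) = c * angleIntegral f := by
  simp only [angleIntegral, intervalIntegral.integral_const_mul]

lemma angleIntegral_sub (hf : Continuous fun p : ℝ × ℝ => f p.1 p.2)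
    (hh : Continuous fun p : ℝ × ℝ => h p.1 p.2) :
    angleIntegral (fun t s => f t s - h t s) = angleIntegral f - angleIntegral h := by
  have := angleIntegral_add hf (h := fun t s => -1 * h t s) (hh.const_mul (-1))
  rw [angleIntegral_const_mul] at this
  simpa [sub_eq_add_neg] using this

lemma angleIntegral_swap (hf : Continuous fun p : ℝ × ℝ => f p.1 p.2) :
    angleIntegral (fun t s => f s t) = angleIntegral f := by
  unfold angleIntegral
  refine intervalIntegral_intervalIntegral_swap ?_
  have hc : Continuous fun p : ℝ × ℝ => f p.2 p.1 :=
    hf.comp (by fun_prop : Continuous fun p : ℝ × ℝ => (p.2, p.1))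
  have h1 : IntegrableOn (fun p : ℝ × ℝ => f p.2 p.1)
      (Set.Icc 0 Real.pi ×ˢ Set.Icc 0 Real.pi) :=
    hc.continuousOn.integrableOn_compact (isCompact_Icc.prod isCompact_Icc)
  refine h1.mono_set ?_
  rw [Set.uIoc_of_le Real.pi_pos.le]
  exact Set.prod_mono Set.Ioc_subset_Icc_self Set.Ioc_subset_Icc_self

/-- The majorant depends on one angle only, because the thermal variance is controlled only after
integration over its angle; the other angle contributes `π`. -/
lemma abs_angleIntegral_le {ψ : ℝ → ℝ} (hψ : Continuous ψ)
    (hf : Continuous fun p : ℝ × ℝ => f p.1 p.2) (hb : ∀ t s, |f t s| ≤ ψ t) :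
    |angleIntegral f| ≤ Real.pi * ∫ t in (0 : ℝ)..Real.pi, ψ t := by
  have hpi := Real.pi_pos.le
  rw [← intervalIntegral.integral_const_mul]
  refine (intervalIntegral.abs_integral_le_integral_abs hpi).trans
    (intervalIntegral.integral_mono_on hpi
      ((continuous_inner_angleIntegral hf).abs.intervalIntegrable _ _)
      ((hψ.const_mul _).intervalIntegrable _ _) fun t _ => ?_)
  have := intervalIntegral.norm_integral_le_of_norm_le_const (a := 0) (b := Real.pi) (f := f t)
    (C := ψ t) fun s _ => hb t s
  rw [Real.norm_eq_abs, sub_zero, abs_of_nonneg hpi] at this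
  linarith

end AngleIntegral

/-! ### Fubini for Gaussian functionals integrated over the angle. -/

section GaussianProcess

variable {K : Type*} [Fintype K] {Φ : ℝ → (K → ℝ) → ℝ}

lemma PolyGrowth.intervalIntegral (hΦ : PolyGrowth Φ) (a b : ℝ) :
    PolyGrowth (fun (_ : Unit) g => ∫ t in a..b, Φ t g) := by
  obtain ⟨hc, C, hC, n, hn⟩ := hΦ
  refine ⟨?_, C * |b - a|, by positivity, n, fun _ g => ?_⟩
  · refine intervalIntegral.continuous_parametric_intervalIntegral_of_continuous'
      (f := fun (p : Unit × (K → ℝ)) t => Φ t p.2) ?_ a b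
    exact hc.comp (by fun_prop : Continuous fun q : (Unit × (K → ℝ)) × ℝ => (q.2, q.1.2))
  · have := intervalIntegral.norm_integral_le_of_norm_le_const (a := a) (b := b)
      (f := fun t => Φ t g) fun t _ => hn t g
    rw [Real.norm_eq_abs] at this
    linarith

lemma PolyGrowth.integral_sq_intervalIntegral (hΦ : PolyGrowth Φ) :
    ∫ g, (∫ t in (0 : ℝ)..Real.pi, Φ t g) ^ 2 ∂stdGaussianPi K
      = angleIntegral fun t s => ∫ g, Φ t g * Φ s g ∂stdGaussianPi K := by
  have hX := hΦ.intervalIntegral 0 Real.pi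
  have h1 : ∫ g, (∫ t in (0 : ℝ)..Real.pi, Φ t g) ^ 2 ∂stdGaussianPi K
      = ∫ g, (∫ t in (0 : ℝ)..Real.pi, Φ t g * ∫ s in (0 : ℝ)..Real.pi, Φ s g)
        ∂stdGaussianPi K := by
    simp only [intervalIntegral.integral_mul_const, pow_two]
  have hX' : PolyGrowth fun (_ : ℝ) g => ∫ s in (0 : ℝ)..Real.pi, Φ s g :=
    hX.comp (φ := fun _ => ()) continuous_const
  rw [h1, ← (hΦ.mul hX').intervalIntegral_integral_swap]
  refine intervalIntegral.integral_congr fun t _ => ?_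
  have h2 : PolyGrowth fun s g => Φ t g * Φ s g := (hΦ.comp continuous_const).mul hΦ
  simp only
  rw [h2.intervalIntegral_integral_swap]
  simp only [intervalIntegral.integral_const_mul]

lemma PolyGrowth.sq_integral_intervalIntegral (hΦ : PolyGrowth Φ) :
    (∫ g, (∫ t in (0 : ℝ)..Real.pi, Φ t g) ∂stdGaussianPi K) ^ 2
      = angleIntegral fun t s =>
        (∫ g, Φ t g ∂stdGaussianPi K) * ∫ g, Φ s g ∂stdGaussianPi K := by
  rw [← hΦ.intervalIntegral_integral_swap]
  simp only [angleIntegral, intervalIntegral.integral_const_mul,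
    intervalIntegral.integral_mul_const, pow_two]

end GaussianProcess

/-! ### The pressure difference between the angles `π` and `0`. -/

namespace FlipModel

noncomputable section

variable {κ S : Type*} [DecidableEq κ] [Fintype κ] (M : FlipModel κ S)

lemma energy_zero (g : κ ⊕ κ → ℝ) (σ : S) :
    M.energy 0 g σ = ∑ X, M.coeff X σ * g (.inl X) + M.θ 0 * M.bulk σ + M.rest σ := by
  simp [energy, dir, Fintype.sum_sum_type]

lemma energy_pi (g : κ ⊕ κ → ℝ) (σ : S) :
    M.energy Real.pi g σ = ∑ X, M.coeff X σ * (if X ∈ M.region then -g (.inl X) else g (.inl X))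
      + M.θ Real.pi * M.bulk σ + M.rest σ := by
  simp only [energy, dir, Fintype.sum_sum_type, Sum.elim_inl, Sum.elim_inr, Real.cos_pi,
    Real.sin_pi, zero_mul, ite_self, Finset.sum_const_zero, add_zero]
  congr 2
  refine Finset.sum_congr rfl fun X _ => ?_
  split_ifs <;> ring

variable [Fintype S]

/-- Difference of the pressures at angles `π` and `0`. -/
def pressureDiff (g : κ ⊕ κ → ℝ) : ℝ := M.pressure Real.pi g - M.pressure 0 g

/-- The sine vanishes at both ends of the rotation, so the second copy drops out. The variance
bounds then concern a function of the first copy only, leaving the second free for resampling. -/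
lemma pressureDiff_eq_elim (g : κ ⊕ κ → ℝ) :
    M.pressureDiff g = M.pressureDiff (Sum.elim (fun X => g (.inl X)) 0) := by
  have h0 : M.energy 0 g = M.energy 0 (Sum.elim (fun X => g (.inl X)) 0) := by
    funext σ; simp [energy_zero]
  have h1 : M.energy Real.pi g = M.energy Real.pi (Sum.elim (fun X => g (.inl X)) 0) := by
    funext σ; simp [energy_pi]
  simp only [pressureDiff, pressure]
  rw [h0, h1]

/-- Reversing the disorder of the region exchanges the two endpoint energies, provided the
modulation agrees at both ends. -/
lemma pressureDiff_odd (hθ : M.θ Real.pi = M.θ 0) (x : κ → ℝ) :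
    M.pressureDiff (Sum.elim (fun i => if i ∈ M.region then -x i else x i) 0)
      = -M.pressureDiff (Sum.elim x 0) := by
  have h0 : M.energy 0 (Sum.elim (fun i => if i ∈ M.region then -x i else x i) 0)
      = M.energy Real.pi (Sum.elim x 0) := by
    funext σ; simp only [energy_zero, energy_pi, Sum.elim_inl, hθ]
  have h1 : M.energy Real.pi (Sum.elim (fun i => if i ∈ M.region then -x i else x i) 0)
      = M.energy 0 (Sum.elim x 0) := by
    funext σ
    simp only [energy_zero, energy_pi, Sum.elim_inl, hθ]
    congr 3
    funext X
    by_cases hX : X ∈ M.region <;> simp [hX]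
  simp only [pressureDiff, pressure]
  rw [h0, h1]
  ring

variable [Nonempty S]

lemma continuous_velocity (g : κ ⊕ κ → ℝ) : Continuous fun t => M.velocity t g := by
  have hp : Continuous fun t : ℝ => (t, g) := by fun_prop
  have h := (M.polyGrowth_velocity continuous_id).1.comp hp
  exact h

/-- Fundamental theorem of calculus along the rotation, at fixed disorder. -/
lemma pressureDiff_eq (g : κ ⊕ κ → ℝ) :
    M.pressureDiff g = -M.β * ∫ t in (0 : ℝ)..Real.pi, M.velocity t g := by
  rw [← intervalIntegral.integral_const_mul, intervalIntegral.integral_eq_sub_of_hasDerivAt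
    (f := fun t => M.pressure t g)]
  · rfl
  · intro t _
    refine (hasDerivAt_logPartition (β := M.β)
      fun σ => M.hasDerivAt_energy t g σ).congr_deriv ?_
    rw [gibbsAvg_add, gibbsAvg_const_mul]
    rfl
  · exact ((M.continuous_velocity g).const_mul _).intervalIntegrable _ _

lemma polyGrowth_pressureDiff : PolyGrowth fun (_ : Unit) => M.pressureDiff := by
  have h := ((M.polyGrowth_velocity continuous_id).intervalIntegral 0 Real.pi).const_mul (-M.β)
  have e : M.pressureDiff = fun g => -M.β * ∫ t in (0 : ℝ)..Real.pi, M.velocity t g :=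
    funext M.pressureDiff_eq
  rw [e]
  exact h

lemma integral_pressureDiff_sq :
    ∫ g, M.pressureDiff g ^ 2 ∂stdGaussianPi (κ ⊕ κ)
      = M.β ^ 2 * angleIntegral fun t s =>
        ∫ g, M.velocity t g * M.velocity s g ∂stdGaussianPi (κ ⊕ κ) := by
  have h := (M.polyGrowth_velocity continuous_id).integral_sq_intervalIntegral
  simp only [id] at h
  simp only [pressureDiff_eq, mul_pow, neg_sq]
  rw [integral_const_mul, h]

lemma sq_integral_pressureDiff :
    (∫ g, M.pressureDiff g ∂stdGaussianPi (κ ⊕ κ)) ^ 2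
      = M.β ^ 2 * angleIntegral fun t s => (∫ g, M.velocity t g ∂stdGaussianPi (κ ⊕ κ))
        * ∫ g, M.velocity s g ∂stdGaussianPi (κ ⊕ κ) := by
  have h := (M.polyGrowth_velocity continuous_id).sq_integral_intervalIntegral
  simp only [id] at h
  simp only [pressureDiff_eq]
  rw [integral_const_mul, mul_pow, neg_sq, h]

/-! ### Variance of the pressure difference -/

lemma polyGrowth_pressureDiff_elim :
    PolyGrowth fun (_ : Unit) (x : κ → ℝ) => M.pressureDiff (Sum.elim x 0) := by
  refine M.polyGrowth_pressureDiff.comp_right (r := fun x : κ → ℝ => Sum.elim x 0) ?_ fun x => ?_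
  · refine continuous_pi ?_
    rintro (i | i)
    · exact continuous_apply i
    · exact continuous_const
  · refine (pi_norm_le_iff_of_nonneg (norm_nonneg _)).2 ?_
    rintro (i | i)
    · exact norm_le_pi_norm x i
    · simp

/-- Changing one coupling moves each endpoint energy by at most `A i * |y - x i|` in sup norm; the
factor 2 counts the endpoints. -/
lemma abs_pressureDiff_update_sub_le {A : κ → ℝ} (hA : ∀ X σ, |M.coeff X σ| ≤ A X) (i : κ)
    (x : κ → ℝ) (y : ℝ) :
    |M.pressureDiff (Sum.elim (Function.update x i y) 0) - M.pressureDiff (Sum.elim x 0)|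
      ≤ 2 * M.β * A i * |y - x i| := by
  have hsum (c : κ → ℝ) (e : ℝ) : (∑ X, c X * Function.update x i y X + e)
      - (∑ X, c X * x X + e) = c i * (y - x i) := by
    rw [add_sub_add_right_eq_sub, ← Finset.sum_sub_distrib, Finset.sum_eq_single i]
    · simp; ring
    · intro X _ hX; simp [hX]
    · simp
  have hb (σ : S) : |M.coeff i σ * (y - x i)| ≤ A i * |y - x i| := by
    rw [abs_mul]; exact mul_le_mul_of_nonneg_right (hA i σ) (abs_nonneg _)
  have h0 (σ : S) : |M.energy 0 (Sum.elim (Function.update x i y) 0) σ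
      - M.energy 0 (Sum.elim x 0) σ| ≤ A i * |y - x i| := by
    have := hsum (fun X => M.coeff X σ) (M.θ 0 * M.bulk σ + M.rest σ)
    simp only [energy_zero, Sum.elim_inl, add_assoc]
    rw [this]
    exact hb σ
  have h1 (σ : S) : |M.energy Real.pi (Sum.elim (Function.update x i y) 0) σ
      - M.energy Real.pi (Sum.elim x 0) σ| ≤ A i * |y - x i| := by
    have := hsum (fun X => if X ∈ M.region then -M.coeff X σ else M.coeff X σ)
      (M.θ Real.pi * M.bulk σ + M.rest σ)
    have e (X : κ) (z : ℝ) : M.coeff X σ * (if X ∈ M.region then -z else z)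
        = (if X ∈ M.region then -M.coeff X σ else M.coeff X σ) * z := by
      split_ifs <;> ring
    simp only [energy_pi, Sum.elim_inl, add_assoc, e]
    rw [this]
    split_ifs
    · rw [neg_mul, abs_neg]; exact hb σ
    · exact hb σ
  have l0 := abs_logPartition_sub_le M.β_pos.le h0
  have l1 := abs_logPartition_sub_le M.β_pos.le h1
  simp only [pressureDiff, pressure]
  rw [abs_le] at l0 l1 ⊢
  constructor <;> linarith [l0.1, l0.2, l1.1, l1.2]

/-- Without oddness the sum runs over all couplings, not only those of the region. This is where the
outer volume enters part 2. -/
lemma variance_pressureDiff_le {A : κ → ℝ} (hA : ∀ X σ, |M.coeff X σ| ≤ A X) :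
    ∫ g, M.pressureDiff g ^ 2 ∂stdGaussianPi (κ ⊕ κ)
      - (∫ g, M.pressureDiff g ∂stdGaussianPi (κ ⊕ κ)) ^ 2 ≤ 4 * M.β ^ 2 * ∑ X, A X ^ 2 := by
  have := integral_sq_sub_sq_integral_le M.polyGrowth_pressureDiff_elim
    (L := fun X => 2 * M.β * A X) (M.abs_pressureDiff_update_sub_le hA)
  simp only [← pressureDiff_eq_elim] at this
  refine this.trans_eq ?_
  rw [Finset.mul_sum]
  exact Finset.sum_congr rfl fun _ _ => by ring

lemma integral_pressureDiff_sq_le (hθ : M.θ Real.pi = M.θ 0) {A : κ → ℝ}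
    (hA : ∀ X σ, |M.coeff X σ| ≤ A X) :
    ∫ g, M.pressureDiff g ^ 2 ∂stdGaussianPi (κ ⊕ κ)
      ≤ 4 * M.β ^ 2 * ∑ X ∈ M.region, A X ^ 2 := by
  have := integral_sq_le_of_odd M.polyGrowth_pressureDiff_elim
    (L := fun X => 2 * M.β * A X) (M.abs_pressureDiff_update_sub_le hA) M.region
    (M.pressureDiff_odd hθ)
  simp only [← pressureDiff_eq_elim] at this
  refine this.trans_eq ?_
  rw [Finset.mul_sum]
  exact Finset.sum_congr rfl fun _ _ => by ring

lemma sq_integral_pressureDiff_le :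
    (∫ g, M.pressureDiff g ∂stdGaussianPi (κ ⊕ κ)) ^ 2
      ≤ ∫ g, M.pressureDiff g ^ 2 ∂stdGaussianPi (κ ⊕ κ) := by
  have h1 := M.polyGrowth_pressureDiff.integrable ()
  have h2 := M.polyGrowth_pressureDiff.sq.integrable ()
  set m := ∫ g, M.pressureDiff g ∂stdGaussianPi (κ ⊕ κ) with hm
  have h : 0 ≤ ∫ g, (M.pressureDiff g ^ 2 - 2 * m * M.pressureDiff g + m ^ 2)
      ∂stdGaussianPi (κ ⊕ κ) := integral_nonneg fun g => by
    have := sq_nonneg (M.pressureDiff g - m)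
    simp only [Pi.zero_apply]; linarith
  have h3 : Integrable (fun g => M.pressureDiff g ^ 2 - 2 * m * M.pressureDiff g)
      (stdGaussianPi (κ ⊕ κ)) := h2.sub (h1.const_mul _)
  rw [integral_add h3 (integrable_const _), integral_sub h2 (h1.const_mul _),
    integral_const_mul, ← hm] at h
  simp at h
  linarith

/-! ### The thermal fluctuations of the modulated term -/

/-- Thermal variance of the modulated energy. -/
def bulkVar (t : ℝ) (g : κ ⊕ κ → ℝ) : ℝ :=
  M.av t g (fun σ => M.bulk σ ^ 2) - M.av t g M.bulk ^ 2

lemma polyGrowth_bulkVar {T : Type*} [TopologicalSpace T] {φ : T → ℝ} (hφ : Continuous φ) :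
    PolyGrowth fun t g => M.bulkVar (φ t) g :=
  (M.polyGrowth_av_const hφ _).sub (M.polyGrowth_av_const hφ M.bulk).sq

lemma continuous_integral_bulkVar :
    Continuous fun t => ∫ g, M.bulkVar t g ∂stdGaussianPi (κ ⊕ κ) :=
  (M.polyGrowth_bulkVar continuous_id).continuous_integral

/-- In the angular derivative of the Gibbs average of the bulk energy, the terms with the force have
zero disorder average, leaving `-β θ'` times the thermal variance. The variance is thus controlled
by a difference of mean energies. -/
lemma integral_av_bulk_sub (a b : ℝ) :
    (∫ g, M.av b g M.bulk ∂stdGaussianPi (κ ⊕ κ)) - ∫ g, M.av a g M.bulk ∂stdGaussianPi (κ ⊕ κ)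
      = -M.β * ∫ t in a..b, M.θ' t * ∫ g, M.bulkVar t g ∂stdGaussianPi (κ ⊕ κ) := by
  have hB : PolyGrowth fun t g => M.av t g M.bulk := M.polyGrowth_av_const continuous_id M.bulk
  have hV : PolyGrowth fun t g => M.θ' t * M.bulkVar t g :=
    (PolyGrowth.of_param M.continuous_θ' M.abs_θ'_le).mul (M.polyGrowth_bulkVar continuous_id)
  have hFB : PolyGrowth fun t g => M.av t g fun σ => M.force t g σ * M.bulk σ :=
    M.polyGrowth_av continuous_id fun σ => (M.polyGrowth_force σ).mul (PolyGrowth.const _)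
  have hF : PolyGrowth fun t g => M.av t g (M.force t g) := M.polyGrowth_av_force continuous_id
  have hD := (hV.add (hFB.sub (hF.mul hB))).const_mul (-M.β)
  have hd (g : κ ⊕ κ → ℝ) (t : ℝ) : HasDerivAt (fun t => M.av t g M.bulk)
      (-M.β * (M.θ' t * M.bulkVar t g + (M.av t g (fun σ => M.force t g σ * M.bulk σ)
        - M.av t g (M.force t g) * M.av t g M.bulk))) t := by
    refine (hasDerivAt_gibbsAvg (β := M.β) (f := fun _ => M.bulk) (f' := fun _ => 0)
      (fun σ => M.hasDerivAt_energy t g σ) fun σ => hasDerivAt_const _ _).congr_deriv ?_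
    have e : (fun σ => M.bulk σ * (M.force t g σ + M.θ' t * M.bulk σ))
        = fun σ => M.force t g σ * M.bulk σ + M.θ' t * M.bulk σ ^ 2 := by
      funext σ; ring
    simp only [e, gibbsAvg_add, gibbsAvg_const_mul, gibbsAvg_const, bulkVar, av]
    ring
  have hftc (g : κ ⊕ κ → ℝ) := intervalIntegral.integral_eq_sub_of_hasDerivAt (a := a) (b := b)
    (fun t _ => hd g t)
    ((hD.1.comp (by fun_prop : Continuous fun t : ℝ => (t, g))).intervalIntegrable a b)
  have hz₁ (t : ℝ) : ∫ g, M.av t g (fun σ => M.force t g σ * M.bulk σ)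
      ∂stdGaussianPi (κ ⊕ κ) = 0 := by
    have := M.integral_av_force_mul t (F := fun σ _ => M.bulk σ) (F' := fun _ _ => 0)
      (fun _ => PolyGrowth.const _) (fun _ => PolyGrowth.const 0)
      fun σ g => hasLineDerivAt_const _ g _
    simpa [av, gibbsAvg_const] using this
  have hz₂ (t : ℝ) : ∫ g, M.av t g (M.force t g) * M.av t g M.bulk
      ∂stdGaussianPi (κ ⊕ κ) = 0 := by
    have := M.integral_av_force_mul t (F := fun _ g => M.av t g M.bulk) (F' := fun _ _ => 0)
      (fun _ => hB.at_param t) (fun _ => PolyGrowth.const 0)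
      fun σ g => M.hasLineDerivAt_av_self t M.bulk σ g
    simpa [av, gibbsAvg_const, gibbsAvg_mul_const] using this
  rw [← integral_sub (hB.integrable b) (hB.integrable a)]
  simp_rw [← hftc]
  rw [← hD.intervalIntegral_integral_swap, ← intervalIntegral.integral_const_mul]
  refine intervalIntegral.integral_congr fun t _ => ?_
  rw [integral_const_mul, integral_add (hV.integrable t) ((hFB.sub (hF.mul hB)).integrable t),
    integral_sub (hFB.integrable t) ((hF.mul hB).integrable t), hz₁, hz₂, integral_const_mul]
  ring

lemma abs_integral_av_bulk_le {N : ℝ} (hN : ∀ σ, |M.bulk σ| ≤ N) (t : ℝ) :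
    |∫ g, M.av t g M.bulk ∂stdGaussianPi (κ ⊕ κ)| ≤ N := by
  have := norm_integral_le_of_norm_le_const (μ := stdGaussianPi (κ ⊕ κ))
    (f := fun g => M.av t g M.bulk) (C := N) (ae_of_all _ fun g => abs_gibbsAvg_le_of_le hN)
  simpa using this

/-- The thermal variance of the modulated energy is small on average over the angle. -/
lemma integral_abs_θ'_mul_bulkVar_le {N : ℝ} (hN : ∀ σ, |M.bulk σ| ≤ N) {c : ℝ} (hc₀ : 0 ≤ c)
    (hc : c ≤ Real.pi) (hpos : ∀ t ∈ Set.Icc 0 c, 0 ≤ M.θ' t)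
    (hneg : ∀ t ∈ Set.Icc c Real.pi, M.θ' t ≤ 0) :
    ∫ t in (0 : ℝ)..Real.pi, |M.θ' t| * ∫ g, M.bulkVar t g ∂stdGaussianPi (κ ⊕ κ)
      ≤ 4 * N / M.β := by
  have hcont : Continuous fun t => |M.θ' t| * ∫ g, M.bulkVar t g ∂stdGaussianPi (κ ⊕ κ) :=
    M.continuous_θ'.abs.mul M.continuous_integral_bulkVar
  rw [← intervalIntegral.integral_add_adjacent_intervals (hcont.intervalIntegrable 0 c)
    (hcont.intervalIntegrable c Real.pi)]
  have h1 : ∫ t in (0 : ℝ)..c, |M.θ' t| * ∫ g, M.bulkVar t g ∂stdGaussianPi (κ ⊕ κ)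
      = ∫ t in (0 : ℝ)..c, M.θ' t * ∫ g, M.bulkVar t g ∂stdGaussianPi (κ ⊕ κ) := by
    refine intervalIntegral.integral_congr fun t ht => ?_
    rw [Set.uIcc_of_le hc₀] at ht
    simp only [abs_of_nonneg (hpos t ht)]
  have h2 : ∫ t in c..Real.pi, |M.θ' t| * ∫ g, M.bulkVar t g ∂stdGaussianPi (κ ⊕ κ)
      = -∫ t in c..Real.pi, M.θ' t * ∫ g, M.bulkVar t g ∂stdGaussianPi (κ ⊕ κ) := by
    rw [← intervalIntegral.integral_neg]
    refine intervalIntegral.integral_congr fun t ht => ?_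
    rw [Set.uIcc_of_le hc] at ht
    simp only [abs_of_nonpos (hneg t ht), neg_mul]
  have e1 := M.integral_av_bulk_sub 0 c
  have e2 := M.integral_av_bulk_sub c Real.pi
  have b0 := abs_le.1 (M.abs_integral_av_bulk_le hN 0)
  have b1 := abs_le.1 (M.abs_integral_av_bulk_le hN c)
  have b2 := abs_le.1 (M.abs_integral_av_bulk_le hN Real.pi)
  -- With `m` the mean bulk energy, the two pieces add up to `(m 0 - 2 m c + m π) / β`, and each
  -- value is at most `N` in absolute value; hence `4 N`.
  rw [h1, h2, le_div_iff₀ M.β_pos]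
  nlinarith [b0.1, b0.2, b1.1, b1.2, b2.1, b2.2]

/-- For a fixed configuration at angle `s`, the integrand is a thermal covariance at angle `t` of
the bulk energy with a bounded observable. -/
lemma abs_mixed_le {N δ : ℝ} (hδ : 0 < δ) (hC : ∀ σ τ, |M.C σ τ| ≤ N) (t s : ℝ)
    (g : κ ⊕ κ → ℝ) : |M.mixed t s g| ≤ N * (δ / 2 + M.bulkVar t g / (2 * δ)) :=
  abs_gibbsAvg_le_of_le fun τ => abs_gibbsAvg_mul_sub_mul_le hδ (hC τ)

lemma abs_integral_mixed_le {N δ : ℝ} (hδ : 0 < δ) (hC : ∀ σ τ, |M.C σ τ| ≤ N) (t s : ℝ) :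
    |∫ g, M.mixed t s g ∂stdGaussianPi (κ ⊕ κ)|
      ≤ N * (δ / 2 + (∫ g, M.bulkVar t g ∂stdGaussianPi (κ ⊕ κ)) / (2 * δ)) := by
  have hV : PolyGrowth fun (_ : Unit) g => M.bulkVar t g := M.polyGrowth_bulkVar continuous_const
  have hm : PolyGrowth fun (_ : Unit) g => M.mixed t s g :=
    M.polyGrowth_mixed continuous_const continuous_const
  have hi : Integrable (fun g => δ / 2 + M.bulkVar t g / (2 * δ)) (stdGaussianPi (κ ⊕ κ)) :=
    (integrable_const _).add ((hV.integrable ()).div_const _)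
  have h := (abs_integral_le_integral_abs (f := fun g => M.mixed t s g)
    (μ := stdGaussianPi (κ ⊕ κ))).trans (integral_mono (hm.integrable ()).abs (hi.const_mul N)
      fun g => M.abs_mixed_le hδ hC t s g)
  rw [integral_const_mul, integral_add (integrable_const _) ((hV.integrable ()).div_const _)] at h
  simpa [integral_div] using h

/-- The mixed term is negligible. -/
lemma abs_angleIntegral_mixed_le {N N' δ : ℝ} (hδ : 0 < δ) (hN : ∀ σ, |M.bulk σ| ≤ N)
    (hC : ∀ σ τ, |M.C σ τ| ≤ N') {c : ℝ} (hc₀ : 0 ≤ c) (hc : c ≤ Real.pi)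
    (hpos : ∀ t ∈ Set.Icc 0 c, 0 ≤ M.θ' t) (hneg : ∀ t ∈ Set.Icc c Real.pi, M.θ' t ≤ 0) :
    |angleIntegral fun t s => Real.sin (t - s) * M.θ' t
        * ∫ g, M.mixed t s g ∂stdGaussianPi (κ ⊕ κ)|
      ≤ Real.pi * (N' * (Real.pi * δ + 2 * N / (δ * M.β))) := by
  have hN' : 0 ≤ N' := (abs_nonneg _).trans (hC (Classical.arbitrary S) (Classical.arbitrary S))
  have hV := M.continuous_integral_bulkVar
  have hm : Continuous fun p : ℝ × ℝ => ∫ g, M.mixed p.1 p.2 g ∂stdGaussianPi (κ ⊕ κ) :=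
    (M.polyGrowth_mixed continuous_fst continuous_snd).continuous_integral
  have hθ := M.continuous_θ'
  have hcont : Continuous fun p : ℝ × ℝ => Real.sin (p.1 - p.2) * M.θ' p.1
      * ∫ g, M.mixed p.1 p.2 g ∂stdGaussianPi (κ ⊕ κ) := by fun_prop
  set V : ℝ → ℝ := fun t => ∫ g, M.bulkVar t g ∂stdGaussianPi (κ ⊕ κ) with hVdef
  have hψ : Continuous fun t => N' * δ + N' / (2 * δ) * (|M.θ' t| * V t) := by fun_prop
  refine (abs_angleIntegral_le hψ hcont fun t s => ?_).trans ?_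
  · rw [abs_mul, abs_mul]
    have h1 := M.abs_integral_mixed_le hδ hC t s
    have h2 : |Real.sin (t - s)| * |M.θ' t| ≤ |M.θ' t| :=
      mul_le_of_le_one_left (abs_nonneg _) (Real.abs_sin_le_one _)
    have h3 : |M.θ' t| * (N' * (δ / 2)) ≤ 2 * (N' * (δ / 2)) :=
      mul_le_mul_of_nonneg_right (M.abs_θ'_le t) (by positivity)
    calc _ ≤ |M.θ' t| * (N' * (δ / 2 + V t / (2 * δ))) :=
          mul_le_mul h2 h1 (abs_nonneg _) (abs_nonneg _)
      _ = |M.θ' t| * (N' * (δ / 2)) + N' / (2 * δ) * (|M.θ' t| * V t) := by ring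
      _ ≤ _ := by linarith
  · refine mul_le_mul_of_nonneg_left ?_ Real.pi_pos.le
    have hi : Continuous fun t => N' / (2 * δ) * (|M.θ' t| * V t) := by fun_prop
    rw [intervalIntegral.integral_add (intervalIntegrable_const) (hi.intervalIntegrable _ _),
      intervalIntegral.integral_const, intervalIntegral.integral_const_mul]
    have h4 := mul_le_mul_of_nonneg_left
      (M.integral_abs_θ'_mul_bulkVar_le hN hc₀ hc hpos hneg)
      (by positivity : 0 ≤ N' / (2 * δ))
    have h5 : N' / (2 * δ) * (4 * N / M.β) = N' * (2 * N / (δ * M.β)) := by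
      have := M.β_pos.ne'
      field_simp; ring
    rw [h5] at h4
    simp only [sub_zero, smul_eq_mul]
    linarith

/-! ### The integrated identity -/

lemma integral_bracket (t s : ℝ) :
    ∫ g, M.bracket t s g ∂stdGaussianPi (κ ⊕ κ)
      = (∫ g, M.cov₂ t s g ∂stdGaussianPi (κ ⊕ κ)) - (∫ g, M.cov₃ t s g ∂stdGaussianPi (κ ⊕ κ))
        - (∫ g, M.cov₃ s t g ∂stdGaussianPi (κ ⊕ κ))
        + ∫ g, M.cov₁ t s g ^ 2 ∂stdGaussianPi (κ ⊕ κ) := by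
  have h₁ : PolyGrowth fun (_ : Unit) g => M.cov₁ t s g ^ 2 :=
    (M.polyGrowth_cov₁ continuous_const continuous_const).sq
  have h₂ : PolyGrowth fun (_ : Unit) g => M.cov₂ t s g :=
    M.polyGrowth_cov₂ continuous_const continuous_const
  have h₃ (t s : ℝ) : PolyGrowth fun (_ : Unit) g => M.cov₃ t s g :=
    M.polyGrowth_cov₃ continuous_const continuous_const
  unfold bracket
  rw [integral_add (((h₂.sub (h₃ t s)).sub (h₃ s t)).integrable ()) (h₁.integrable ()),
    integral_sub ((h₂.sub (h₃ t s)).integrable ()) ((h₃ s t).integrable ()),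
    integral_sub (h₂.integrable ()) ((h₃ t s).integrable ())]

/-- The overlap integral of the flip identities. -/
def overlapIntegral : ℝ := angleIntegral fun t s => Real.sin (t - s) ^ 2 *
  ((∫ g, M.cov₂ t s g ∂stdGaussianPi (κ ⊕ κ)) - 2 * (∫ g, M.cov₃ t s g ∂stdGaussianPi (κ ⊕ κ))
    + ∫ g, M.cov₁ t s g ^ 2 ∂stdGaussianPi (κ ⊕ κ))

section Continuity

lemma continuous_integral_cov₁ :
    Continuous fun p : ℝ × ℝ => ∫ g, M.cov₁ p.1 p.2 g ∂stdGaussianPi (κ ⊕ κ) :=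
  (M.polyGrowth_cov₁ continuous_fst continuous_snd).continuous_integral

lemma continuous_integral_cov₁_sq :
    Continuous fun p : ℝ × ℝ => ∫ g, M.cov₁ p.1 p.2 g ^ 2 ∂stdGaussianPi (κ ⊕ κ) :=
  (M.polyGrowth_cov₁ continuous_fst continuous_snd).sq.continuous_integral

lemma continuous_integral_cov₂ :
    Continuous fun p : ℝ × ℝ => ∫ g, M.cov₂ p.1 p.2 g ∂stdGaussianPi (κ ⊕ κ) :=
  (M.polyGrowth_cov₂ continuous_fst continuous_snd).continuous_integral

lemma continuous_integral_cov₃ :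
    Continuous fun p : ℝ × ℝ => ∫ g, M.cov₃ p.1 p.2 g ∂stdGaussianPi (κ ⊕ κ) :=
  (M.polyGrowth_cov₃ continuous_fst continuous_snd).continuous_integral

lemma continuous_integral_mixed :
    Continuous fun p : ℝ × ℝ => ∫ g, M.mixed p.1 p.2 g ∂stdGaussianPi (κ ⊕ κ) :=
  (M.polyGrowth_mixed continuous_fst continuous_snd).continuous_integral

lemma continuous_integral_bulk_mul_bulk :
    Continuous fun p : ℝ × ℝ =>
      ∫ g, M.av p.1 g M.bulk * M.av p.2 g M.bulk ∂stdGaussianPi (κ ⊕ κ) :=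
  ((M.polyGrowth_av_const continuous_fst M.bulk).mul
    (M.polyGrowth_av_const continuous_snd M.bulk)).continuous_integral

end Continuity

lemma continuous_kernel_cov₃ : Continuous fun p : ℝ × ℝ => Real.sin (p.1 - p.2) ^ 2 *
    ∫ g, M.cov₃ p.1 p.2 g ∂stdGaussianPi (κ ⊕ κ) := by
  have := M.continuous_integral_cov₃
  fun_prop

/-- The kernel is symmetric in the two angles, so the two three-replica terms of the bracket merge
into one with coefficient 2. -/
lemma angleIntegral_cov₃_swap :
    (angleIntegral fun t s => Real.sin (t - s) ^ 2 *
        ∫ g, M.cov₃ s t g ∂stdGaussianPi (κ ⊕ κ))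
      = angleIntegral fun t s => Real.sin (t - s) ^ 2 *
        ∫ g, M.cov₃ t s g ∂stdGaussianPi (κ ⊕ κ) := by
  rw [← angleIntegral_swap (f := fun t s => Real.sin (t - s) ^ 2 *
    ∫ g, M.cov₃ t s g ∂stdGaussianPi (κ ⊕ κ)) M.continuous_kernel_cov₃]
  congr 1
  funext t s
  rw [← neg_sub s t, Real.sin_neg, neg_sq]

lemma angleIntegral_bracket :
    (angleIntegral fun t s => Real.sin (t - s) ^ 2 *
        ∫ g, M.bracket t s g ∂stdGaussianPi (κ ⊕ κ)) = M.overlapIntegral := by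
  have h₁ := M.continuous_integral_cov₁_sq
  have h₂ := M.continuous_integral_cov₂
  have h₃ := M.continuous_integral_cov₃
  have h₃' : Continuous fun p : ℝ × ℝ => ∫ g, M.cov₃ p.2 p.1 g ∂stdGaussianPi (κ ⊕ κ) :=
    (M.polyGrowth_cov₃ continuous_snd continuous_fst).continuous_integral
  have e : (fun t s => Real.sin (t - s) ^ 2 * ∫ g, M.bracket t s g ∂stdGaussianPi (κ ⊕ κ))
      = fun t s => Real.sin (t - s) ^ 2 *
      ((∫ g, M.cov₂ t s g ∂stdGaussianPi (κ ⊕ κ)) - 2 * (∫ g, M.cov₃ t s g ∂stdGaussianPi (κ ⊕ κ))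
        + ∫ g, M.cov₁ t s g ^ 2 ∂stdGaussianPi (κ ⊕ κ))
      + (Real.sin (t - s) ^ 2 * (∫ g, M.cov₃ t s g ∂stdGaussianPi (κ ⊕ κ))
        - Real.sin (t - s) ^ 2 * ∫ g, M.cov₃ s t g ∂stdGaussianPi (κ ⊕ κ)) := by
    funext t s
    rw [integral_bracket]
    ring
  rw [e, angleIntegral_add (by fun_prop) (by fun_prop), angleIntegral_sub (by fun_prop)
    (by fun_prop), angleIntegral_cov₃_swap, sub_self, add_zero]
  rfl

/-- Part 1 of the theorem orders the three-replica angles as `t, s, t` and part 2 as `s, t, s`; both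
give the same integral. -/
lemma overlapIntegral_eq_swap :
    M.overlapIntegral = angleIntegral fun t s => Real.sin (t - s) ^ 2 *
      ((∫ g, M.cov₂ t s g ∂stdGaussianPi (κ ⊕ κ))
        - 2 * (∫ g, M.cov₃ s t g ∂stdGaussianPi (κ ⊕ κ))
        + ∫ g, M.cov₁ t s g ^ 2 ∂stdGaussianPi (κ ⊕ κ)) := by
  have h₁ := M.continuous_integral_cov₁_sq
  have h₂ := M.continuous_integral_cov₂
  have h₃ := M.continuous_integral_cov₃
  have h₃' : Continuous fun p : ℝ × ℝ => ∫ g, M.cov₃ p.2 p.1 g ∂stdGaussianPi (κ ⊕ κ) :=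
    (M.polyGrowth_cov₃ continuous_snd continuous_fst).continuous_integral
  have e : (fun t s => Real.sin (t - s) ^ 2 *
      ((∫ g, M.cov₂ t s g ∂stdGaussianPi (κ ⊕ κ))
        - 2 * (∫ g, M.cov₃ t s g ∂stdGaussianPi (κ ⊕ κ))
        + ∫ g, M.cov₁ t s g ^ 2 ∂stdGaussianPi (κ ⊕ κ)))
      = fun t s => Real.sin (t - s) ^ 2 *
      ((∫ g, M.cov₂ t s g ∂stdGaussianPi (κ ⊕ κ)) - 2 * (∫ g, M.cov₃ s t g ∂stdGaussianPi (κ ⊕ κ))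
        + ∫ g, M.cov₁ t s g ^ 2 ∂stdGaussianPi (κ ⊕ κ))
      + 2 * (Real.sin (t - s) ^ 2 * (∫ g, M.cov₃ s t g ∂stdGaussianPi (κ ⊕ κ))
        - Real.sin (t - s) ^ 2 * ∫ g, M.cov₃ t s g ∂stdGaussianPi (κ ⊕ κ)) := by
    funext t s
    ring
  rw [overlapIntegral, e, angleIntegral_add (by fun_prop) (by fun_prop), angleIntegral_const_mul,
    angleIntegral_sub (by fun_prop) (by fun_prop), angleIntegral_cov₃_swap, sub_self, mul_zero,
    add_zero]

/-- The variance of the pressure difference in terms of overlaps. -/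
theorem variance_pressureDiff_eq :
    ∫ g, M.pressureDiff g ^ 2 ∂stdGaussianPi (κ ⊕ κ)
      - (∫ g, M.pressureDiff g ∂stdGaussianPi (κ ⊕ κ)) ^ 2
    = M.β ^ 2 * (angleIntegral fun t s => M.θ' t * M.θ' s *
          ((∫ g, M.av t g M.bulk * M.av s g M.bulk ∂stdGaussianPi (κ ⊕ κ))
            - (∫ g, M.av t g M.bulk ∂stdGaussianPi (κ ⊕ κ))
              * ∫ g, M.av s g M.bulk ∂stdGaussianPi (κ ⊕ κ)))
      - 2 * M.β ^ 3 * (angleIntegral fun t s => Real.sin (t - s) * M.θ' t *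
          ∫ g, M.mixed t s g ∂stdGaussianPi (κ ⊕ κ))
      + M.β ^ 2 * (angleIntegral fun t s => Real.cos (t - s) *
          ∫ g, M.cov₁ t s g ∂stdGaussianPi (κ ⊕ κ))
      - M.β ^ 4 * M.overlapIntegral := by
  have hθ := M.continuous_θ'
  have c₁ := M.continuous_integral_cov₁
  have c₂ := M.continuous_integral_mixed
  have c₃ := M.continuous_integral_bulk_mul_bulk
  have c₄ : Continuous fun p : ℝ × ℝ => ∫ g, M.av p.1 g M.bulk ∂stdGaussianPi (κ ⊕ κ) :=
    (M.polyGrowth_av_const continuous_fst M.bulk).continuous_integral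
  have c₄' : Continuous fun p : ℝ × ℝ => ∫ g, M.av p.2 g M.bulk ∂stdGaussianPi (κ ⊕ κ) :=
    (M.polyGrowth_av_const continuous_snd M.bulk).continuous_integral
  have c₅ : Continuous fun p : ℝ × ℝ => ∫ g, M.mixed p.2 p.1 g ∂stdGaussianPi (κ ⊕ κ) :=
    (M.polyGrowth_mixed continuous_snd continuous_fst).continuous_integral
  have c₆ : Continuous fun p : ℝ × ℝ => ∫ g, M.bracket p.1 p.2 g ∂stdGaussianPi (κ ⊕ κ) :=
    ((((M.polyGrowth_cov₂ continuous_fst continuous_snd).sub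
      (M.polyGrowth_cov₃ continuous_fst continuous_snd)).sub
      (M.polyGrowth_cov₃ continuous_snd continuous_fst)).add
      (M.polyGrowth_cov₁ continuous_fst continuous_snd).sq).continuous_integral
  have c₇ : Continuous fun p : ℝ × ℝ =>
      ∫ g, M.velocity p.1 g * M.velocity p.2 g ∂stdGaussianPi (κ ⊕ κ) :=
    ((M.polyGrowth_velocity continuous_fst).mul
      (M.polyGrowth_velocity continuous_snd)).continuous_integral
  have c₈ : Continuous fun p : ℝ × ℝ => ∫ g, M.velocity p.1 g ∂stdGaussianPi (κ ⊕ κ) :=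
    (M.polyGrowth_velocity continuous_fst).continuous_integral
  have c₈' : Continuous fun p : ℝ × ℝ => ∫ g, M.velocity p.2 g ∂stdGaussianPi (κ ⊕ κ) :=
    (M.polyGrowth_velocity continuous_snd).continuous_integral
  rw [integral_pressureDiff_sq, sq_integral_pressureDiff, ← mul_sub,
    ← angleIntegral_sub (by fun_prop) (by fun_prop)]
  -- The two cross terms between force and bulk coincide after renaming the angles, hence the factor
  -- 2.
  have hsw : (angleIntegral fun t s => Real.sin (s - t) * M.θ' s *
        ∫ g, M.mixed s t g ∂stdGaussianPi (κ ⊕ κ))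
      = angleIntegral fun t s => Real.sin (t - s) * M.θ' t *
        ∫ g, M.mixed t s g ∂stdGaussianPi (κ ⊕ κ) :=
    angleIntegral_swap (f := fun t s => Real.sin (t - s) * M.θ' t *
        ∫ g, M.mixed t s g ∂stdGaussianPi (κ ⊕ κ)) (by fun_prop)
  have e : (fun t s => (∫ g, M.velocity t g * M.velocity s g ∂stdGaussianPi (κ ⊕ κ))
        - (∫ g, M.velocity t g ∂stdGaussianPi (κ ⊕ κ))
          * ∫ g, M.velocity s g ∂stdGaussianPi (κ ⊕ κ))
      = fun t s => M.θ' t * M.θ' s *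
          ((∫ g, M.av t g M.bulk * M.av s g M.bulk ∂stdGaussianPi (κ ⊕ κ))
            - (∫ g, M.av t g M.bulk ∂stdGaussianPi (κ ⊕ κ))
              * ∫ g, M.av s g M.bulk ∂stdGaussianPi (κ ⊕ κ))
        - M.β * (Real.sin (t - s) * M.θ' t * ∫ g, M.mixed t s g ∂stdGaussianPi (κ ⊕ κ))
        - M.β * (Real.sin (s - t) * M.θ' s * ∫ g, M.mixed s t g ∂stdGaussianPi (κ ⊕ κ))
        + Real.cos (t - s) * (∫ g, M.cov₁ t s g ∂stdGaussianPi (κ ⊕ κ))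
        - M.β ^ 2 * (Real.sin (t - s) ^ 2 * ∫ g, M.bracket t s g ∂stdGaussianPi (κ ⊕ κ)) := by
    funext t s
    rw [integral_velocity_mul_velocity, integral_velocity, integral_velocity]
    ring
  rw [e, angleIntegral_sub (by fun_prop) (by fun_prop), angleIntegral_add (by fun_prop)
    (by fun_prop), angleIntegral_sub (by fun_prop) (by fun_prop), angleIntegral_sub (by fun_prop)
    (by fun_prop), angleIntegral_const_mul, angleIntegral_const_mul, angleIntegral_const_mul,
    hsw, angleIntegral_bracket]
  ring

lemma abs_angleIntegral_cos_cov₁_le {N : ℝ} (hC : ∀ σ τ, |M.C σ τ| ≤ N) :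
    |angleIntegral fun t s => Real.cos (t - s) * ∫ g, M.cov₁ t s g ∂stdGaussianPi (κ ⊕ κ)|
      ≤ Real.pi ^ 2 * N := by
  have c₁ := M.continuous_integral_cov₁
  refine (abs_angleIntegral_le (ψ := fun _ => N) continuous_const (by fun_prop)
    fun t s => ?_).trans_eq ?_
  · have h : |∫ g, M.cov₁ t s g ∂stdGaussianPi (κ ⊕ κ)| ≤ N := by
      have := norm_integral_le_of_norm_le_const (μ := stdGaussianPi (κ ⊕ κ))
        (f := fun g => M.cov₁ t s g) (C := N) (ae_of_all _ fun g =>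
          abs_gibbsAvg_le_of_le fun σ => abs_gibbsAvg_le_of_le (hC σ))
      simpa using this
    rw [abs_mul]
    exact (mul_le_of_le_one_left (abs_nonneg _) (Real.abs_cos_le_one _)).trans h
  · simp; ring

/-- Bound for the overlap integral when the deterministic energy is not modulated. -/
theorem abs_overlapIntegral_le (hθ : M.θ Real.pi = M.θ 0) (hθ' : ∀ t, M.θ' t = 0) {A : κ → ℝ}
    (hA : ∀ X σ, |M.coeff X σ| ≤ A X) {N : ℝ} (hC : ∀ σ τ, |M.C σ τ| ≤ N) :
    M.β ^ 2 * |M.overlapIntegral| ≤ 4 * (∑ X ∈ M.region, A X ^ 2) + Real.pi ^ 2 * N := by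
  have h1 := M.variance_pressureDiff_eq
  have h2 := M.integral_pressureDiff_sq_le hθ hA
  have h3 := M.sq_integral_pressureDiff_le
  have h4 := M.abs_angleIntegral_cos_cov₁_le hC
  have h5 := sq_nonneg (∫ g, M.pressureDiff g ∂stdGaussianPi (κ ⊕ κ))
  have hz : (angleIntegral fun _ _ => (0 : ℝ)) = 0 := by simp [angleIntegral]
  -- Without modulation the identity reduces to variance `= β² X - β⁴` times the overlap integral,
  -- which is then solved for the latter.
  simp only [hθ', mul_zero, zero_mul, hz, zero_add, sub_zero] at h1
  set X := angleIntegral fun t s => Real.cos (t - s) * ∫ g, M.cov₁ t s g ∂stdGaussianPi (κ ⊕ κ)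
  set V := ∫ g, M.pressureDiff g ^ 2 ∂stdGaussianPi (κ ⊕ κ)
      - (∫ g, M.pressureDiff g ∂stdGaussianPi (κ ⊕ κ)) ^ 2 with hV
  have hb : 0 < M.β ^ 2 := pow_pos M.β_pos 2
  have e : M.β ^ 2 * (M.β ^ 2 * M.overlapIntegral) = M.β ^ 2 * X - V := by rw [h1]; ring
  have h6 : M.β ^ 2 * (M.β ^ 2 * |M.overlapIntegral|)
      ≤ M.β ^ 2 * (4 * (∑ X ∈ M.region, A X ^ 2) + Real.pi ^ 2 * N) := by
    rw [← abs_of_pos hb, ← abs_mul, abs_of_pos hb, ← abs_of_pos hb, ← abs_mul, abs_of_pos hb, e]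
    have h7 := mul_le_mul_of_nonneg_left h4 hb.le
    have h8 : |M.β ^ 2 * X - V| ≤ |M.β ^ 2 * X| + |V| := abs_sub _ _
    rw [abs_mul, abs_of_pos hb, abs_of_nonneg (by rw [hV]; linarith : 0 ≤ V)] at h8
    have h9 : V ≤ 4 * M.β ^ 2 * ∑ X ∈ M.region, A X ^ 2 := by rw [hV]; linarith
    linarith
  exact le_of_mul_le_mul_left h6 hb

/-- Bound for the full flip identity. -/
theorem abs_flip_identity_le {A : κ → ℝ} (hA : ∀ X σ, |M.coeff X σ| ≤ A X) {N N' δ : ℝ}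
    (hδ : 0 < δ) (hN : ∀ σ, |M.bulk σ| ≤ N) (hC : ∀ σ τ, |M.C σ τ| ≤ N') {c : ℝ} (hc₀ : 0 ≤ c)
    (hc : c ≤ Real.pi) (hpos : ∀ t ∈ Set.Icc 0 c, 0 ≤ M.θ' t)
    (hneg : ∀ t ∈ Set.Icc c Real.pi, M.θ' t ≤ 0) :
    |M.β ^ 2 * (angleIntegral fun t s => M.θ' t * M.θ' s *
          ((∫ g, M.av t g M.bulk * M.av s g M.bulk ∂stdGaussianPi (κ ⊕ κ))
            - (∫ g, M.av t g M.bulk ∂stdGaussianPi (κ ⊕ κ))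
              * ∫ g, M.av s g M.bulk ∂stdGaussianPi (κ ⊕ κ)))
      + 2 * M.β ^ 3 * (angleIntegral fun t s => Real.sin (t - s) * M.θ' t *
          ∫ g, M.mixed t s g ∂stdGaussianPi (κ ⊕ κ))
      - M.β ^ 4 * M.overlapIntegral|
    ≤ M.β ^ 2 * (4 * ∑ X, A X ^ 2) + M.β ^ 2 * (Real.pi ^ 2 * N')
      + 4 * M.β ^ 3 * (Real.pi * (N' * (Real.pi * δ + 2 * N / (δ * M.β)))) := by
  have h1 := M.variance_pressureDiff_eq
  have h2 := M.variance_pressureDiff_le hA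
  have h3 := M.sq_integral_pressureDiff_le
  have h4 := abs_le.1 (M.abs_angleIntegral_cos_cov₁_le hC)
  have h5 := abs_le.1 (M.abs_angleIntegral_mixed_le hδ hN hC hc₀ hc hpos hneg)
  have hb2 : 0 < M.β ^ 2 := pow_pos M.β_pos 2
  -- The quantity to bound has `+2β³` before the mixed term and the variance identity has `-2β³`;
  -- the difference `4β³` times a negligible integral goes into the error.
  have hb3 : 0 < 4 * M.β ^ 3 := mul_pos four_pos (pow_pos M.β_pos 3)
  have h6 := mul_le_mul_of_nonneg_left h4.1 hb2.le
  have h7 := mul_le_mul_of_nonneg_left h4.2 hb2.le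
  have h8 := mul_le_mul_of_nonneg_left h5.1 hb3.le
  have h9 := mul_le_mul_of_nonneg_left h5.2 hb3.le
  rw [abs_le]
  constructor <;> linarith

end

end FlipModel

namespace FlipSpinGlass

noncomputable section

/-! ### Replica averages -/

section Replicas

variable {d : ℕ} {Λ : Finset (Site d)} {β : ℝ}

lemma boltzmann_eq_gibbsWeight (E : SpinConfig Λ → ℝ) (σ : SpinConfig Λ) :
    boltzmann β E σ = gibbsWeight β E σ := rfl

lemma randomState_zero (E : Fin 0 → SpinConfig Λ → ℝ) (f : (Fin 0 → SpinConfig Λ) → ℝ) :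
    randomState β E f = f default := by
  rw [randomState, Fintype.sum_unique, Fin.prod_univ_zero, mul_one]
  exact congrArg f (Subsingleton.elim _ _)

/-- Splitting off the first replica turns product states into iterated Gibbs averages. -/
lemma randomState_succ {n : ℕ} (E : Fin (n + 1) → SpinConfig Λ → ℝ)
    (f : (Fin (n + 1) → SpinConfig Λ) → ℝ) :
    randomState β E f = gibbsAvg β (E 0) fun x =>
      randomState β (fun k => E k.succ) fun σ => f (Fin.cons x σ) := by
  unfold randomState gibbsAvg
  rw [← (Fin.consEquiv fun _ : Fin (n + 1) => SpinConfig Λ).sum_comp, Fintype.sum_prod_type]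
  refine Finset.sum_congr rfl fun x _ => ?_
  rw [Finset.mul_sum]
  refine Finset.sum_congr rfl fun σ _ => ?_
  rw [Fin.prod_univ_succ]
  have hc : (Fin.consEquiv fun _ : Fin (n + 1) => SpinConfig Λ) (x, σ) = Fin.cons x σ := rfl
  simp only [hc, Fin.cons_zero, Fin.cons_succ, boltzmann_eq_gibbsWeight]
  ring

variable (E : ℝ → SpinConfig Λ → ℝ)

lemma randomState_one (t : ℝ) (F : SpinConfig Λ → ℝ) :
    randomState β (fun k => E (![t] k)) (fun σ => F (σ 0)) = gibbsAvg β (E t) F := by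
  simp [randomState_succ, randomState_zero]

lemma randomState_two (t s : ℝ) (F : SpinConfig Λ → SpinConfig Λ → ℝ) :
    randomState β (fun k => E (![t, s] k)) (fun σ => F (σ 0) (σ 1))
      = gibbsAvg β (E t) fun x => gibbsAvg β (E s) fun y => F x y := by
  simp only [randomState_succ, randomState_zero]
  rfl

lemma randomState_three (t s r : ℝ) (F : SpinConfig Λ → SpinConfig Λ → SpinConfig Λ → ℝ) :
    randomState β (fun k => E (![t, s, r] k)) (fun σ => F (σ 0) (σ 1) (σ 2))
      = gibbsAvg β (E t) fun x => gibbsAvg β (E s) fun y => gibbsAvg β (E r) fun z => F x y z := by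
  simp only [randomState_succ, randomState_zero]
  rfl

lemma randomState_four (t s r q : ℝ)
    (F : SpinConfig Λ → SpinConfig Λ → SpinConfig Λ → SpinConfig Λ → ℝ) :
    randomState β (fun k => E (![t, s, r, q] k)) (fun σ => F (σ 0) (σ 1) (σ 2) (σ 3))
      = gibbsAvg β (E t) fun x => gibbsAvg β (E s) fun y => gibbsAvg β (E r) fun z =>
        gibbsAvg β (E q) fun u => F x y z u := by
  simp only [randomState_succ, randomState_zero]
  rfl

end Replicas

/-! ### The spin system as a flip model -/

lemma abs_spinProd_le_one {d : ℕ} {Λ : Finset (Site d)} (X : Finset (Site d))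
    (σ : SpinConfig Λ) : |spinProd X σ| ≤ 1 := by
  unfold spinProd
  split_ifs
  · simp
  · rw [Finset.abs_prod]
    refine (Finset.prod_eq_one fun i _ => ?_).le
    rcases Int.units_eq_one_or (σ i) with h | h <;> simp [h]

/-- Subsets of the volume `Λ`. -/
abbrev Bond {d : ℕ} (Λ : Finset (Site d)) : Type := {X : Finset (Site d) // X ∈ Λ.powerset}

section Sums

variable {d : ℕ} {Λ Λ' : Finset (Site d)}

lemma sum_bond_subset (h : Λ' ⊆ Λ) (f : Finset (Site d) → ℝ) :
    ∑ X : Bond Λ with X.1 ⊆ Λ', f X.1 = ∑ X ∈ Λ'.powerset, f X := by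
  rw [Finset.sum_filter, Finset.sum_coe_sort Λ.powerset fun X => if X ⊆ Λ' then f X else 0,
    ← Finset.sum_filter]
  refine Finset.sum_congr ?_ fun _ _ => rfl
  ext X
  simp only [Finset.mem_filter, Finset.mem_powerset]
  exact ⟨fun hX => hX.2, fun hX => ⟨hX.trans h, hX⟩⟩

lemma sum_bond_not_subset (f : Finset (Site d) → ℝ) :
    ∑ X : Bond Λ with ¬ X.1 ⊆ Λ', f X.1 = ∑ X ∈ Λ.powerset with ¬ X ⊆ Λ', f X := by
  rw [Finset.sum_filter, Finset.sum_coe_sort Λ.powerset fun X => if ¬ X ⊆ Λ' then f X else 0,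
    ← Finset.sum_filter]

end Sums

/-- A modulation together with its derivative. -/
structure Modulation where
  /-- the modulation -/
  θ : ℝ → ℝ
  /-- its derivative -/
  θ' : ℝ → ℝ
  hasDerivAt_θ : ∀ t, HasDerivAt θ (θ' t) t
  continuous_θ' : Continuous θ'
  abs_θ'_le : ∀ t, |θ' t| ≤ 2

/-- The trivial modulation. -/
def Modulation.one : Modulation where
  θ _ := 1
  θ' _ := 0
  hasDerivAt_θ t := hasDerivAt_const t 1
  continuous_θ' := continuous_const
  abs_θ'_le t := by simp

/-- The modulation of the mean energy in the full flip. -/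
def Modulation.cosAddSin : Modulation where
  θ t := Real.cos t + Real.sin t
  θ' t := Real.cos t - Real.sin t
  hasDerivAt_θ t :=
    ((Real.hasDerivAt_cos t).add (Real.hasDerivAt_sin t)).congr_deriv (by ring)
  continuous_θ' := by fun_prop
  abs_θ'_le t := by
    have h1 := abs_le.1 (Real.abs_cos_le_one t)
    have h2 := abs_le.1 (Real.abs_sin_le_one t)
    exact abs_le.2 ⟨by linarith [h1.1, h2.2], by linarith [h1.2, h2.1]⟩

section Model

variable {d : ℕ} (m : Modulation) {β : ℝ} (hβ : 0 < β) (μ Δ : Finset (Site d) → ℝ)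
  (Λ Λ' : Finset (Site d))

/-- The spin glass in standardized couplings as a flip model. -/
def spinModel : FlipModel (Bond Λ) (SpinConfig Λ) where
  β := β
  β_pos := hβ
  coeff X σ := -(Δ X.1 * spinProd X.1 σ)
  region := Finset.univ.filter fun X => X.1 ⊆ Λ'
  bulk := hamIn μ Λ'
  rest := hamOut μ Λ'
  θ := m.θ
  θ' := m.θ'
  hasDerivAt_θ := m.hasDerivAt_θ
  continuous_θ' := m.continuous_θ'
  abs_θ'_le := m.abs_θ'_le

/-- The energy of the flipped spin system as a function of the couplings. -/
def couplingHam (t : ℝ) (j : Bond Λ ⊕ Bond Λ → ℝ) (σ : SpinConfig Λ) : ℝ :=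
  -(Real.cos t * (∑ X : Bond Λ with X.1 ⊆ Λ', (j (.inl X) - μ X.1) * spinProd X.1 σ)
    + Real.sin t * (∑ X : Bond Λ with X.1 ⊆ Λ', (j (.inr X) - μ X.1) * spinProd X.1 σ)
    + ∑ X : Bond Λ with ¬ X.1 ⊆ Λ', j (.inl X) * spinProd X.1 σ)
    + m.θ t * hamIn μ Λ' σ

variable {m μ Δ Λ Λ'}

lemma continuous_couplingHam (t : ℝ) (σ : SpinConfig Λ) :
    Continuous fun j => couplingHam m μ Λ Λ' t j σ := by
  unfold couplingHam
  fun_prop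

/-- The substitution `J = μ + Δ g` moves the means inside `Λ'` into the modulated bulk and those
outside into the fixed rest. -/
lemma couplingHam_eq_energy (t : ℝ) (g : Bond Λ ⊕ Bond Λ → ℝ) :
    couplingHam m μ Λ Λ' t (Sum.elim (fun X => μ X.1 + Δ X.1 * g (.inl X))
        fun X => μ X.1 + Δ X.1 * g (.inr X))
      = (spinModel m hβ μ Δ Λ Λ').energy t g := by
  funext σ
  have hout : hamOut μ Λ' σ = -∑ X : Bond Λ with ¬ X.1 ⊆ Λ', μ X.1 * spinProd X.1 σ := by
    rw [hamOut, sum_bond_not_subset fun X => μ X * spinProd X σ]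
  simp only [couplingHam, FlipModel.energy, FlipModel.dir, spinModel, Fintype.sum_sum_type,
    Sum.elim_inl, Sum.elim_inr, hout, Finset.mem_filter, Finset.mem_univ, true_and,
    add_sub_cancel_left]
  simp only [Finset.sum_filter, Finset.mul_sum, ← Finset.sum_neg_distrib,
    ← Finset.sum_add_distrib, neg_add]
  have : ∀ a b c e : ℝ, a = b + e → a + c = b + c + e := by intros; linarith
  refine this _ _ _ _ ?_
  rw [← Finset.sum_add_distrib]
  refine Finset.sum_congr rfl fun X _ => ?_
  by_cases h : X.1 ⊆ Λ' <;> simp only [h, if_true, if_false, not_true_eq_false,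
    not_false_eq_true] <;> ring

variable {Ω : Type*} {J Jt : Finset (Site d) → Ω → ℝ}

lemma centeredFlipHam_eq_couplingHam (h : Λ' ⊆ Λ) (t : ℝ) (w : Ω) :
    centeredFlipHam μ J Jt Λ Λ' t w = couplingHam Modulation.one μ Λ Λ' t
      (Sum.elim (fun X => J X.1 w) fun X => Jt X.1 w) := by
  funext σ
  simp only [centeredFlipHam, couplingHam, Modulation.one, Sum.elim_inl, Sum.elim_inr]
  rw [sum_bond_subset h fun X => (J X w - μ X) * spinProd X σ,
    sum_bond_subset h fun X => (Jt X w - μ X) * spinProd X σ,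
    sum_bond_not_subset fun X => J X w * spinProd X σ]
  simp only [hamIn, hamOut]
  ring

/-- The full flip is the centred flip with the mean energy multiplied by `cos t + sin t`, since both
copies have the same means. -/
lemma flipHam_eq_couplingHam (h : Λ' ⊆ Λ) (t : ℝ) (w : Ω) :
    flipHam J Jt Λ Λ' t w = couplingHam Modulation.cosAddSin μ Λ Λ' t
      (Sum.elim (fun X => J X.1 w) fun X => Jt X.1 w) := by
  funext σ
  simp only [flipHam, couplingHam, Modulation.cosAddSin, Sum.elim_inl, Sum.elim_inr]
  rw [sum_bond_subset h fun X => (J X w - μ X) * spinProd X σ,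
    sum_bond_subset h fun X => (Jt X w - μ X) * spinProd X σ,
    sum_bond_not_subset fun X => J X w * spinProd X σ]
  simp only [hamIn, hamOut, sub_mul, Finset.sum_sub_distrib]
  ring

/-- The case `b = 0` is included, so couplings of zero variance need no separate treatment. -/
lemma map_gaussianReal_affine (a b : ℝ) :
    (gaussianReal 0 1).map (fun x => a + b * x) = gaussianReal a (Real.toNNReal (b ^ 2)) := by
  have h : (fun x : ℝ => a + b * x) = (fun x => a + x) ∘ fun x => b * x := rfl
  rw [h, ← Measure.map_map (by fun_prop) (by fun_prop), gaussianReal_map_const_mul,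
    gaussianReal_map_const_add]
  congr 1
  · simp
  · ext; simp [Real.coe_toNNReal _ (sq_nonneg b)]

variable [MeasurableSpace Ω] {P : Measure Ω} [IsProbabilityMeasure P]

/-- Expectations of functions of the couplings in a finite volume, in standardized couplings. -/
lemma integral_couplings (hJ : IsGaussianDisorder P μ Δ J Jt) {Ψ : (Bond Λ ⊕ Bond Λ → ℝ) → ℝ}
    (hΨ : Continuous Ψ) :
    ∫ w, Ψ (Sum.elim (fun X => J X.1 w) fun X => Jt X.1 w) ∂P
      = ∫ g, Ψ (Sum.elim (fun X => μ X.1 + Δ X.1 * g (.inl X))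
        fun X => μ X.1 + Δ X.1 * g (.inr X)) ∂stdGaussianPi (Bond Λ ⊕ Bond Λ) := by
  set Z : Bond Λ ⊕ Bond Λ → Ω → ℝ := Sum.elim (fun X => J X.1) fun X => Jt X.1 with hZ
  set ν : Bond Λ ⊕ Bond Λ → Finset (Site d) := Sum.elim Subtype.val Subtype.val with hν
  have hlaw (k : Bond Λ ⊕ Bond Λ) :
      HasLaw (Z k) (gaussianReal (μ (ν k)) (Real.toNNReal (Δ (ν k) ^ 2))) P := by
    rcases k with X | X
    · exact hJ.law X.1
    · exact hJ.law_copy X.1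
  have hindep : iIndepFun Z P := by
    have h := hJ.indep.precomp (g := Sum.map (Subtype.val : Bond Λ → _) (Subtype.val : Bond Λ → _))
      (Sum.map_injective.2 ⟨Subtype.val_injective, Subtype.val_injective⟩)
    convert! h using 1
    funext k
    rcases k with X | X <;> rfl
  have hae (k : Bond Λ ⊕ Bond Λ) : AEMeasurable (Z k) P := (hlaw k).aemeasurable
  -- Independence makes the joint law of the couplings a product of Gaussians, which is the
  -- coordinatewise affine image of the standard Gaussian vector.
  have hmap : P.map (fun w k => Z k w)
      = (stdGaussianPi (Bond Λ ⊕ Bond Λ)).map fun g k => μ (ν k) + Δ (ν k) * g k := by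
    rw [(iIndepFun_iff_map_fun_eq_pi_map hae).1 hindep]
    have hs (k : Bond Λ ⊕ Bond Λ) :
        SigmaFinite ((gaussianReal 0 1).map fun x => μ (ν k) + Δ (ν k) * x) := by
      rw [map_gaussianReal_affine]; infer_instance
    rw [Measure.pi_map_pi (f := fun k x => μ (ν k) + Δ (ν k) * x) fun k => by fun_prop]
    congr 1
    funext k
    rw [(hlaw k).map_eq, map_gaussianReal_affine]
  have e₁ (w : Ω) : (Sum.elim (fun X => J X.1 w) fun X => Jt X.1 w) = fun k => Z k w := by
    funext k; rcases k with X | X <;> rfl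
  have e₂ (g : Bond Λ ⊕ Bond Λ → ℝ) : (Sum.elim (fun X => μ X.1 + Δ X.1 * g (.inl X))
      fun X => μ X.1 + Δ X.1 * g (.inr X)) = fun k => μ (ν k) + Δ (ν k) * g k := by
    funext k; rcases k with X | X <;> rfl
  have haff : Measurable fun (g : Bond Λ ⊕ Bond Λ → ℝ) k => μ (ν k) + Δ (ν k) * g k :=
    measurable_pi_lambda _ fun k => ((measurable_pi_apply k).const_mul _).const_add _
  simp only [e₁, e₂]
  rw [← integral_map (φ := fun w k => Z k w) (aemeasurable_pi_lambda _ hae)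
    hΨ.aestronglyMeasurable, hmap, integral_map haff.aemeasurable hΨ.aestronglyMeasurable]

lemma continuous_randomState {n : ℕ} {Y : Type*} [TopologicalSpace Y]
    {E : Fin n → Y → SpinConfig Λ → ℝ} (hE : ∀ k σ, Continuous fun y => E k y σ)
    (f : (Fin n → SpinConfig Λ) → ℝ) :
    Continuous fun y => randomState β (fun k => E k y) f := by
  unfold randomState boltzmann
  refine continuous_finsetSum _ fun σ _ => continuous_const.mul
    (continuous_finsetProd _ fun k _ => Continuous.div ?_ ?_ fun y => ?_)
  · exact Real.continuous_exp.comp ((hE k _).const_mul _)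
  · exact continuous_finsetSum _ fun τ _ => Real.continuous_exp.comp ((hE k τ).const_mul _)
  · exact (partition_pos β (E k y)).ne'

/-- All replicas share one standardized disorder and differ only in their angles. -/
lemma quenched_eq_integral (hJ : IsGaussianDisorder P μ Δ J Jt)
    {H : ℝ → Ω → SpinConfig Λ → ℝ} (hH : ∀ t w, H t w = couplingHam m μ Λ Λ' t
      (Sum.elim (fun X => J X.1 w) fun X => Jt X.1 w)) {n : ℕ} (t : Fin n → ℝ)
    (f : (Fin n → SpinConfig Λ) → ℝ) :
    quenched P β H t f = ∫ g, randomState β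
      (fun k => (spinModel m hβ μ Δ Λ Λ').energy (t k) g) f ∂stdGaussianPi (Bond Λ ⊕ Bond Λ) := by
  unfold quenched
  simp only [hH]
  rw [integral_couplings hJ (Ψ := fun j => randomState β
    (fun k => couplingHam m μ Λ Λ' (t k) j) f)
    (continuous_randomState (E := fun k j => couplingHam m μ Λ Λ' (t k) j)
      (fun k σ => continuous_couplingHam (t k) σ) f)]
  simp only [couplingHam_eq_energy hβ]

lemma C_spinModel (h : Λ' ⊆ Λ) (σ τ : SpinConfig Λ) :
    (spinModel m hβ μ Δ Λ Λ').C σ τ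
      = ∑ X ∈ Λ'.powerset, Δ X ^ 2 * spinProd X σ * spinProd X τ := by
  rw [← sum_bond_subset h fun X => Δ X ^ 2 * spinProd X σ * spinProd X τ]
  exact Finset.sum_congr rfl fun X _ => by simp only [spinModel]; ring

lemma cov_eq (h : Λ' ⊆ Λ) (σ τ : SpinConfig Λ) :
    cov Δ Λ' σ τ = (Λ'.card : ℝ)⁻¹ * (spinModel m hβ μ Δ Λ Λ').C σ τ := by
  rw [C_spinModel hβ h, cov, div_eq_inv_mul]

lemma magn_eq (σ : SpinConfig Λ) :
    magn μ Λ' σ = (Λ'.card : ℝ)⁻¹ * (spinModel m hβ μ Δ Λ Λ').bulk σ := by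
  rw [magn, div_eq_inv_mul]; rfl

lemma magn_mul_cov_eq (h : Λ' ⊆ Λ) (σ τ ρ : SpinConfig Λ) :
    magn μ Λ' σ * cov Δ Λ' τ ρ = (Λ'.card : ℝ)⁻¹ ^ 2 *
      ((spinModel m hβ μ Δ Λ Λ').bulk σ * (spinModel m hβ μ Δ Λ Λ').C τ ρ) := by
  rw [magn_eq (m := m) (Δ := Δ) hβ, cov_eq (m := m) (μ := μ) hβ h]
  ring

/-! ### Quenched states of the spin system -/

section Quenched

variable {H : ℝ → Ω → SpinConfig Λ → ℝ}

lemma quenched_cov_sq (hJ : IsGaussianDisorder P μ Δ J Jt)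
    (hH : ∀ t w, H t w = couplingHam m μ Λ Λ' t (Sum.elim (fun X => J X.1 w) fun X => Jt X.1 w))
    (h : Λ' ⊆ Λ) (t s : ℝ) :
    quenched P β H ![t, s] (fun σ => cov Δ Λ' (σ 0) (σ 1) ^ 2)
      = ((Λ'.card : ℝ)⁻¹) ^ 2 * ∫ g, (spinModel m hβ μ Δ Λ Λ').cov₂ t s g
        ∂stdGaussianPi (Bond Λ ⊕ Bond Λ) := by
  rw [quenched_eq_integral hβ hJ hH, ← integral_const_mul]
  refine integral_congr_ae (ae_of_all _ fun g => ?_)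
  simp only
  rw [randomState_two (fun t => (spinModel m hβ μ Δ Λ Λ').energy t g) t s
    fun x y => cov Δ Λ' x y ^ 2]
  simp only [cov_eq (m := m) (μ := μ) hβ h, mul_pow, gibbsAvg_const_mul]
  rfl

/-- Given the middle replica, the two outer ones are independent with the same angle, which produces
a square. -/
lemma cov₃_eq {κ S : Type*} [DecidableEq κ] [Fintype κ] [Fintype S] (M : FlipModel κ S)
    (t s : ℝ) (g : κ ⊕ κ → ℝ) :
    (M.av t g fun x => M.av s g fun y => M.av t g fun z => M.C x y * M.C y z) = M.cov₃ t s g := by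
  have hsymm (τ : S) : (fun σ => M.C σ τ) = M.C τ := funext fun σ => M.C_comm σ τ
  simp only [FlipModel.av, gibbsAvg_const_mul]
  rw [gibbsAvg_comm]
  simp only [gibbsAvg_mul_const, hsymm, ← pow_two]
  rfl

lemma quenched_cov_mul_cov (hJ : IsGaussianDisorder P μ Δ J Jt)
    (hH : ∀ t w, H t w = couplingHam m μ Λ Λ' t (Sum.elim (fun X => J X.1 w) fun X => Jt X.1 w))
    (h : Λ' ⊆ Λ) (t s : ℝ) :
    quenched P β H ![t, s, t] (fun σ => cov Δ Λ' (σ 0) (σ 1) * cov Δ Λ' (σ 1) (σ 2))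
      = ((Λ'.card : ℝ)⁻¹) ^ 2 * ∫ g, (spinModel m hβ μ Δ Λ Λ').cov₃ t s g
        ∂stdGaussianPi (Bond Λ ⊕ Bond Λ) := by
  rw [quenched_eq_integral hβ hJ hH, ← integral_const_mul]
  refine integral_congr_ae (ae_of_all _ fun g => ?_)
  simp only
  rw [randomState_three (fun t => (spinModel m hβ μ Δ Λ Λ').energy t g) t s t
    fun x y z => cov Δ Λ' x y * cov Δ Λ' y z, ← cov₃_eq]
  simp only [cov_eq (m := m) (μ := μ) hβ h, mul_mul_mul_comm, ← pow_two,
    gibbsAvg_const_mul ((Λ'.card : ℝ)⁻¹ ^ 2)]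
  rfl

lemma cov₁_sq_eq {κ S : Type*} [DecidableEq κ] [Fintype κ] [Fintype S] (M : FlipModel κ S)
    (t s : ℝ) (g : κ ⊕ κ → ℝ) :
    (M.av t g fun x => M.av s g fun y => M.av s g fun z => M.av t g fun u =>
      M.C x y * M.C z u) = M.cov₁ t s g ^ 2 := by
  have hsymm (τ : S) : (fun σ => M.C σ τ) = M.C τ := funext fun σ => M.C_comm σ τ
  have h : gibbsAvg M.β (M.energy s g) (fun z => gibbsAvg M.β (M.energy t g) (M.C z))
      = M.cov₁ t s g := by
    rw [gibbsAvg_comm]; simp only [hsymm]; rfl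
  simp only [FlipModel.av, gibbsAvg_const_mul, gibbsAvg_mul_const, h, pow_two]
  rfl

lemma quenched_cov_mul_cov_disjoint (hJ : IsGaussianDisorder P μ Δ J Jt)
    (hH : ∀ t w, H t w = couplingHam m μ Λ Λ' t (Sum.elim (fun X => J X.1 w) fun X => Jt X.1 w))
    (h : Λ' ⊆ Λ) (t s : ℝ) :
    quenched P β H ![t, s, s, t] (fun σ => cov Δ Λ' (σ 0) (σ 1) * cov Δ Λ' (σ 2) (σ 3))
      = ((Λ'.card : ℝ)⁻¹) ^ 2 * ∫ g, (spinModel m hβ μ Δ Λ Λ').cov₁ t s g ^ 2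
        ∂stdGaussianPi (Bond Λ ⊕ Bond Λ) := by
  rw [quenched_eq_integral hβ hJ hH, ← integral_const_mul]
  refine integral_congr_ae (ae_of_all _ fun g => ?_)
  simp only
  rw [randomState_four (fun t => (spinModel m hβ μ Δ Λ Λ').energy t g) t s s t
    fun x y z u => cov Δ Λ' x y * cov Δ Λ' z u, ← cov₁_sq_eq]
  simp only [cov_eq (m := m) (μ := μ) hβ h, mul_mul_mul_comm, ← pow_two,
    gibbsAvg_const_mul ((Λ'.card : ℝ)⁻¹ ^ 2)]
  rfl

lemma quenched_magn (hJ : IsGaussianDisorder P μ Δ J Jt)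
    (hH : ∀ t w, H t w = couplingHam m μ Λ Λ' t (Sum.elim (fun X => J X.1 w) fun X => Jt X.1 w))
    (t : ℝ) :
    quenched P β H ![t] (fun σ => magn μ Λ' (σ 0))
      = (Λ'.card : ℝ)⁻¹ * ∫ g, (spinModel m hβ μ Δ Λ Λ').av t g (spinModel m hβ μ Δ Λ Λ').bulk
        ∂stdGaussianPi (Bond Λ ⊕ Bond Λ) := by
  rw [quenched_eq_integral hβ hJ hH, ← integral_const_mul]
  refine integral_congr_ae (ae_of_all _ fun g => ?_)
  simp only
  rw [randomState_one (fun t => (spinModel m hβ μ Δ Λ Λ').energy t g) t fun x => magn μ Λ' x]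
  simp only [magn_eq (m := m) (Δ := Δ) hβ, gibbsAvg_const_mul]
  rfl

lemma quenched_magn_mul_magn (hJ : IsGaussianDisorder P μ Δ J Jt)
    (hH : ∀ t w, H t w = couplingHam m μ Λ Λ' t (Sum.elim (fun X => J X.1 w) fun X => Jt X.1 w))
    (t s : ℝ) :
    quenched P β H ![t, s] (fun σ => magn μ Λ' (σ 0) * magn μ Λ' (σ 1))
      = ((Λ'.card : ℝ)⁻¹) ^ 2 * ∫ g,
        (spinModel m hβ μ Δ Λ Λ').av t g (spinModel m hβ μ Δ Λ Λ').bulk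
          * (spinModel m hβ μ Δ Λ Λ').av s g (spinModel m hβ μ Δ Λ Λ').bulk
        ∂stdGaussianPi (Bond Λ ⊕ Bond Λ) := by
  rw [quenched_eq_integral hβ hJ hH, ← integral_const_mul]
  refine integral_congr_ae (ae_of_all _ fun g => ?_)
  simp only
  rw [randomState_two (fun t => (spinModel m hβ μ Δ Λ Λ').energy t g) t s
    fun x y => magn μ Λ' x * magn μ Λ' y]
  simp only [magn_eq (m := m) (Δ := Δ) hβ, mul_mul_mul_comm, ← pow_two, gibbsAvg_const_mul,
    gibbsAvg_mul_const]
  rfl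

lemma mixed_eq {κ S : Type*} [DecidableEq κ] [Fintype κ] [Fintype S]
    (M : FlipModel κ S) (t s : ℝ) (g : κ ⊕ κ → ℝ) :
    (M.av t g fun x => M.av s g fun y => M.bulk x * M.C x y)
      - (M.av t g fun x => M.av s g fun y => M.av t g fun z => M.bulk x * M.C y z)
      = M.mixed t s g := by
  have h : gibbsAvg M.β (M.energy t g) (fun x => gibbsAvg M.β (M.energy s g)
      fun y => M.bulk x * M.C x y) = gibbsAvg M.β (M.energy s g) fun y =>
        gibbsAvg M.β (M.energy t g) fun x => M.bulk x * M.C y x := by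
    rw [gibbsAvg_comm]
    simp only [M.C_comm]
  simp only [FlipModel.mixed, FlipModel.av, gibbsAvg_sub]
  rw [h]
  simp only [gibbsAvg_const_mul, gibbsAvg_mul_const]

lemma quenched_magn_mul_cov_sub (hJ : IsGaussianDisorder P μ Δ J Jt)
    (hH : ∀ t w, H t w = couplingHam m μ Λ Λ' t (Sum.elim (fun X => J X.1 w) fun X => Jt X.1 w))
    (h : Λ' ⊆ Λ) (t s : ℝ) :
    quenched P β H ![t, s] (fun σ => magn μ Λ' (σ 0) * cov Δ Λ' (σ 0) (σ 1))
      - quenched P β H ![t, s, t] (fun σ => magn μ Λ' (σ 0) * cov Δ Λ' (σ 1) (σ 2))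
      = ((Λ'.card : ℝ)⁻¹) ^ 2 * ∫ g, (spinModel m hβ μ Δ Λ Λ').mixed t s g
        ∂stdGaussianPi (Bond Λ ⊕ Bond Λ) := by
  set M := spinModel m hβ μ Δ Λ Λ' with hM
  have e₁ : quenched P β H ![t, s] (fun σ => magn μ Λ' (σ 0) * cov Δ Λ' (σ 0) (σ 1))
      = ((Λ'.card : ℝ)⁻¹) ^ 2 * ∫ g, M.av t g (fun x => M.av s g fun y => M.bulk x * M.C x y)
        ∂stdGaussianPi (Bond Λ ⊕ Bond Λ) := by
    rw [quenched_eq_integral hβ hJ hH, ← integral_const_mul]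
    refine integral_congr_ae (ae_of_all _ fun g => ?_)
    simp only
    rw [randomState_two (fun t => (spinModel m hβ μ Δ Λ Λ').energy t g) t s
      fun x y => magn μ Λ' x * cov Δ Λ' x y]
    simp only [magn_mul_cov_eq (m := m) hβ h, gibbsAvg_const_mul ((Λ'.card : ℝ)⁻¹ ^ 2)]
    rfl
  have e₂ : quenched P β H ![t, s, t] (fun σ => magn μ Λ' (σ 0) * cov Δ Λ' (σ 1) (σ 2))
      = ((Λ'.card : ℝ)⁻¹) ^ 2 * ∫ g, M.av t g (fun x => M.av s g fun y =>
        M.av t g fun z => M.bulk x * M.C y z) ∂stdGaussianPi (Bond Λ ⊕ Bond Λ) := by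
    rw [quenched_eq_integral hβ hJ hH, ← integral_const_mul]
    refine integral_congr_ae (ae_of_all _ fun g => ?_)
    simp only
    rw [randomState_three (fun t => (spinModel m hβ μ Δ Λ Λ').energy t g) t s t
      fun x y z => magn μ Λ' x * cov Δ Λ' y z]
    simp only [magn_mul_cov_eq (m := m) hβ h, gibbsAvg_const_mul ((Λ'.card : ℝ)⁻¹ ^ 2)]
    rfl
  have g₁ : PolyGrowth fun (_ : Unit) g =>
      M.av t g fun x => M.av s g fun y => M.bulk x * M.C x y :=
    M.polyGrowth_av continuous_const fun x => M.polyGrowth_av_const continuous_const _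
  have g₂ : PolyGrowth fun (_ : Unit) g =>
      M.av t g fun x => M.av s g fun y => M.av t g fun z => M.bulk x * M.C y z :=
    M.polyGrowth_av continuous_const fun x => M.polyGrowth_av continuous_const fun y =>
      M.polyGrowth_av_const continuous_const _
  rw [e₁, e₂, ← mul_sub, ← integral_sub (g₁.integrable ()) (g₂.integrable ())]
  simp only [mixed_eq]

end Quenched

end Model

end

end FlipSpinGlass

namespace FlipSpinGlass

noncomputable section

/-! ### Bounds in finite volume -/

section Bounds

variable {d : ℕ} {m : Modulation} {β : ℝ} (hβ : 0 < β) {μ Δ : Finset (Site d) → ℝ}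
  {Λ Λ' : Finset (Site d)}

lemma sum_le_of_div_card_le {f : Finset (Site d) → ℝ} {c : ℝ} (hΛ : Λ.Nonempty)
    (h : (∑ X ∈ Λ.powerset, f X) / (Λ.card : ℝ) ≤ c) :
    ∑ X ∈ Λ.powerset, f X ≤ c * Λ.card :=
  (div_le_iff₀ (Nat.cast_pos.2 hΛ.card_pos)).1 h

lemma abs_coeff_spinModel_le (X : Bond Λ) (σ : SpinConfig Λ) :
    |(spinModel m hβ μ Δ Λ Λ').coeff X σ| ≤ |Δ X.1| := by
  simp only [spinModel, abs_neg, abs_mul]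
  exact mul_le_of_le_one_right (abs_nonneg _) (abs_spinProd_le_one X.1 σ)

lemma abs_C_spinModel_le (h : Λ' ⊆ Λ) (σ τ : SpinConfig Λ) :
    |(spinModel m hβ μ Δ Λ Λ').C σ τ| ≤ ∑ X ∈ Λ'.powerset, Δ X ^ 2 := by
  rw [C_spinModel hβ h]
  refine (Finset.abs_sum_le_sum_abs _ _).trans (Finset.sum_le_sum fun X _ => ?_)
  rw [abs_mul, abs_mul, abs_of_nonneg (sq_nonneg (Δ X)), mul_assoc]
  exact mul_le_of_le_one_right (sq_nonneg _)
    (mul_le_one₀ (abs_spinProd_le_one X σ) (abs_nonneg _) (abs_spinProd_le_one X τ))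

lemma abs_bulk_spinModel_le (σ : SpinConfig Λ) :
    |(spinModel m hβ μ Δ Λ Λ').bulk σ| ≤ ∑ X ∈ Λ'.powerset, |μ X| := by
  simp only [spinModel, hamIn, abs_neg]
  refine (Finset.abs_sum_le_sum_abs _ _).trans (Finset.sum_le_sum fun X _ => ?_)
  rw [abs_mul]
  exact mul_le_of_le_one_right (abs_nonneg _) (abs_spinProd_le_one X σ)

lemma sum_region_spinModel (h : Λ' ⊆ Λ) :
    ∑ X ∈ (spinModel m hβ μ Δ Λ Λ').region, |Δ X.1| ^ 2 = ∑ X ∈ Λ'.powerset, Δ X ^ 2 := by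
  simp only [sq_abs]
  exact sum_bond_subset h fun X => Δ X ^ 2

lemma cos_sub_sin_nonneg {t : ℝ} (ht : t ∈ Set.Icc 0 (Real.pi / 4)) :
    0 ≤ Real.cos t - Real.sin t := by
  have hpi := Real.pi_pos
  have h1 := Real.sin_le_sin_of_le_of_le_pi_div_two (by linarith [ht.1]) (by linarith) ht.2
  have h2 := Real.cos_le_cos_of_nonneg_of_le_pi ht.1 (by linarith) ht.2
  rw [Real.sin_pi_div_four] at h1
  rw [Real.cos_pi_div_four] at h2
  linarith

lemma cos_sub_sin_nonpos {t : ℝ} (ht : t ∈ Set.Icc (Real.pi / 4) Real.pi) :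
    Real.cos t - Real.sin t ≤ 0 := by
  have hpi := Real.pi_pos
  rcases le_total t (Real.pi / 2) with h | h
  · have h1 := Real.sin_le_sin_of_le_of_le_pi_div_two (by linarith) h ht.1
    have h2 := Real.cos_le_cos_of_nonneg_of_le_pi (by linarith) ht.2 ht.1
    rw [Real.sin_pi_div_four] at h1
    rw [Real.cos_pi_div_four] at h2
    linarith
  · have h1 := Real.sin_nonneg_of_nonneg_of_le_pi (by linarith) ht.2
    have h2 := Real.cos_nonpos_of_pi_div_two_le_of_le h (by linarith [ht.2])
    linarith

variable {Ω : Type*} [MeasurableSpace Ω] {P : Measure Ω} [IsProbabilityMeasure P]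
  {J Jt : Finset (Site d) → Ω → ℝ}

/-- The centred flip identity in finite volume. -/
lemma abs_centered_flip_le (hβ : 0 < β) (hJ : IsGaussianDisorder P μ Δ J Jt) (h : Λ' ⊆ Λ)
    (hΛ' : Λ'.Nonempty) {c : ℝ}
    (hc : ∀ Λ : Finset (Site d), Λ.Nonempty → (∑ X ∈ Λ.powerset, Δ X ^ 2) / (Λ.card : ℝ) ≤ c) :
    |∫ t in (0 : ℝ)..Real.pi, ∫ s in (0 : ℝ)..Real.pi, k₂ t s *
        (quenched P β (centeredFlipHam μ J Jt Λ Λ') ![t, s]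
              (fun σ => cov Δ Λ' (σ 0) (σ 1) ^ 2)
          - 2 * quenched P β (centeredFlipHam μ J Jt Λ Λ') ![t, s, t]
              (fun σ => cov Δ Λ' (σ 0) (σ 1) * cov Δ Λ' (σ 1) (σ 2))
          + quenched P β (centeredFlipHam μ J Jt Λ Λ') ![t, s, s, t]
              (fun σ => cov Δ Λ' (σ 0) (σ 1) * cov Δ Λ' (σ 2) (σ 3)))|
      ≤ (4 * c + Real.pi ^ 2 * c) / β ^ 2 * (Λ'.card : ℝ)⁻¹ := by
  set M := spinModel Modulation.one hβ μ Δ Λ Λ' with hM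
  have hN : (0 : ℝ) < Λ'.card := Nat.cast_pos.2 hΛ'.card_pos
  have hH (t : ℝ) (w : Ω) := centeredFlipHam_eq_couplingHam (μ := μ) (J := J) (Jt := Jt) h t w
  have e : (∫ t in (0 : ℝ)..Real.pi, ∫ s in (0 : ℝ)..Real.pi, k₂ t s *
        (quenched P β (centeredFlipHam μ J Jt Λ Λ') ![t, s]
              (fun σ => cov Δ Λ' (σ 0) (σ 1) ^ 2)
          - 2 * quenched P β (centeredFlipHam μ J Jt Λ Λ') ![t, s, t]
              (fun σ => cov Δ Λ' (σ 0) (σ 1) * cov Δ Λ' (σ 1) (σ 2))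
          + quenched P β (centeredFlipHam μ J Jt Λ Λ') ![t, s, s, t]
              (fun σ => cov Δ Λ' (σ 0) (σ 1) * cov Δ Λ' (σ 2) (σ 3))))
      = (Λ'.card : ℝ)⁻¹ ^ 2 * M.overlapIntegral := by
    rw [FlipModel.overlapIntegral, ← angleIntegral_const_mul]
    unfold angleIntegral
    refine intervalIntegral.integral_congr fun t _ =>
      intervalIntegral.integral_congr fun s _ => ?_
    simp only
    rw [quenched_cov_sq hβ hJ hH h, quenched_cov_mul_cov hβ hJ hH h,
      quenched_cov_mul_cov_disjoint hβ hJ hH h, k₂]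
    ring
  have hC (σ τ : SpinConfig Λ) :=
    abs_C_spinModel_le (m := Modulation.one) (μ := μ) (Δ := Δ) hβ h σ τ
  -- The modulation is constant, so its endpoint values agree and its derivative vanishes
  -- definitionally.
  have key := M.abs_overlapIntegral_le rfl (fun _ => rfl)
    (fun X σ => abs_coeff_spinModel_le hβ X σ) hC
  have hb := sum_le_of_div_card_le hΛ' (hc Λ' hΛ')
  rw [hM, sum_region_spinModel hβ h, ← hM] at key
  rw [e, abs_mul, abs_of_pos (by positivity)]
  have hβ2 : 0 < β ^ 2 := by positivity
  have hpi : 0 ≤ Real.pi ^ 2 := by positivity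
  have key' : β ^ 2 * |M.overlapIntegral| ≤ (4 * c + Real.pi ^ 2 * c) * Λ'.card := by
    refine key.trans ?_
    have := mul_le_mul_of_nonneg_left hb hpi
    linarith
  have h2 : |M.overlapIntegral| ≤ (4 * c + Real.pi ^ 2 * c) * Λ'.card / β ^ 2 := by
    rw [le_div_iff₀ hβ2]; linarith
  calc _ ≤ (Λ'.card : ℝ)⁻¹ ^ 2 * ((4 * c + Real.pi ^ 2 * c) * Λ'.card / β ^ 2) :=
        mul_le_mul_of_nonneg_left h2 (by positivity)
    _ = _ := by field_simp

/-- The full flip identity in finite volume. -/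
lemma abs_full_flip_le (hβ : 0 < β) (hJ : IsGaussianDisorder P μ Δ J Jt) (h : Λ' ⊆ Λ)
    (hΛ' : Λ'.Nonempty) {c : ℝ}
    (hμ : ∀ Λ : Finset (Site d), Λ.Nonempty → (∑ X ∈ Λ.powerset, |μ X|) / (Λ.card : ℝ) ≤ c)
    (hΔ : ∀ Λ : Finset (Site d), Λ.Nonempty → (∑ X ∈ Λ.powerset, Δ X ^ 2) / (Λ.card : ℝ) ≤ c) :
    |β ^ 2 * (∫ t in (0 : ℝ)..Real.pi, ∫ s in (0 : ℝ)..Real.pi, h₁ t s *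
          (quenched P β (flipHam J Jt Λ Λ') ![t, s]
              (fun σ => magn μ Λ' (σ 0) * magn μ Λ' (σ 1))
            - quenched P β (flipHam J Jt Λ Λ') ![t]
              (fun σ => magn μ Λ' (σ 0)) * quenched P β (flipHam J Jt Λ Λ') ![s]
              (fun σ => magn μ Λ' (σ 0))))
        + 2 * β ^ 3 * (∫ t in (0 : ℝ)..Real.pi, ∫ s in (0 : ℝ)..Real.pi, h₂ t s *
          (quenched P β (flipHam J Jt Λ Λ') ![t, s]
              (fun σ => magn μ Λ' (σ 0) * cov Δ Λ' (σ 0) (σ 1))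
            - quenched P β (flipHam J Jt Λ Λ') ![t, s, t]
              (fun σ => magn μ Λ' (σ 0) * cov Δ Λ' (σ 1) (σ 2))))
        - β ^ 4 * (∫ t in (0 : ℝ)..Real.pi, ∫ s in (0 : ℝ)..Real.pi, k₂ t s *
          (quenched P β (flipHam J Jt Λ Λ') ![t, s]
              (fun σ => cov Δ Λ' (σ 0) (σ 1) ^ 2)
            - 2 * quenched P β (flipHam J Jt Λ Λ') ![s, t, s]
              (fun σ => cov Δ Λ' (σ 0) (σ 1) * cov Δ Λ' (σ 1) (σ 2))
            + quenched P β (flipHam J Jt Λ Λ') ![t, s, s, t]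
              (fun σ => cov Δ Λ' (σ 0) (σ 1) * cov Δ Λ' (σ 2) (σ 3))))|
      ≤ 4 * β ^ 2 * c * (((Λ'.card : ℝ) / Λ.card)⁻¹ * (Λ'.card : ℝ)⁻¹)
        + β ^ 2 * Real.pi ^ 2 * c * (Λ'.card : ℝ)⁻¹
        + 4 * β ^ 3 * Real.pi * c * (Real.pi + 2 * c / β) * (√(Λ'.card : ℝ))⁻¹ := by
  set M := spinModel Modulation.cosAddSin hβ μ Δ Λ Λ' with hM
  set N : ℝ := (Λ'.card : ℝ) with hNdef
  have hN : 0 < N := Nat.cast_pos.2 hΛ'.card_pos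
  have hΛ : Λ.Nonempty := hΛ'.mono h
  have hN₂ : (0 : ℝ) < Λ.card := Nat.cast_pos.2 hΛ.card_pos
  have hH (t : ℝ) (w : Ω) := flipHam_eq_couplingHam (μ := μ) (J := J) (Jt := Jt) h t w
  have e₁ : (∫ t in (0 : ℝ)..Real.pi, ∫ s in (0 : ℝ)..Real.pi, h₁ t s *
          (quenched P β (flipHam J Jt Λ Λ') ![t, s]
              (fun σ => magn μ Λ' (σ 0) * magn μ Λ' (σ 1))
            - quenched P β (flipHam J Jt Λ Λ') ![t]
              (fun σ => magn μ Λ' (σ 0)) * quenched P β (flipHam J Jt Λ Λ') ![s]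
              (fun σ => magn μ Λ' (σ 0))))
      = N⁻¹ ^ 2 * angleIntegral fun t s => M.θ' t * M.θ' s *
          ((∫ g, M.av t g M.bulk * M.av s g M.bulk ∂stdGaussianPi (Bond Λ ⊕ Bond Λ))
            - (∫ g, M.av t g M.bulk ∂stdGaussianPi (Bond Λ ⊕ Bond Λ))
              * ∫ g, M.av s g M.bulk ∂stdGaussianPi (Bond Λ ⊕ Bond Λ)) := by
    rw [← angleIntegral_const_mul]
    refine intervalIntegral.integral_congr fun t _ =>
      intervalIntegral.integral_congr fun s _ => ?_
    simp only
    rw [quenched_magn_mul_magn hβ hJ hH, quenched_magn hβ hJ hH, quenched_magn hβ hJ hH, h₁]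
    have hθ (r : ℝ) : M.θ' r = Real.cos r - Real.sin r := rfl
    rw [hθ, hθ]
    ring
  have e₂ : (∫ t in (0 : ℝ)..Real.pi, ∫ s in (0 : ℝ)..Real.pi, h₂ t s *
          (quenched P β (flipHam J Jt Λ Λ') ![t, s]
              (fun σ => magn μ Λ' (σ 0) * cov Δ Λ' (σ 0) (σ 1))
            - quenched P β (flipHam J Jt Λ Λ') ![t, s, t]
              (fun σ => magn μ Λ' (σ 0) * cov Δ Λ' (σ 1) (σ 2))))
      = N⁻¹ ^ 2 * angleIntegral fun t s => Real.sin (t - s) * M.θ' t *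
          ∫ g, M.mixed t s g ∂stdGaussianPi (Bond Λ ⊕ Bond Λ) := by
    rw [← angleIntegral_const_mul]
    refine intervalIntegral.integral_congr fun t _ =>
      intervalIntegral.integral_congr fun s _ => ?_
    simp only
    rw [quenched_magn_mul_cov_sub hβ hJ hH h, h₂]
    have hθ (r : ℝ) : M.θ' r = Real.cos r - Real.sin r := rfl
    rw [hθ]
    ring
  have e₃ : (∫ t in (0 : ℝ)..Real.pi, ∫ s in (0 : ℝ)..Real.pi, k₂ t s *
          (quenched P β (flipHam J Jt Λ Λ') ![t, s]
              (fun σ => cov Δ Λ' (σ 0) (σ 1) ^ 2)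
            - 2 * quenched P β (flipHam J Jt Λ Λ') ![s, t, s]
              (fun σ => cov Δ Λ' (σ 0) (σ 1) * cov Δ Λ' (σ 1) (σ 2))
            + quenched P β (flipHam J Jt Λ Λ') ![t, s, s, t]
              (fun σ => cov Δ Λ' (σ 0) (σ 1) * cov Δ Λ' (σ 2) (σ 3))))
      = N⁻¹ ^ 2 * M.overlapIntegral := by
    rw [FlipModel.overlapIntegral_eq_swap, ← angleIntegral_const_mul]
    refine intervalIntegral.integral_congr fun t _ =>
      intervalIntegral.integral_congr fun s _ => ?_
    simp only
    rw [quenched_cov_sq hβ hJ hH h, quenched_cov_mul_cov hβ hJ hH h,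
      quenched_cov_mul_cov_disjoint hβ hJ hH h, k₂]
    ring
  have hb := sum_le_of_div_card_le hΛ' (hΔ Λ' hΛ')
  have hb₂ := sum_le_of_div_card_le hΛ (hΔ Λ hΛ)
  have hb₃ := sum_le_of_div_card_le hΛ' (hμ Λ' hΛ')
  have hc : 0 ≤ c := le_trans
    (div_nonneg (Finset.sum_nonneg fun _ _ => sq_nonneg _) (Nat.cast_nonneg _)) (hΔ Λ' hΛ')
  have hpi := Real.pi_pos
  have hsqrt : 0 < √N := Real.sqrt_pos.2 hN
  have hss : √N * √N = N := Real.mul_self_sqrt hN.le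
  -- The choice `δ = √N` balances `N δ` against `N² / δ`: both are of order `N^(3/2)`, hence
  -- `N^(-1/2)` after normalization. The angle `π / 4` is where `cos - sin` changes sign.
  have key := M.abs_flip_identity_le (A := fun X => |Δ X.1|)
    (fun X σ => abs_coeff_spinModel_le hβ X σ) (N := c * N) (N' := c * N) hsqrt
    (fun σ => (abs_bulk_spinModel_le hβ σ).trans hb₃)
    (fun σ τ => (abs_C_spinModel_le hβ h σ τ).trans hb)
    (c := Real.pi / 4) (by positivity) (by linarith)
    (fun t ht => cos_sub_sin_nonneg ht) (fun t ht => cos_sub_sin_nonpos ht)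
  have hsum : ∑ X : Bond Λ, |Δ X.1| ^ 2 ≤ c * Λ.card := by
    simp only [sq_abs]
    rw [Finset.sum_coe_sort Λ.powerset fun X => Δ X ^ 2]
    exact hb₂
  rw [e₁, e₂, e₃]
  have hMβ : M.β = β := rfl
  rw [hMβ] at key
  have efac (a b c' : ℝ) : β ^ 2 * (N⁻¹ ^ 2 * a) + 2 * β ^ 3 * (N⁻¹ ^ 2 * b)
      - β ^ 4 * (N⁻¹ ^ 2 * c') = N⁻¹ ^ 2 * (β ^ 2 * a + 2 * β ^ 3 * b - β ^ 4 * c') := by ring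
  rw [efac, abs_mul, abs_of_pos (by positivity : 0 < N⁻¹ ^ 2)]
  have key₂ := key.trans (add_le_add_left (add_le_add_left (mul_le_mul_of_nonneg_left
    (mul_le_mul_of_nonneg_left hsum (by norm_num : (0 : ℝ) ≤ 4)) (by positivity : 0 ≤ β ^ 2)) _) _)
  refine (mul_le_mul_of_nonneg_left key₂ (by positivity : 0 ≤ N⁻¹ ^ 2)).trans_eq ?_
  have hβ' := hβ.ne'
  have t₁ : N⁻¹ ^ 2 * (β ^ 2 * (4 * (c * Λ.card))) = 4 * β ^ 2 * c * ((N / Λ.card)⁻¹ * N⁻¹) := by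
    field_simp
  have t₂ : N⁻¹ ^ 2 * (β ^ 2 * (Real.pi ^ 2 * (c * N))) = β ^ 2 * Real.pi ^ 2 * c * N⁻¹ := by
    field_simp
  have t₄ : 2 * (c * N) / (√N * β) = 2 * c / β * √N := by
    rw [div_eq_iff (by positivity)]
    calc 2 * (c * N) = 2 * c * (√N * √N) * (β⁻¹ * β) := by rw [hss, inv_mul_cancel₀ hβ']; ring
      _ = _ := by ring
  have t₅ : N⁻¹ * √N = (√N)⁻¹ := by
    calc N⁻¹ * √N = (√N * √N)⁻¹ * √N := by rw [hss]
      _ = (√N)⁻¹ := by rw [mul_inv, mul_assoc, inv_mul_cancel₀ hsqrt.ne', mul_one]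
  have t₃ : N⁻¹ ^ 2 * (4 * β ^ 3 * (Real.pi * (c * N * (Real.pi * √N + 2 * (c * N) / (√N * β)))))
      = 4 * β ^ 3 * Real.pi * c * (Real.pi + 2 * c / β) * (√N)⁻¹ := by
    rw [t₄, ← t₅]
    field_simp
  rw [mul_add, mul_add, t₁, t₂, t₃]

end Bounds

end

end FlipSpinGlass

/-! ### The thermodynamic limit. -/

open FlipSpinGlass in
theorem theorem1 {d : ℕ} (hd : 0 < d) {Ω : Type*} [MeasurableSpace Ω] (P : Measure Ω)
    [IsProbabilityMeasure P] (μ Δ : Finset (Site d) → ℝ) (J Jt : Finset (Site d) → Ω → ℝ)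
    (hJ : IsGaussianDisorder P μ Δ J Jt) (hstab : ThermoStable μ Δ)
    (β : ℝ) (hβ : 0 < β)
    {ι : Type*} (l : Filter ι) (Λ Λ' : ι → Finset (Site d)) (hsub : ∀ i, Λ' i ⊆ Λ i)
    (hlim : Tendsto Λ' l atTop) :
    Tendsto (fun i =>
      ∫ t in (0 : ℝ)..Real.pi, ∫ s in (0 : ℝ)..Real.pi, k₂ t s *
        (quenched P β (centeredFlipHam μ J Jt (Λ i) (Λ' i)) ![t, s]
              (fun σ => cov Δ (Λ' i) (σ 0) (σ 1) ^ 2)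
          - 2 * quenched P β (centeredFlipHam μ J Jt (Λ i) (Λ' i)) ![t, s, t]
              (fun σ => cov Δ (Λ' i) (σ 0) (σ 1) * cov Δ (Λ' i) (σ 1) (σ 2))
          + quenched P β (centeredFlipHam μ J Jt (Λ i) (Λ' i)) ![t, s, s, t]
              (fun σ => cov Δ (Λ' i) (σ 0) (σ 1) * cov Δ (Λ' i) (σ 2) (σ 3))))
      l (𝓝 0) ∧
    ∀ a : ℝ, 0 < a →
      Tendsto (fun i => ((Λ' i).card : ℝ) / ((Λ i).card : ℝ)) l (𝓝 a) →
      Tendsto (fun i =>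
        β ^ 2 * (∫ t in (0 : ℝ)..Real.pi, ∫ s in (0 : ℝ)..Real.pi, h₁ t s *
          (quenched P β (flipHam J Jt (Λ i) (Λ' i)) ![t, s]
              (fun σ => magn μ (Λ' i) (σ 0) * magn μ (Λ' i) (σ 1))
            - quenched P β (flipHam J Jt (Λ i) (Λ' i)) ![t]
              (fun σ => magn μ (Λ' i) (σ 0)) * quenched P β (flipHam J Jt (Λ i) (Λ' i)) ![s]
              (fun σ => magn μ (Λ' i) (σ 0))))
        + 2 * β ^ 3 * (∫ t in (0 : ℝ)..Real.pi, ∫ s in (0 : ℝ)..Real.pi, h₂ t s *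
          (quenched P β (flipHam J Jt (Λ i) (Λ' i)) ![t, s]
              (fun σ => magn μ (Λ' i) (σ 0) * cov Δ (Λ' i) (σ 0) (σ 1))
            - quenched P β (flipHam J Jt (Λ i) (Λ' i)) ![t, s, t]
              (fun σ => magn μ (Λ' i) (σ 0) * cov Δ (Λ' i) (σ 1) (σ 2))))
        - β ^ 4 * (∫ t in (0 : ℝ)..Real.pi, ∫ s in (0 : ℝ)..Real.pi, k₂ t s *
          (quenched P β (flipHam J Jt (Λ i) (Λ' i)) ![t, s]
              (fun σ => cov Δ (Λ' i) (σ 0) (σ 1) ^ 2)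
            - 2 * quenched P β (flipHam J Jt (Λ i) (Λ' i)) ![s, t, s]
              (fun σ => cov Δ (Λ' i) (σ 0) (σ 1) * cov Δ (Λ' i) (σ 1) (σ 2))
            + quenched P β (flipHam J Jt (Λ i) (Λ' i)) ![t, s, s, t]
              (fun σ => cov Δ (Λ' i) (σ 0) (σ 1) * cov Δ (Λ' i) (σ 2) (σ 3)))))
        l (𝓝 0) := by
  obtain ⟨c, hc⟩ := hstab
  -- Positive dimension makes the lattice infinite, so volumes that absorb every finite set have
  -- cardinality tending to infinity.
  have : Nonempty (Fin d) := ⟨⟨0, hd⟩⟩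
  have : Infinite (Site d) := Pi.infinite_of_right
  have hcard : Tendsto (fun i => ((Λ' i).card : ℝ)) l atTop := by
    refine tendsto_natCast_atTop_atTop.comp (tendsto_atTop.2 fun n => ?_)
    obtain ⟨A, hA⟩ := Infinite.exists_subset_card_eq (Site d) n
    filter_upwards [hlim.eventually_ge_atTop A] with i hi
    exact hA ▸ Finset.card_le_card hi
  have hne : ∀ᶠ i in l, (Λ' i).Nonempty := by
    filter_upwards [hcard.eventually_gt_atTop 0] with i hi
    exact Finset.card_pos.1 (Nat.cast_pos.1 hi)
  have hinv := tendsto_inv_atTop_zero.comp hcard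
  have hsqrt := tendsto_inv_atTop_zero.comp (Real.tendsto_sqrt_atTop.comp hcard)
  refine ⟨?_, fun a ha hratio => ?_⟩
  · refine squeeze_zero_norm' (a := fun i => (4 * c + Real.pi ^ 2 * c) / β ^ 2
      * ((Λ' i).card : ℝ)⁻¹) ?_ (by simpa using hinv.const_mul ((4 * c + Real.pi ^ 2 * c) / β ^ 2))
    filter_upwards [hne] with i hi
    exact abs_centered_flip_le hβ hJ (hsub i) hi fun Λ hΛ => (hc Λ hΛ).2
  -- Positivity of `a` keeps the inverse volume ratio convergent, so the term with the outer volume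
  -- still vanishes.
  · have hr := (hratio.inv₀ ha.ne').mul hinv
    have hlim₀ := ((hr.const_mul (4 * β ^ 2 * c)).add
      (hinv.const_mul (β ^ 2 * Real.pi ^ 2 * c))).add
      (hsqrt.const_mul (4 * β ^ 3 * Real.pi * c * (Real.pi + 2 * c / β)))
    simp only [mul_zero, add_zero] at hlim₀
    refine squeeze_zero_norm' ?_ hlim₀
    filter_upwards [hne] with i hi
    exact abs_full_flip_le hβ hJ (hsub i) hi (fun Λ hΛ => (hc Λ hΛ).1) fun Λ hΛ => (hc Λ hΛ).2
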